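/- **Setting.** Let $\mathcal N$ be a countably infinite set of names. A nominal set carries an action of the permutations of $\mathcal N$ such that every element $X$ has a finite support $n(X)$; $a\# X$ means $a\notin n(X)$. Terms ${\bf T}\supseteq\mathcal N$, conditions ${\bf C}$ and assertions ${\bf A}$ are nominal sets. A substitution $\sigma$ is a map $\mathcal N\to{\bf T}$ that moves only finitely many names; $a\#\sigma$ means that $\sigma(a)=a$ and $a\#\sigma(b)$ for all $b\neq a$. Substitutions act on ${\bf T},{\bf C},{\bf A}$ (nominal data types) with the usual laws: the action is equivariant, $a\sigma=\sigma(a)$ for names $a$, $X\sigma$ depends only on $\sigma|_{n(X)}$, renaming along a permutation $\pi$ is $\pi\cdot X$, $(X\sigma)\tau=X(\sigma\tau)$ where $(\sigma\tau)(a)=\sigma(a)\tau$, and $n(\sigma(a))\subseteq n(X\sigma)$ for $a\in n(X)$. A psi-calculus has equivariant operators $\dot\leftrightarrow:{\bf T}\times{\bf T}\to{\bf C}$, $\otimes:{\bf A}\times{\bf A}\to{\bf A}$, ${\bf 1}\in{\bf A}$, ${\vdash}\subseteq{\bf A}\times{\bf C}$, the first three commuting with substitution. Write $\Psi\simeq\Psi'$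 if $\Psi,\Psi'$ entail the same conditions. It is required that $\dot\leftrightarrow$ is symmetric and transitive under each $\Psi$, that $\Psi\vdash\varphi$ implies $\Psi\otimes\Psi'\vdash\varphi$, and that $\otimes$ preserves $\simeq$ and is associative and commutative with unit ${\bf 1}$ up to $\simeq$. **Agents**, up to alpha-equivalence: output $\overline MN.P$, input $\underline M(x).P$ ($x$ binds in $P$), $\mathbf{case}\ \varphi_1:P_1[]\cdots[]\varphi_n:P_n$, $(\nu a)P$, $P\mid Q$, $!P$ and $(\!|\Psi|\!)$. An assertion is unguarded if it is not below an input or output. There are no unguarded assertions in $P$ in $!P$, and none except $(\!|{\bf 1}|\!)=\mathbf 0$ in the branches $P_i$ of a case. Frames $\mathcal F(P)=(\nu\tilde b_P)\Psi_P$, up to alpha-equivalence: $\mathcal F((\!|\Psi|\!))=\Psi$, $\mathcal F(P\mid Q)=\mathcal F(P)\otimes\mathcal F(Q)=(\nu\tilde b_P\tilde b_Q)(\Psi_P\otimes\Psi_Q)$ (bound names chosen fresh), $\mathcal F((\nu a)P)=(\nu a)\mathcal F(P)$, and $\mathcal F(P)={\bf 1}$ otherwise. $(\nu\tilde b)\Psi\vdash\varphi$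 means $\Psi\vdash\varphi$ for an alpha-variant with $\tilde b\#\varphi$; $F\simeq G$ if the frames $F,G$ entail the same conditions; $\Psi\otimes(\nu\tilde b)\Psi'=(\nu\tilde b)(\Psi\otimes\Psi')$ for $\tilde b\#\Psi$. **Concrete transitions** $\Psi\rhd P\xrightarrow{\alpha}P'$, with $\alpha$ one of $\tau$, $\underline M(x)$, $\overline M(\nu\tilde a)N$; $\mathrm{bn}(\alpha)$ is $\emptyset$, $\{x\}$, $\tilde a$ respectively and belongs to the support of $\alpha$; transitions are identified up to alpha-conversion of $\mathrm{bn}(\alpha)$, which binds into the object and $P'$. Below, $\mathcal F(P)=(\nu\tilde b_P)\Psi_P$ and $\mathcal F(Q)=(\nu\tilde b_Q)\Psi_Q$. Rules: - In: if $\Psi\vdash M\dot\leftrightarrow K$ then $\Psi\rhd\underline M(x).P\xrightarrow{\underline K(x)}P$. Out: if $\Psi\vdash M\dot\leftrightarrow K$ then $\Psi\rhd\overline MN.P\xrightarrow{\overline KN}P$. Case: from $\Psi\rhd P_i\xrightarrow{\alpha}P'$ and $\Psi\vdash\varphi_i$ infer $\Psi\rhd\mathbf{case}\ \tilde\varphi:\tilde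 P\xrightarrow{\alpha}P'$. - Com (and its mirror image): from $\Psi_Q\otimes\Psi\rhd P\xrightarrow{\overline M(\nu\tilde a)N}P'$, $\Psi_P\otimes\Psi\rhd Q\xrightarrow{\underline K(x)}Q'$, $\Psi\otimes\Psi_P\otimes\Psi_Q\vdash M\dot\leftrightarrow K$, $\tilde a\#Q$, infer $\Psi\rhd P\mid Q\xrightarrow{\tau}(\nu\tilde a)(P'\mid Q'[N/x])$; here $\tilde b_P\#\Psi,\tilde b_Q,Q,M,P$ and $\tilde b_Q\#\Psi,\tilde b_P,P,K,Q$. - Par (and mirror image): from $\Psi_Q\otimes\Psi\rhd P\xrightarrow{\alpha}P'$ infer $\Psi\rhd P\mid Q\xrightarrow{\alpha}P'\mid Q$ if $\mathrm{bn}(\alpha)\#Q$, $\tilde b_Q\#\Psi,P,\alpha$. - Scope: from $\Psi\rhd P\xrightarrow{\alpha}P'$ infer $\Psi\rhd(\nu b)P\xrightarrow{\alpha}(\nu b)P'$ if $b\#\alpha,\Psi$. Open: from $\Psi\rhd P\xrightarrow{\overline M(\nu\tilde a)N}P'$ infer $\Psi\rhd(\nu b)P\xrightarrow{\overline M(\nu\tilde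 a')N}P'$ if $b\#\tilde a,\Psi,M$ and $b\in n(N)$, where $\tilde a'$ is $\tilde a$ with $b$ inserted anywhere. Rep: from $\Psi\rhd P\mid{!P}\xrightarrow{\alpha}P'$ infer $\Psi\rhd{!P}\xrightarrow{\alpha}P'$. **Concrete (early) bisimulation**: a relation $\mathcal R\subseteq{\bf A}\times\mathrm{Agents}\times\mathrm{Agents}$ such that $(\Psi,P,Q)\in\mathcal R$ implies (1) $\Psi\otimes\mathcal F(P)\simeq\Psi\otimes\mathcal F(Q)$; (2) $(\Psi,Q,P)\in\mathcal R$; (3) $(\Psi\otimes\Psi',P,Q)\in\mathcal R$ for all $\Psi'$; (4) whenever $\Psi\rhd P\xrightarrow{\alpha}P'$ with $\mathrm{bn}(\alpha)\#\Psi,Q$: if $\alpha=\underline M(x)$, then for every term $L$ there is $Q'$ with $\Psi\rhd Q\xrightarrow{\alpha}Q'$ and $(\Psi,P'[L/x],Q'[L/x])\in\mathcal R$; otherwise there is $Q'$ with $\Psi\rhd Q\xrightarrow{\alpha}Q'$ and $(\Psi,P',Q')\in\mathcal R$. **Constraints.** An atomic constraint $(\nu\tilde a)\{\Psi\vdash\varphi\}$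 has as solutions the pairs $(\sigma,\Psi')$ with $\tilde a\#\sigma,\Psi'$ and $\Psi\sigma\otimes\Psi'\vdash\varphi\sigma$. The names $\tilde a$ do not count as free, but they are kept as written (atomic constraints are not identified up to alpha-conversion). Transition constraints are finite conjunctions of atomic constraints; $(\nu\tilde a)$ distributes over conjunction. Constraints are the transition constraints, $\{M=N\}$ (solutions: $M\sigma=N\sigma$), $\{a\#X\}$ for $X$ an agent or an element of any nominal data type (solutions: $a\#X\sigma$), and conjunctions of constraints. $(\sigma,\Psi)\models C$ means that $(\sigma,\Psi)$ is a solution of $C$; a conjunction is solved by the common solutions. $C\Rightarrow D$ means that every solution of $C$ solves $D$, and $C\Rightarrow\bigvee\widehat C$ that every solution of $C$ solves some member of the set $\widehat C$. **Symbolic transitions** $\Psi\rhd P\xrightarrow[C]{\alpha}P'$ have names as subjects and a transition constraint $C$. Conjunction is read as forming finite lists of atomic constraints, the constraint on the subject coming first. Rules: - In: $\Psi\rhd\underline M(x).P\xrightarrow[\{\Psi\vdash M\dot\leftrightarrow y\}]{\underline y(x)}P$ if $y\#\Psi,M,P,x$. Out: $\Psi\rhd\overline MN.P\xrightarrow[\{\Psi\vdash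 M\dot\leftrightarrow y\}]{\overline yN}P$ if $y\#\Psi,M,N,P$. Case: from $\Psi\rhd P_i\xrightarrow[C]{\alpha}P'$ infer $\Psi\rhd\mathbf{case}\ \tilde\varphi:\tilde P\xrightarrow[C\wedge\{\Psi\vdash\varphi_i\}]{\alpha}P'$. - Com (and mirror image): let $\Psi'=\Psi\otimes\Psi_P\otimes\Psi_Q$. From $\Psi\otimes\Psi_Q\rhd P\xrightarrow[(\nu\tilde c_P)\{\Psi_1\vdash M_P\dot\leftrightarrow y\}\wedge C_P]{\overline y(\nu\tilde a)N}P'$ and $\Psi\otimes\Psi_P\rhd Q\xrightarrow[(\nu\tilde c_Q)\{\Psi_2\vdash M_Q\dot\leftrightarrow z\}\wedge C_Q]{\underline z(x)}Q'$ infer $\Psi\rhd P\mid Q\xrightarrow[(\nu\tilde c_P\tilde c_Q)\{\Psi'\vdash M_P\dot\leftrightarrow M_Q\}\wedge C_P\wedge C_Q]{\tau}(\nu\tilde a)(P'\mid Q'[N/x])$, provided that $\Psi_1\sigma\simeq\Psi'\sigma\simeq\Psi_2\sigma$ for all $\sigma$; $\tilde b_P\subseteq\tilde c_P$, $\tilde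 b_Q\subseteq\tilde c_Q$; $\tilde b_P\#P$, $\tilde b_Q\#Q$; $\tilde c_P\#\Psi,Q,M_Q,\tilde c_Q$ and $\tilde c_Q\#\Psi,P,M_P,\tilde c_P$; $\tilde a\#Q$; $y\neq z$ and $y,z\#\Psi,P,Q,N,M_P,M_Q,\tilde c_P,\tilde c_Q,\tilde a$. - Par (and mirror image): from $\Psi\otimes\Psi_Q\rhd P\xrightarrow[C]{\alpha}P'$ infer $\Psi\rhd P\mid Q\xrightarrow[(\nu\tilde b_Q)C]{\alpha}P'\mid Q$ if $\mathrm{bn}(\alpha)\#Q$, the subject of $\alpha$ (if any) is fresh for $Q$, and $\tilde b_Q\#\Psi,P,\alpha$. - Scope: from $\Psi\rhd P\xrightarrow[C]{\alpha}P'$ infer $\Psi\rhd(\nu a)P\xrightarrow[(\nu a)C]{\alpha}(\nu a)P'$ if $a\#\alpha,\Psi$. Open: from $\Psi\rhd P\xrightarrow[C]{\overline y(\nu\tilde a)N}P'$ infer $\Psi\rhd(\nu a)P\xrightarrow[(\nu a)C]{\overline y(\nu\tilde a')N}P'$ if $a\in n(N)$ and $a\#\tilde a,\Psi,y$, with $\tilde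 a'$ being $\tilde a$ with $a$ inserted anywhere. Rep: from $\Psi\rhd P\mid{!P}\xrightarrow[C]{\alpha}P'$ infer $\Psi\rhd{!P}\xrightarrow[C]{\alpha}P'$. **(Early) symbolic bisimulation**: a relation $\mathcal S$ between constraints and pairs of agents such that $(C,P,Q)\in\mathcal S$ implies (1) $\Psi\otimes\mathcal F(P)\sigma\simeq\Psi\otimes\mathcal F(Q)\sigma$ for every solution $(\sigma,\Psi)$ of $C$; (2) $(C,Q,P)\in\mathcal S$; (3) whenever ${\bf 1}\rhd P\xrightarrow[C_P]{\alpha}P'$ with $\mathrm{bn}(\alpha)$ fresh for $P,Q,C,C_P$ and the subject of $\alpha$, and the subject of $\alpha$ (if any) fresh for $P,Q,C$, there is a set $\widehat C$ of constraints with $C\wedge C_P\Rightarrow\bigvee\widehat C$ such that for every $C'\in\widehat C$ there are $Q',\alpha',C_Q$ with ${\bf 1}\rhd Q\xrightarrow[C_Q]{\alpha'}Q'$, $C'\Rightarrow C_Q$, and: if $\alpha=\overline y(\nu\tilde a)N$, then $\alpha'=\overline y(\nu\tilde a)N'$ for some $N'$ with $C'\Rightarrow\{N=N'\}$, and $(C'\wedge\{\tilde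 a\#P,Q\},P',Q')\in\mathcal S$; otherwise $\alpha'=\alpha$ and $(C',P',Q')\in\mathcal S$. **Theorem (Completeness).** Let $\mathcal R$ be a concrete bisimulation that is definable by constraints: for all agents $P,Q$ there is a constraint $C$ such that for all $(\sigma,\Psi)$, $(\sigma,\Psi)\models C\iff(\Psi,P\sigma,Q\sigma)\in\mathcal R$. Then $$\mathcal S=\{(C,P,Q):(\Psi,P\sigma,Q\sigma)\in\mathcal R\text{ for every solution }(\sigma,\Psi)\text{ of }C\}$$ is a symbolic bisimulation. -/

import Mathlib

universe u v

namespace Psi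

/-! ### Names, nominal sets and substitution -/

/-- The countably infinite set of names. -/
abbrev Name : Type := ℕ

/-- Permutations of names. -/
abbrev NPerm : Type := Equiv.Perm Name

/-- A nominal set: names can be permuted (in particular swapped) in its elements, and every element
has a finite support. -/
class NominalSet (X : Type u) extends MulAction NPerm X where
  exists_support : ∀ x : X, ∃ S : Finset Name, MulAction.Supports NPerm (S : Set Name) x

/-- `Fresh a x`: the name `a` is not in the (least) support of `x`. -/
def Fresh {X : Type v} [MulAction NPerm X] (a : Name) (x : X) : Prop :=
  ∃ S : Finset Name, a ∉ S ∧ MulAction.Supports NPerm (S : Set Name) x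

/-- `a ∈ n(x)`: the name `a` occurs in the support of `x`. -/
def Occurs {X : Type v} [MulAction NPerm X] (a : Name) (x : X) : Prop := ¬ Fresh a x

/-- All names of the sequence `l` are fresh for `x`. -/
def FreshAll {X : Type v} [MulAction NPerm X] (l : List Name) (x : X) : Prop :=
  ∀ a ∈ l, Fresh a x

/-- The names are among the terms. -/
class NamedTerms (T : Type u) [NominalSet T] where
  var : Name → T
  var_injective : Function.Injective var
  smul_var : ∀ (π : NPerm) (a : Name), π • var a = var (π a)

open NamedTerms (var)

/-- A substitution of terms for names: it moves only finitely many names. -/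
structure Substn (T : Type u) [NominalSet T] [NamedTerms T] where
  toFun : Name → T
  finite_dom : {a | toFun a ≠ var a}.Finite

namespace Substn

variable {T : Type u} [NominalSet T] [NamedTerms T]

instance : CoeFun (Substn T) (fun _ => Name → T) := ⟨Substn.toFun⟩

/-- `a # σ`: the name `a` is not moved by `σ` and occurs in no term substituted for another
name. -/
def Fresh (a : Name) (σ : Substn T) : Prop :=
  σ a = var a ∧ ∀ b, b ≠ a → Psi.Fresh a (σ b)

/-- The identity substitution. -/
def id : Substn T := ⟨var, by simp⟩

open Classical in
/-- A substitution that agrees with `f` on the finite set `S` and moves no other name. -/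
noncomputable def ofFinite (S : Set Name) (hS : S.Finite) (f : Name → T) : Substn T where
  toFun a := if a ∈ S then f a else var a
  finite_dom := hS.subset (fun a ha => by
    by_contra h
    exact ha (if_neg h))

/-- `σ · [L/x]`: sends `x` to `L` and any other name `a` to `σ a`. -/
def update (σ : Substn T) (x : Name) (L : T) : Substn T where
  toFun a := if a = x then L else σ a
  finite_dom := (σ.finite_dom.insert x).subset (fun a ha => by
    by_cases h : a = x
    · exact Or.inl h
    · right
      simpa [h] using ha)

/-- `[L/x]`. -/
def single (x : Name) (L : T) : Substn T := id.update x L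

end Substn

/-- A type that carries a substitution function of terms for names. -/
class HasSubst (T X : Type u) [NominalSet T] [NamedTerms T] where
  subst : X → Substn T → X

open HasSubst (subst)

/-- The standard laws of substitution in a nominal data type: it is equivariant, depends only on
what happens to the names that occur, renames like permutations do, composes, and does not lose
any names of the substituted terms. -/
class LawfulSubst (T X : Type u) [NominalSet T] [NamedTerms T] [HasSubst T T]
    [NominalSet X] [HasSubst T X] : Prop where
  smul_subst : ∀ (π : NPerm) (σ τ : Substn T) (x : X),
    (∀ a, τ (π a) = π • σ a) → π • subst x σ = subst (π • x) τ
  subst_congr : ∀ (σ τ : Substn T) (x : X),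
    (∀ a, Occurs a x → σ a = τ a) → subst x σ = subst x τ
  subst_rename : ∀ (π : NPerm) (σ : Substn T) (x : X),
    (∀ a, Occurs a x → σ a = var (π a)) → subst x σ = π • x
  subst_subst : ∀ (σ τ ρ : Substn T) (x : X),
    (∀ a, ρ a = subst (σ a) τ) → subst (subst x σ) τ = subst x ρ
  occurs_subst : ∀ (σ : Substn T) (x : X) (a b : Name),
    Occurs a x → Occurs b (σ a) → Occurs b (subst x σ)

/-- The terms: a nominal data type that contains the names, on which substitution acts as
expected. -/
class TermType (T : Type u) extends NominalSet T, NamedTerms T, HasSubst T T, LawfulSubst T T where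
  var_subst : ∀ (σ : Substn T) (a : Name), subst (var a : T) σ = σ a

/-- A nominal data type over the terms `T`. -/
class DataType (T X : Type u) [TermType T] extends NominalSet X, HasSubst T X, LawfulSubst T X

/-- The terms are themselves a nominal data type. -/
@[reducible] def TermType.dataType (T : Type u) [TermType T] : DataType T T := { }

/-! ### Psi-calculus parameters -/

/-- Valid psi-calculus parameters over terms `T`, conditions `C` and assertions `A`. -/
structure PsiCalculus (T C A : Type u) [TermType T] [DataType T C] [DataType T A] where
  chan : T → T → C
  comp : A → A → A
  unit : A
  entails : A → C → Prop
  -- the operators are equivariant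
  smul_chan : ∀ (π : NPerm) (M N : T), π • chan M N = chan (π • M) (π • N)
  smul_comp : ∀ (π : NPerm) (Ψ Ψ' : A), π • comp Ψ Ψ' = comp (π • Ψ) (π • Ψ')
  smul_unit : ∀ π : NPerm, π • unit = unit
  smul_entails : ∀ (π : NPerm) (Ψ : A) (φ : C), entails Ψ φ → entails (π • Ψ) (π • φ)
  -- substitution distributes over the operators
  chan_subst : ∀ (σ : Substn T) (M N : T), subst (chan M N) σ = chan (subst M σ) (subst N σ)
  comp_subst : ∀ (σ : Substn T) (Ψ Ψ' : A), subst (comp Ψ Ψ') σ = comp (subst Ψ σ) (subst Ψ' σ)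
  unit_subst : ∀ σ : Substn T, subst unit σ = unit
  -- the requisites
  chan_symm : ∀ Ψ M N, entails Ψ (chan M N) → entails Ψ (chan N M)
  chan_trans : ∀ Ψ M N L,
    entails Ψ (chan M N) → entails Ψ (chan N L) → entails Ψ (chan M L)
  weakening : ∀ Ψ Ψ' φ, entails Ψ φ → entails (comp Ψ Ψ') φ
  composition : ∀ Ψ Ψ' Ψ'', (∀ φ, entails Ψ φ ↔ entails Ψ' φ) →
    ∀ φ, entails (comp Ψ Ψ'') φ ↔ entails (comp Ψ' Ψ'') φ
  identity : ∀ Ψ φ, entails (comp Ψ unit) φ ↔ entails Ψ φ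
  associativity : ∀ Ψ Ψ' Ψ'' φ,
    entails (comp (comp Ψ Ψ') Ψ'') φ ↔ entails (comp Ψ (comp Ψ' Ψ'')) φ
  commutativity : ∀ Ψ Ψ' φ, entails (comp Ψ Ψ') φ ↔ entails (comp Ψ' Ψ) φ

/-- The syntax trees of agents, before alpha-conversion. `case φ P` has `n` branches `φ i : P i`. -/
inductive RawAgent (T C A : Type u) : Type u
  | output (M N : T) (P : RawAgent T C A)
  | input (M : T) (x : Name) (P : RawAgent T C A)
  | case {n : ℕ} (φ : Fin n → C) (P : Fin n → RawAgent T C A)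
  | res (a : Name) (P : RawAgent T C A)
  | par (P Q : RawAgent T C A)
  | rep (P : RawAgent T C A)
  | assertion (Ψ : A)

/-! ### Atomic constraints and agents -/

/-- The atomic constraint `(ν a) {| Ψ ⊢ φ |}`. The names `a` are kept as they are written. -/
structure AtomicConstraint (C A : Type u) where
  names : List Name
  assertion : A
  cond : C

/-- `b # (ν a) {| Ψ ⊢ φ |}`, where the names `a` are bound. -/
def AtomicConstraint.FreshIn {C A : Type u} [MulAction NPerm C] [MulAction NPerm A] (b : Name)
    (D : AtomicConstraint C A) : Prop :=
  b ∈ D.names ∨ (Fresh b D.assertion ∧ Fresh b D.cond)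

section Agents

variable {T C A : Type u} [TermType T] [DataType T C] [DataType T A]

namespace RawAgent

/-- Permutations distribute over all constructors. -/
def perm (π : NPerm) : RawAgent T C A → RawAgent T C A
  | output M N P => output (π • M) (π • N) (P.perm π)
  | input M x P => input (π • M) (π x) (P.perm π)
  | case φ P => case (fun i => π • φ i) (fun i => (P i).perm π)
  | res a P => res (π a) (P.perm π)
  | par P Q => par (P.perm π) (Q.perm π)
  | rep P => rep (P.perm π)
  | assertion Ψ => assertion (π • Ψ)

/-- The name `a` has a free occurrence. -/
def Free (a : Name) : RawAgent T C A → Prop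
  | output M N P => Occurs a M ∨ Occurs a N ∨ P.Free a
  | input M x P => Occurs a M ∨ (a ≠ x ∧ P.Free a)
  | case φ P => ∃ i, Occurs a (φ i) ∨ (P i).Free a
  | res b P => a ≠ b ∧ P.Free a
  | par P Q => P.Free a ∨ Q.Free a
  | rep P => P.Free a
  | assertion Ψ => Occurs a Ψ

/-- A name that `σ` can be extended with at the binder `x` of `P` without captures. -/
noncomputable def freshName (P : RawAgent T C A) (x : Name) (σ : Substn T) : Name :=
  Classical.epsilon fun w => ∀ a, P.Free a → a ≠ x → Fresh w (σ a)

/-- Capture-avoiding substitution: bound names are first converted to fresh ones. -/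
noncomputable def rsubst : RawAgent T C A → Substn T → RawAgent T C A
  | output M N P, σ => output (subst M σ) (subst N σ) (P.rsubst σ)
  | input M x P, σ =>
      input (subst M σ) (freshName P x σ) (P.rsubst (σ.update x (var (freshName P x σ))))
  | case φ P, σ => case (fun i => subst (φ i) σ) (fun i => (P i).rsubst σ)
  | res a P, σ => res (freshName P a σ) (P.rsubst (σ.update a (var (freshName P a σ))))
  | par P Q, σ => par (P.rsubst σ) (Q.rsubst σ)
  | rep P, σ => rep (P.rsubst σ)
  | assertion Ψ, σ => assertion (subst Ψ σ)

/-- All unguarded assertions (those not below an input or an output) satisfy `p`. -/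
def Unguarded (p : A → Prop) : RawAgent T C A → Prop
  | output _ _ _ => True
  | input _ _ _ => True
  | case _ P => ∀ i, (P i).Unguarded p
  | res _ P => P.Unguarded p
  | par P Q => P.Unguarded p ∧ Q.Unguarded p
  | rep P => P.Unguarded p
  | assertion Ψ => p Ψ

/-- There are no unguarded assertions in a replication, and none but the unit (the inactive agent)
in the branches of a case. -/
def WellFormed (psi : PsiCalculus T C A) : RawAgent T C A → Prop
  | output _ _ P => P.WellFormed psi
  | input _ _ P => P.WellFormed psi
  | case _ P => ∀ i, (P i).WellFormed psi ∧ (P i).Unguarded (fun Ψ => Ψ = psi.unit)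
  | res _ P => P.WellFormed psi
  | par P Q => P.WellFormed psi ∧ Q.WellFormed psi
  | rep P => P.WellFormed psi ∧ P.Unguarded (fun _ => False)
  | assertion _ => True

theorem perm_one (P : RawAgent T C A) : P.perm 1 = P := by
  induction P <;> simp_all [perm]

theorem perm_mul (π ρ : NPerm) (P : RawAgent T C A) : P.perm (π * ρ) = (P.perm ρ).perm π := by
  induction P <;> simp_all [perm, mul_smul]

instance : MulAction NPerm (RawAgent T C A) where
  smul := perm
  one_smul := perm_one
  mul_smul := perm_mul

theorem smul_def (π : NPerm) (P : RawAgent T C A) : π • P = P.perm π := rfl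

/-- Alpha-equivalence: the least congruence that allows bound names to be converted. -/
inductive Alpha : RawAgent T C A → RawAgent T C A → Prop
  | refl (P) : Alpha P P
  | symm {P Q} : Alpha P Q → Alpha Q P
  | trans {P Q R} : Alpha P Q → Alpha Q R → Alpha P R
  | output (M N) {P Q} : Alpha P Q → Alpha (output M N P) (output M N Q)
  | input (M x) {P Q} : Alpha P Q → Alpha (input M x P) (input M x Q)
  | case {n : ℕ} (φ : Fin n → C) {P Q : Fin n → RawAgent T C A} :
      (∀ i, Alpha (P i) (Q i)) → Alpha (case φ P) (case φ Q)
  | res (a) {P Q} : Alpha P Q → Alpha (res a P) (res a Q)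
  | par {P P' Q Q'} : Alpha P P' → Alpha Q Q' → Alpha (par P Q) (par P' Q')
  | rep {P Q} : Alpha P Q → Alpha (rep P) (rep Q)
  | input_conv (M x z P) : ¬ P.Free z → Alpha (input M x P) (input M z (Equiv.swap x z • P))
  | res_conv (a z P) : ¬ P.Free z → Alpha (res a P) (res z (Equiv.swap a z • P))

end RawAgent

/-! #### Helper facts: alpha-equivalence is respected by permutation and substitution -/

theorem fresh_smul {X : Type v} [MulAction NPerm X] (π : NPerm) {a : Name} {x : X}
    (h : Fresh a x) : Fresh (π a) (π • x) := by
  obtain ⟨S, haS, hS⟩ := h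
  refine ⟨S.map π.toEmbedding, by simpa using haS, ?_⟩
  intro g hg
  have := hS (π⁻¹ * g * π) (fun b hb => by
    have h1 : g • (π b) = π b := hg (by simpa using hb)
    have h2 : g (π b) = π b := h1
    simp [Equiv.Perm.smul_def, h2])
  rw [mul_smul, mul_smul, inv_smul_eq_iff] at this
  exact this

theorem occurs_smul_iff {X : Type v} [MulAction NPerm X] (π : NPerm) (a : Name) (x : X) :
    Occurs (π a) (π • x) ↔ Occurs a x := by
  refine not_congr ⟨fun h => ?_, fresh_smul π⟩
  simpa using fresh_smul π⁻¹ h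

theorem finite_occurs {X : Type u} [NominalSet X] (x : X) : {a | Occurs a x}.Finite := by
  obtain ⟨S, hS⟩ := NominalSet.exists_support x
  refine S.finite_toSet.subset (fun a ha => ?_)
  by_contra h
  exact ha ⟨S, h, hS⟩

theorem fresh_var {a b : Name} (h : a ≠ b) : Fresh a (var b : T) := by
  refine ⟨{b}, by simpa using h, fun g hg => ?_⟩
  have : g • b = b := hg (by simp)
  rw [NamedTerms.smul_var]
  exact congrArg var this

/-- The general form of compatibility of substitution with renaming, for data. -/
theorem smul_subst_smul {X : Type u} [NominalSet X] [HasSubst T X] [LawfulSubst T X]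
    (π π' ρ ρ' : NPerm) (σ σ' : Substn T) (x : X)
    (h : ∀ a, Occurs a x → π • σ (ρ a) = π' • σ' (ρ' a)) :
    π • subst (ρ • x) σ = π' • subst (ρ' • x) σ' := by
  have key : ∀ (π ρ : NPerm) (σ : Substn T), π • subst (ρ • x) σ =
      subst x (Substn.ofFinite {a | Occurs a x} (finite_occurs x) fun a => π • σ (ρ a)) := by
    intro π ρ σ
    have h0 : subst (ρ • x) σ = subst x
        (Substn.ofFinite {a | Occurs a x} (finite_occurs x) fun a => σ (ρ a)) := by
      have h1 := LawfulSubst.subst_rename ρ (T := T)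
        (Substn.ofFinite {a | Occurs a x} (finite_occurs x) fun a => var (ρ a)) x
        (fun a ha => if_pos ha)
      rw [← h1]
      let μ : Substn T := Substn.ofFinite ({a | Occurs a x} ∪ {a | σ a ≠ var a})
        ((finite_occurs x).union σ.finite_dom)
        (fun a => subst ((Substn.ofFinite {a | Occurs a x} (finite_occurs x)
          fun a => (var (ρ a) : T)) a) σ)
      rw [LawfulSubst.subst_subst _ _ μ]
      · refine LawfulSubst.subst_congr _ _ _ (fun a ha => ?_)
        have e1 : μ a = _ := if_pos (Or.inl ha)
        rw [e1]
        simp only [Substn.ofFinite, Set.mem_ofPred_eq, ha, if_true]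
        exact TermType.var_subst _ _
      · intro a
        by_cases ha : a ∈ ({a | Occurs a x} ∪ {a | σ a ≠ var a} : Set Name)
        · exact if_pos ha
        · have e1 : μ a = var a := if_neg ha
          rw [e1]
          simp only [Set.mem_union, Set.mem_ofPred_eq, not_or, not_not] at ha
          simp only [Substn.ofFinite, Set.mem_ofPred_eq, ha.1, if_false]
          rw [TermType.var_subst, ha.2]
    rw [h0]
    set ν : Substn T := Substn.ofFinite {a | Occurs a x} (finite_occurs x) fun a => σ (ρ a) with hν
    have hνa : ∀ a, Occurs a x → ν a = σ (ρ a) := fun a ha => if_pos ha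
    let θ : Substn T := Substn.ofFinite {a | Occurs a (subst x ν)} (finite_occurs _)
      (fun a => var (π a))
    rw [← LawfulSubst.subst_rename π θ (subst x ν) (fun a ha => if_pos ha)]
    let μ : Substn T := Substn.ofFinite
      ({a | ν a ≠ var a} ∪ {a | θ a ≠ var a}) (ν.finite_dom.union θ.finite_dom)
      (fun a => subst (ν a) θ)
    rw [LawfulSubst.subst_subst _ _ μ]
    · refine LawfulSubst.subst_congr _ _ _ (fun a ha => ?_)
      have e0 : μ a = subst (ν a) θ := by
        by_cases hm : a ∈ ({a | ν a ≠ var a} ∪ {a | θ a ≠ var a} : Set Name)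
        · exact if_pos hm
        · have e1 : μ a = var a := if_neg hm
          simp only [Set.mem_union, Set.mem_ofPred_eq, not_or, not_not] at hm
          rw [e1, hm.1, TermType.var_subst, hm.2]
      rw [e0, LawfulSubst.subst_rename π θ (ν a)
        (fun b hb => if_pos (LawfulSubst.occurs_subst ν x a b ha hb)), hνa a ha]
      exact (if_pos ha).symm
    · intro a
      by_cases hm : a ∈ ({a | ν a ≠ var a} ∪ {a | θ a ≠ var a} : Set Name)
      · exact if_pos hm
      · have e1 : μ a = var a := if_neg hm
        simp only [Set.mem_union, Set.mem_ofPred_eq, not_or, not_not] at hm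
        rw [e1, hm.1, TermType.var_subst, hm.2]
  rw [key, key]
  refine LawfulSubst.subst_congr _ _ _ (fun a ha => ?_)
  have e1 : ∀ f : Name → T, (Substn.ofFinite {a | Occurs a x} (finite_occurs x) f) a = f a :=
    fun f => if_pos ha
  rw [e1, e1, h a ha]

namespace RawAgent

theorem free_smul_iff (π : NPerm) (a : Name) (P : RawAgent T C A) :
    (π • P).Free (π a) ↔ P.Free a := by
  rw [smul_def]
  induction P <;> simp_all [perm, Free, occurs_smul_iff]

theorem finite_free (P : RawAgent T C A) : {a | P.Free a}.Finite := by
  induction P with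
  | output M N P ih => exact (finite_occurs M).union ((finite_occurs N).union ih)
  | input M x P ih => exact (finite_occurs M).union (ih.subset fun a h => h.2)
  | case φ P ih =>
    have : {a | (case φ P).Free a} = ⋃ i, ({a | Occurs a (φ i)} ∪ {a | (P i).Free a}) := by
      ext a; simp [Free]
    rw [this]
    exact Set.finite_iUnion fun i => (finite_occurs (φ i)).union (ih i)
  | res a P ih => exact ih.subset fun a h => h.2
  | par P Q ihP ihQ => exact ihP.union ihQ
  | rep P ih => exact ih
  | assertion Ψ => exact finite_occurs Ψ

/-- There are names that are fresh for everything in a finite family. -/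
theorem exists_fresh (S : Set Name) (hS : S.Finite) (P : RawAgent T C A) (f : Name → T) :
    ∃ w, w ∉ S ∧ ∀ a, P.Free a → Fresh w (f a) := by
  have h : (S ∪ ⋃ a ∈ {a | P.Free a}, {w | Occurs w (f a)}).Finite :=
    hS.union (P.finite_free.biUnion fun a _ => finite_occurs (f a))
  obtain ⟨w, hw⟩ := h.exists_notMem
  simp only [Set.mem_union, Set.mem_iUnion, Set.mem_ofPred_eq, not_or, not_exists] at hw
  exact ⟨w, hw.1, fun a ha => not_not.mp (hw.2 a ha)⟩

theorem freshName_spec (P : RawAgent T C A) (x : Name) (σ : Substn T) :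
    ∀ a, P.Free a → a ≠ x → Fresh (freshName P x σ) (σ a) := by
  have h : ∃ w, ∀ a, P.Free a → a ≠ x → Fresh w (σ a) := by
    obtain ⟨w, -, hw⟩ := exists_fresh ∅ Set.finite_empty P σ
    exact ⟨w, fun a ha _ => hw a ha⟩
  exact Classical.epsilon_spec h

theorem Alpha.smul (π : NPerm) {P Q : RawAgent T C A} (h : Alpha P Q) :
    Alpha (π • P) (π • Q) := by
  have conj : ∀ (x z : Name) (P : RawAgent T C A),
      π • Equiv.swap x z • P = Equiv.swap (π x) (π z) • π • P := by
    intro x z P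
    rw [← mul_smul, ← mul_smul, Equiv.mul_swap_eq_swap_mul]
  induction h with
  | refl P => exact .refl _
  | symm _ ih => exact .symm ih
  | trans _ _ ih₁ ih₂ => exact .trans ih₁ ih₂
  | output M N _ ih => exact .output _ _ ih
  | input M x _ ih => exact .input _ _ ih
  | case φ _ ih => exact .case _ ih
  | res a _ ih => exact .res _ ih
  | par _ _ ih₁ ih₂ => exact .par ih₁ ih₂
  | rep _ ih => exact .rep ih
  | input_conv M x z P hz =>
    have := Alpha.input_conv (π • M) (π x) (π z) (π • P) (by rwa [free_smul_iff])
    rw [← conj] at this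
    exact this
  | res_conv a z P hz =>
    have := Alpha.res_conv (π a) (π z) (π • P) (by rwa [free_smul_iff])
    rw [← conj] at this
    exact this

theorem Alpha.input_of_swap {M : T} {x y z : Name} {P Q : RawAgent T C A}
    (hP : ¬ P.Free z) (hQ : ¬ Q.Free z)
    (h : Alpha (Equiv.swap x z • P) (Equiv.swap y z • Q)) :
    Alpha (RawAgent.input M x P) (RawAgent.input M y Q) :=
  (Alpha.input_conv M x z P hP).trans
    ((Alpha.input M z h).trans (Alpha.input_conv M y z Q hQ).symm)

theorem Alpha.res_of_swap {x y z : Name} {P Q : RawAgent T C A}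
    (hP : ¬ P.Free z) (hQ : ¬ Q.Free z)
    (h : Alpha (Equiv.swap x z • P) (Equiv.swap y z • Q)) :
    Alpha (RawAgent.res x P) (RawAgent.res y Q) :=
  (Alpha.res_conv x z P hP).trans
    ((Alpha.res z h).trans (Alpha.res_conv y z Q hQ).symm)

theorem swap_smul_term_of_fresh {a b : Name} {M : T} (ha : Fresh a M) (hb : Fresh b M) :
    Equiv.swap a b • M = M := by
  have h := LawfulSubst.subst_rename (Equiv.swap a b) (Substn.id : Substn T) M (fun c hc => by
    have h1 : c ≠ a := fun h => hc (h ▸ ha)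
    have h2 : c ≠ b := fun h => hc (h ▸ hb)
    rw [Equiv.swap_apply_of_ne_of_ne h1 h2]; rfl)
  have h' := LawfulSubst.subst_rename 1 (Substn.id : Substn T) M (fun c _ => rfl)
  rw [← h, h', one_smul]

/-- The binder case of the next lemma, on one side. -/
theorem binder_step (π ρ : NPerm) (σ : Substn T) (x w z : Name) (P : RawAgent T C A)
    (hw : ∀ a, (ρ • P).Free a → a ≠ ρ x → Fresh w (σ a))
    (hz : ∀ a, P.Free a → Fresh z (π • σ (ρ a))) (a : Name) (ha : P.Free a) :
    (Equiv.swap (π w) z * π) • (σ.update (ρ x) (var w)) (ρ a) =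
      if a = x then var z else π • σ (ρ a) := by
  by_cases h : a = x
  · subst h
    have : (σ.update (ρ a) (var w)) (ρ a) = var w := if_pos rfl
    rw [this, if_pos rfl, NamedTerms.smul_var]
    simp
  · have : (σ.update (ρ x) (var w)) (ρ a) = σ (ρ a) := if_neg (by simpa using h)
    rw [this, if_neg h, mul_smul]
    exact swap_smul_term_of_fresh
      (fresh_smul π (hw _ ((free_smul_iff ρ a P).mpr ha) (by simpa using h))) (hz a ha)

/-- The general form of compatibility of substitution with renaming, for agents. -/
theorem alpha_smul_rsubst_smul (P : RawAgent T C A) (π π' ρ ρ' : NPerm) (σ σ' : Substn T)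
    (h : ∀ a, P.Free a → π • σ (ρ a) = π' • σ' (ρ' a)) :
    Alpha (π • (ρ • P).rsubst σ) (π' • (ρ' • P).rsubst σ') := by
  induction P generalizing π π' ρ ρ' σ σ' with
  | output M N P ih =>
    have h1 := smul_subst_smul π π' ρ ρ' σ σ' M fun a ha => h a (Or.inl ha)
    have h2 := smul_subst_smul π π' ρ ρ' σ σ' N fun a ha => h a (Or.inr (Or.inl ha))
    have h3 := ih π π' ρ ρ' σ σ' fun a ha => h a (Or.inr (Or.inr ha))
    simp only [smul_def, perm, rsubst] at h3 ⊢
    rw [h1, h2]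
    exact .output _ _ h3
  | input M x P ih =>
    have h1 := smul_subst_smul π π' ρ ρ' σ σ' M fun a ha => h a (Or.inl ha)
    simp only [smul_def, perm, rsubst]
    rw [h1]
    simp only [← smul_def]
    set w := freshName (ρ • P) (ρ x) σ
    set w' := freshName (ρ' • P) (ρ' x) σ'
    obtain ⟨z, hz, hzf⟩ := exists_fresh
      ({a | (π • (ρ • P).rsubst (σ.update (ρ x) (var w))).Free a} ∪
        {a | (π' • (ρ' • P).rsubst (σ'.update (ρ' x) (var w'))).Free a} ∪
        ⋃ a ∈ {a | P.Free a}, {z | Occurs z (π' • σ' (ρ' a))})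
      (((finite_free _).union (finite_free _)).union
        (P.finite_free.biUnion fun a _ => finite_occurs _)) P (fun a => π • σ (ρ a))
    simp only [Set.mem_union, Set.mem_iUnion, Set.mem_ofPred_eq, not_or, not_exists] at hz
    refine Alpha.input_of_swap hz.1.1 hz.1.2 ?_
    rw [← mul_smul, ← mul_smul]
    refine ih _ _ _ _ _ _ fun a ha => ?_
    rw [binder_step π ρ σ x w z P (freshName_spec _ _ _) hzf a ha,
      binder_step π' ρ' σ' x w' z P (freshName_spec _ _ _)
        (fun a ha => not_not.mp (hz.2 a ha)) a ha]
    split_ifs with hax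
    · rfl
    · exact h a (Or.inr ⟨hax, ha⟩)
  | case φ P ih =>
    have h1 := fun i => smul_subst_smul π π' ρ ρ' σ σ' (φ i) fun a ha => h a ⟨i, Or.inl ha⟩
    have h3 := fun i => ih i π π' ρ ρ' σ σ' fun a ha => h a ⟨i, Or.inr ha⟩
    simp only [smul_def, perm, rsubst] at h3 ⊢
    simp only [h1]
    exact .case _ h3
  | res x P ih =>
    simp only [smul_def, perm, rsubst]
    simp only [← smul_def]
    set w := freshName (ρ • P) (ρ x) σ
    set w' := freshName (ρ' • P) (ρ' x) σ'
    obtain ⟨z, hz, hzf⟩ := exists_fresh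
      ({a | (π • (ρ • P).rsubst (σ.update (ρ x) (var w))).Free a} ∪
        {a | (π' • (ρ' • P).rsubst (σ'.update (ρ' x) (var w'))).Free a} ∪
        ⋃ a ∈ {a | P.Free a}, {z | Occurs z (π' • σ' (ρ' a))})
      (((finite_free _).union (finite_free _)).union
        (P.finite_free.biUnion fun a _ => finite_occurs _)) P (fun a => π • σ (ρ a))
    simp only [Set.mem_union, Set.mem_iUnion, Set.mem_ofPred_eq, not_or, not_exists] at hz
    refine Alpha.res_of_swap hz.1.1 hz.1.2 ?_
    rw [← mul_smul, ← mul_smul]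
    refine ih _ _ _ _ _ _ fun a ha => ?_
    rw [binder_step π ρ σ x w z P (freshName_spec _ _ _) hzf a ha,
      binder_step π' ρ' σ' x w' z P (freshName_spec _ _ _)
        (fun a ha => not_not.mp (hz.2 a ha)) a ha]
    split_ifs with hax
    · rfl
    · exact h a ⟨hax, ha⟩
  | par P Q ihP ihQ =>
    exact .par (ihP π π' ρ ρ' σ σ' fun a ha => h a (Or.inl ha))
      (ihQ π π' ρ ρ' σ σ' fun a ha => h a (Or.inr ha))
  | rep P ih => exact .rep (ih π π' ρ ρ' σ σ' h)
  | assertion Ψ =>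
    have h1 := smul_subst_smul π π' ρ ρ' σ σ' Ψ h
    simp only [smul_def, perm, rsubst]
    rw [h1]
    exact .refl _

/-- Converting the bound name `x` of `P`, extended with the chosen name, to the fresh name `z`. -/
theorem alpha_swap_rsubst (P : RawAgent T C A) (σ : Substn T) (x z : Name)
    (hz : ∀ a, P.Free a → Fresh z (σ a)) :
    Alpha (Equiv.swap (freshName P x σ) z • P.rsubst (σ.update x (var (freshName P x σ))))
      (P.rsubst (σ.update x (var z))) := by
  have := alpha_smul_rsubst_smul P (Equiv.swap (freshName P x σ) z * 1) 1 1 1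
    (σ.update x (var (freshName P x σ))) (σ.update x (var z)) (fun a ha => by
      have hw : ∀ a, ((1 : NPerm) • P).Free a → a ≠ (1 : NPerm) x →
          Fresh (freshName P x σ) (σ a) := by
        simpa using freshName_spec P x σ
      have := binder_step 1 1 σ x (freshName P x σ) z P hw (by simpa using hz) a ha
      simp only [Equiv.Perm.one_apply, one_smul] at this ⊢
      exact this)
  simpa using this

theorem Alpha.rsubst {P Q : RawAgent T C A} (h : Alpha P Q) (σ : Substn T) :
    Alpha (P.rsubst σ) (Q.rsubst σ) := by
  have pick : ∀ (P Q R S : RawAgent T C A) (σ : Substn T), ∃ z, ¬ R.Free z ∧ ¬ S.Free z ∧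
      (∀ a, P.Free a → Fresh z (σ a)) ∧ (∀ a, Q.Free a → Fresh z (σ a)) := by
    intro P Q R S σ
    obtain ⟨z, hz, hzf⟩ := exists_fresh
      ({a | R.Free a} ∪ {a | S.Free a} ∪ ⋃ a ∈ {a | Q.Free a}, {z | Occurs z (σ a)})
      ((R.finite_free.union S.finite_free).union
        (Q.finite_free.biUnion fun a _ => finite_occurs _)) P σ
    simp only [Set.mem_union, Set.mem_iUnion, Set.mem_ofPred_eq, not_or, not_exists] at hz
    exact ⟨z, hz.1.1, hz.1.2, hzf, fun a ha => not_not.mp (hz.2 a ha)⟩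
  have conv : ∀ (P : RawAgent T C A) (x y z : Name) (σ : Substn T), ¬ P.Free y →
      Alpha (P.rsubst (σ.update x (var z)))
        ((Equiv.swap x y • P).rsubst (σ.update y (var z))) := by
    intro P x y z σ hy
    have := alpha_smul_rsubst_smul P 1 1 1 (Equiv.swap x y) (σ.update x (var z))
      (σ.update y (var z)) (fun a ha => by
        by_cases hax : a = x
        · subst hax; simp [Substn.update]
        · have hay : a ≠ y := fun h => hy (h ▸ ha)
          simp [Substn.update, Equiv.swap_apply_of_ne_of_ne hax hay, hax, hay])
    simpa using this
  induction h generalizing σ with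
  | refl P => exact .refl _
  | symm _ ih => exact .symm (ih σ)
  | trans _ _ ih₁ ih₂ => exact .trans (ih₁ σ) (ih₂ σ)
  | output M N _ ih => exact .output _ _ (ih σ)
  | input M x _ ih =>
    obtain ⟨z, h1, h2, h3, h4⟩ := pick _ _ _ _ σ
    exact Alpha.input_of_swap h1 h2 ((alpha_swap_rsubst _ σ x z h3).trans
      ((ih _).trans (alpha_swap_rsubst _ σ x z h4).symm))
  | case φ _ ih => exact .case _ fun i => ih i σ
  | res a _ ih =>
    obtain ⟨z, h1, h2, h3, h4⟩ := pick _ _ _ _ σ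
    exact Alpha.res_of_swap h1 h2 ((alpha_swap_rsubst _ σ a z h3).trans
      ((ih _).trans (alpha_swap_rsubst _ σ a z h4).symm))
  | par _ _ ih₁ ih₂ => exact .par (ih₁ σ) (ih₂ σ)
  | rep _ ih => exact .rep (ih σ)
  | input_conv M x y P hy =>
    obtain ⟨z, h1, h2, h3, h4⟩ := pick _ _ _ _ σ
    exact Alpha.input_of_swap h1 h2 ((alpha_swap_rsubst _ σ x z h3).trans
      ((conv P x y z σ hy).trans (alpha_swap_rsubst _ σ y z h4).symm))
  | res_conv x y P hy =>
    obtain ⟨z, h1, h2, h3, h4⟩ := pick _ _ _ _ σ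
    exact Alpha.res_of_swap h1 h2 ((alpha_swap_rsubst _ σ x z h3).trans
      ((conv P x y z σ hy).trans (alpha_swap_rsubst _ σ y z h4).symm))

theorem unguarded_smul (p : A → Prop) (hp : ∀ (π : NPerm) Ψ, p Ψ → p (π • Ψ)) (π : NPerm)
    (P : RawAgent T C A) (h : P.Unguarded p) : (π • P).Unguarded p := by
  rw [smul_def]
  induction P <;> simp_all [perm, Unguarded]

theorem unguarded_rsubst (p : A → Prop) (hp : ∀ (σ : Substn T) Ψ, p Ψ → p (subst Ψ σ))
    (P : RawAgent T C A) (σ : Substn T) (h : P.Unguarded p) : (P.rsubst σ).Unguarded p := by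
  induction P generalizing σ <;> simp_all [rsubst, Unguarded]

theorem unguarded_smul_iff (p : A → Prop) (hp : ∀ (π : NPerm) Ψ, p Ψ → p (π • Ψ)) (π : NPerm)
    (P : RawAgent T C A) : (π • P).Unguarded p ↔ P.Unguarded p :=
  ⟨fun h => by simpa using unguarded_smul p hp π⁻¹ _ h, unguarded_smul p hp π P⟩

theorem Alpha.unguarded_iff (p : A → Prop) (hp : ∀ (π : NPerm) Ψ, p Ψ → p (π • Ψ))
    {P Q : RawAgent T C A} (h : Alpha P Q) : P.Unguarded p ↔ Q.Unguarded p := by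
  induction h with
  | res_conv a z P hz => exact (unguarded_smul_iff p hp _ P).symm
  | _ => simp_all [Unguarded]

theorem wellFormed_smul (psi : PsiCalculus T C A) (π : NPerm) (P : RawAgent T C A)
    (h : P.WellFormed psi) : (π • P).WellFormed psi := by
  induction P with
  | output M N P ih => exact ih h
  | input M x P ih => exact ih h
  | case φ P ih => exact fun i => ⟨ih i (h i).1, unguarded_smul _
      (fun π Ψ hΨ => by rw [hΨ, psi.smul_unit]) π _ (h i).2⟩
  | res a P ih => exact ih h
  | par P Q ihP ihQ => exact ⟨ihP h.1, ihQ h.2⟩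
  | rep P ih => exact ⟨ih h.1, unguarded_smul _ (fun _ _ h => h) π _ h.2⟩
  | assertion Ψ => trivial

theorem wellFormed_rsubst (psi : PsiCalculus T C A) (P : RawAgent T C A) (σ : Substn T)
    (h : P.WellFormed psi) : (P.rsubst σ).WellFormed psi := by
  induction P generalizing σ with
  | output M N P ih => exact ih _ h
  | input M x P ih => exact ih _ h
  | case φ P ih => exact fun i => ⟨ih i _ (h i).1, unguarded_rsubst _
      (fun σ Ψ hΨ => by rw [hΨ, psi.unit_subst]) _ _ (h i).2⟩
  | res a P ih => exact ih _ h
  | par P Q ihP ihQ => exact ⟨ihP _ h.1, ihQ _ h.2⟩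
  | rep P ih => exact ⟨ih _ h.1, unguarded_rsubst _ (fun _ _ h => h) _ _ h.2⟩
  | assertion Ψ => trivial

theorem Alpha.wellFormed_iff (psi : PsiCalculus T C A) {P Q : RawAgent T C A} (h : Alpha P Q) :
    P.WellFormed psi ↔ Q.WellFormed psi := by
  have smul_iff : ∀ (π : NPerm) (P : RawAgent T C A),
      (π • P).WellFormed psi ↔ P.WellFormed psi := fun π P =>
    ⟨fun h => by simpa using wellFormed_smul psi π⁻¹ _ h, wellFormed_smul psi π P⟩
  induction h with
  | refl P => exact Iff.rfl
  | symm _ ih => exact ih.symm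
  | trans _ _ ih₁ ih₂ => exact ih₁.trans ih₂
  | output M N _ ih => exact ih
  | input M x _ ih => exact ih
  | case φ hP ih => exact forall_congr' fun i => and_congr (ih i) <|
      ((hP i).unguarded_iff _ (fun π Ψ hΨ => by rw [hΨ, psi.smul_unit]))
  | res a _ ih => exact ih
  | par _ _ ih₁ ih₂ => exact and_congr ih₁ ih₂
  | rep hP ih => exact and_congr ih (hP.unguarded_iff _ fun _ _ h => h)
  | input_conv M x z P hz => exact (smul_iff _ P).symm
  | res_conv a z P hz => exact (smul_iff _ P).symm

end RawAgent

/-! #### Agents up to alpha-equivalence -/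

variable (T C A) in
/-- Alpha-equivalence as a setoid. -/
def alphaSetoid : Setoid (RawAgent T C A) :=
  ⟨RawAgent.Alpha, RawAgent.Alpha.refl, RawAgent.Alpha.symm, RawAgent.Alpha.trans⟩

variable (T C A) in
/-- Syntax trees up to alpha-equivalence (not necessarily well-formed). -/
def PreAgent : Type u := Quotient (alphaSetoid T C A)

namespace PreAgent

/-- The alpha-equivalence class of a syntax tree. -/
def mk (P : RawAgent T C A) : PreAgent T C A := Quotient.mk (alphaSetoid T C A) P

/-- `M̄ N . P` -/
def output (M N : T) (P : PreAgent T C A) : PreAgent T C A :=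
  Quotient.map' (RawAgent.output M N) (fun _ _ h => .output M N h) P

/-- `M(x) . P` -/
def input (M : T) (x : Name) (P : PreAgent T C A) : PreAgent T C A :=
  Quotient.map' (RawAgent.input M x) (fun _ _ h => .input M x h) P

/-- `case φ₁ : P₁ [] ⋯ [] φₙ : Pₙ` -/
noncomputable def case {n : ℕ} (φ : Fin n → C) (P : Fin n → PreAgent T C A) : PreAgent T C A :=
  mk (RawAgent.case φ fun i => Quotient.out (P i))

/-- `(ν a) P` -/
def res (a : Name) (P : PreAgent T C A) : PreAgent T C A :=
  Quotient.map' (RawAgent.res a) (fun _ _ h => .res a h) P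

/-- `(ν a₁) ⋯ (ν aₙ) P` -/
def resList (a : List Name) (P : PreAgent T C A) : PreAgent T C A := a.foldr res P

/-- `P | Q` -/
def par (P Q : PreAgent T C A) : PreAgent T C A :=
  Quotient.map₂ (sa := alphaSetoid T C A) (sb := alphaSetoid T C A) (sc := alphaSetoid T C A)
    RawAgent.par (fun _ _ h _ _ h' => RawAgent.Alpha.par h h') P Q

/-- `! P` -/
def rep (P : PreAgent T C A) : PreAgent T C A :=
  Quotient.map' RawAgent.rep (fun _ _ h => .rep h) P

/-- `(| Ψ |)` -/
def assertion (Ψ : A) : PreAgent T C A := mk (RawAgent.assertion Ψ)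

theorem case_mk {n : ℕ} (φ : Fin n → C) (P : Fin n → RawAgent T C A) :
    case φ (fun i => mk (P i)) = mk (RawAgent.case φ P) :=
  Quotient.sound (s := alphaSetoid T C A)
    (.case φ fun i => Quotient.mk_out (s := alphaSetoid T C A) (P i))

instance : MulAction NPerm (PreAgent T C A) where
  smul π := Quotient.map' (s₁ := alphaSetoid T C A) (s₂ := alphaSetoid T C A)
    (fun P => π • P) (fun _ _ h => RawAgent.Alpha.smul π h)
  one_smul P := by
    induction P using Quotient.inductionOn' with
    | h P => exact congrArg mk (one_smul NPerm P)
  mul_smul π ρ P := by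
    induction P using Quotient.inductionOn' with
    | h P => exact congrArg mk (mul_smul π ρ P)

/-- Capture-avoiding substitution. -/
noncomputable def subst (P : PreAgent T C A) (σ : Substn T) : PreAgent T C A :=
  Quotient.map' (s₁ := alphaSetoid T C A) (s₂ := alphaSetoid T C A)
    (fun P => P.rsubst σ) (fun _ _ h => RawAgent.Alpha.rsubst h σ) P

/-- There are no unguarded assertions in a replication, and none but the unit (the inactive agent)
in the branches of a case. -/
def WellFormed (psi : PsiCalculus T C A) (P : PreAgent T C A) : Prop :=
  Quotient.lift (s := alphaSetoid T C A) (RawAgent.WellFormed psi)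
    (fun _ _ h => propext (RawAgent.Alpha.wellFormed_iff psi h)) P

theorem WellFormed.subst {psi : PsiCalculus T C A} {P : PreAgent T C A} (h : P.WellFormed psi)
    (σ : Substn T) : (P.subst σ).WellFormed psi := by
  induction P using Quotient.inductionOn' with
  | h P => exact RawAgent.wellFormed_rsubst psi P σ h

end PreAgent

/-- The agents of a psi-calculus. -/
def Agent (psi : PsiCalculus T C A) : Type u := {P : PreAgent T C A // P.WellFormed psi}

/-- `P σ`. -/
noncomputable def Agent.subst {psi : PsiCalculus T C A} (P : Agent psi) (σ : Substn T) :
    Agent psi := ⟨P.1.subst σ, P.2.subst σ⟩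

/-! ### Frames -/

/-- `IsFrame psi P b Ψ`: the frame of `P` is `(ν b) Ψ` up to alpha-equivalence, with distinct names
`b`. -/
inductive IsFrame (psi : PsiCalculus T C A) : PreAgent T C A → List Name → A → Prop
  | output (M N P) : IsFrame psi (.output M N P) [] psi.unit
  | input (M x P) : IsFrame psi (.input M x P) [] psi.unit
  | case {n : ℕ} (φ : Fin n → C) (P : Fin n → PreAgent T C A) :
      IsFrame psi (.case φ P) [] psi.unit
  | rep (P) : IsFrame psi (.rep P) [] psi.unit
  | assertion (Ψ) : IsFrame psi (.assertion Ψ) [] Ψ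
  | par {P Q bP bQ ΨP ΨQ} : IsFrame psi P bP ΨP → IsFrame psi Q bQ ΨQ →
      List.Disjoint bP bQ → FreshAll bP ΨQ → FreshAll bQ ΨP →
      IsFrame psi (.par P Q) (bP ++ bQ) (psi.comp ΨP ΨQ)
  | res {a P b Ψ} : IsFrame psi P b Ψ → a ∉ b → IsFrame psi (.res a P) (a :: b) Ψ

/-- `Ψ ⊗ F(P) ⊢ φ` -/
def FrameEntails (psi : PsiCalculus T C A) (Ψ : A) (P : PreAgent T C A) (φ : C) : Prop :=
  ∃ b ΨP, IsFrame psi P b ΨP ∧ FreshAll b Ψ ∧ FreshAll b φ ∧ psi.entails (psi.comp Ψ ΨP) φ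

/-- `Ψ ⊗ F(P)σ ⊢ φ` -/
def SubstFrameEntails (psi : PsiCalculus T C A) (Ψ : A) (P : PreAgent T C A) (σ : Substn T)
    (φ : C) : Prop :=
  ∃ b ΨP, IsFrame psi P b ΨP ∧ (∀ a ∈ b, σ.Fresh a) ∧ FreshAll b Ψ ∧ FreshAll b φ ∧
    psi.entails (psi.comp Ψ (subst ΨP σ)) φ

/-! ### Actions and the late concrete semantics -/

/-- Actions with subjects in `S` and objects in `T`: silent, input and (bound) output. -/
inductive Action (S : Type v) (T : Type u) : Type (max u v)
  | tau
  | inp (M : S) (x : Name)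
  | out (M : S) (a : List Name) (N : T)

namespace Action

variable {S : Type v}

/-- The subject, if there is one. -/
def subj : Action S T → Option S
  | tau => none
  | inp M _ => some M
  | out M _ _ => some M

/-- The bound names. -/
def bn : Action S T → List Name
  | tau => []
  | inp _ x => [x]
  | out _ a _ => a

/-- `b # α`, where the bound names of `α` belong to its support. -/
def Fresh [MulAction NPerm S] (b : Name) : Action S T → Prop
  | tau => True
  | inp M x => Psi.Fresh b M ∧ b ≠ x
  | out M a N => Psi.Fresh b M ∧ b ∉ a ∧ Psi.Fresh b N

end Action

/-- The late transitions `Ψ ▷ P --α--> P'`. -/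
inductive Trans (psi : PsiCalculus T C A) :
    A → PreAgent T C A → Action T T → PreAgent T C A → Prop
  | inp {Ψ M K x P} : psi.entails Ψ (psi.chan M K) →
      Trans psi Ψ (.input M x P) (.inp K x) P
  | out {Ψ M K N P} : psi.entails Ψ (psi.chan M K) →
      Trans psi Ψ (.output M N P) (.out K [] N) P
  | case {Ψ} {n : ℕ} {φ : Fin n → C} {P : Fin n → PreAgent T C A} {i α P'} :
      Trans psi Ψ (P i) α P' → psi.entails Ψ (φ i) → Trans psi Ψ (.case φ P) α P'
  | com_left {Ψ P Q bP bQ ΨP ΨQ M K a N x P' Q'} :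
      IsFrame psi P bP ΨP → IsFrame psi Q bQ ΨQ → List.Disjoint bP bQ →
      FreshAll bP Ψ → FreshAll bP Q → FreshAll bP M → FreshAll bP P →
      FreshAll bQ Ψ → FreshAll bQ P → FreshAll bQ K → FreshAll bQ Q →
      Trans psi (psi.comp ΨQ Ψ) P (.out M a N) P' →
      Trans psi (psi.comp ΨP Ψ) Q (.inp K x) Q' →
      psi.entails (psi.comp (psi.comp Ψ ΨP) ΨQ) (psi.chan M K) → FreshAll a Q →
      Trans psi Ψ (.par P Q) .tau (.resList a (.par P' (Q'.subst (.single x N))))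
  | com_right {Ψ P Q bP bQ ΨP ΨQ M K a N x P' Q'} :
      IsFrame psi P bP ΨP → IsFrame psi Q bQ ΨQ → List.Disjoint bP bQ →
      FreshAll bP Ψ → FreshAll bP Q → FreshAll bP M → FreshAll bP P →
      FreshAll bQ Ψ → FreshAll bQ P → FreshAll bQ K → FreshAll bQ Q →
      Trans psi (psi.comp ΨQ Ψ) P (.inp M x) P' →
      Trans psi (psi.comp ΨP Ψ) Q (.out K a N) Q' →
      psi.entails (psi.comp (psi.comp Ψ ΨP) ΨQ) (psi.chan M K) → FreshAll a P →
      Trans psi Ψ (.par P Q) .tau (.resList a (.par (P'.subst (.single x N)) Q'))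
  | par_left {Ψ P Q bQ ΨQ α P'} :
      IsFrame psi Q bQ ΨQ → FreshAll bQ Ψ → FreshAll bQ P → (∀ b ∈ bQ, α.Fresh b) →
      Trans psi (psi.comp ΨQ Ψ) P α P' → FreshAll α.bn Q →
      Trans psi Ψ (.par P Q) α (.par P' Q)
  | par_right {Ψ P Q bP ΨP α Q'} :
      IsFrame psi P bP ΨP → FreshAll bP Ψ → FreshAll bP Q → (∀ b ∈ bP, α.Fresh b) →
      Trans psi (psi.comp ΨP Ψ) Q α Q' → FreshAll α.bn P →
      Trans psi Ψ (.par P Q) α (.par P Q')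
  | scope {Ψ P α P' b} : Trans psi Ψ P α P' → α.Fresh b → Fresh b Ψ →
      Trans psi Ψ (.res b P) α (.res b P')
  | openRes {Ψ P M N P' b} {a₁ a₂ : List Name} : Trans psi Ψ P (.out M (a₁ ++ a₂) N) P' →
      b ∉ a₁ ++ a₂ → Fresh b Ψ → Fresh b M → Occurs b N →
      Trans psi Ψ (.res b P) (.out M (a₁ ++ b :: a₂) N) P'
  | rep {Ψ P α P'} : Trans psi Ψ (.par P (.rep P)) α P' → Trans psi Ψ (.rep P) α P'
  -- transitions are identified up to conversion of the bound names of the action, which bind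
  -- into its object and into the derivative
  | inp_conv {Ψ P M x z P'} : Trans psi Ψ P (.inp M x) P' → Fresh z P' →
      Trans psi Ψ P (.inp M z) (Equiv.swap x z • P')
  | out_conv {Ψ P M a N P' b c} : Trans psi Ψ P (.out M a N) P' →
      b ∈ a → c ∉ a → Fresh c N → Fresh c P' →
      Trans psi Ψ P (.out M (a.map (Equiv.swap b c)) (Equiv.swap b c • N))
        (Equiv.swap b c • P')

/-- (Early) bisimulations. -/
structure IsBisimulation (psi : PsiCalculus T C A) (R : A → Agent psi → Agent psi → Prop) :
    Prop where
  static : ∀ Ψ P Q, R Ψ P Q → ∀ φ, FrameEntails psi Ψ P.1 φ ↔ FrameEntails psi Ψ Q.1 φ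
  symm : ∀ Ψ P Q, R Ψ P Q → R Ψ Q P
  extension : ∀ Ψ P Q, R Ψ P Q → ∀ Ψ', R (psi.comp Ψ Ψ') P Q
  sim_inp : ∀ Ψ P Q, R Ψ P Q → ∀ M x (P' : Agent psi), Fresh x Ψ → Fresh x Q.1 →
    Trans psi Ψ P.1 (.inp M x) P'.1 → ∀ L : T, ∃ Q' : Agent psi,
      Trans psi Ψ Q.1 (.inp M x) Q'.1 ∧ R Ψ (P'.subst (.single x L)) (Q'.subst (.single x L))
  sim_other : ∀ Ψ P Q, R Ψ P Q → ∀ (α : Action T T) (P' : Agent psi), (∀ M x, α ≠ .inp M x) →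
    FreshAll α.bn Ψ → FreshAll α.bn Q.1 → Trans psi Ψ P.1 α P'.1 →
      ∃ Q' : Agent psi, Trans psi Ψ Q.1 α Q'.1 ∧ R Ψ P' Q'

/-! ### Constraints -/

/-- Transition constraints: finite conjunctions of atomic constraints. -/
abbrev TransConstraint (C A : Type u) : Type u := List (AtomicConstraint C A)

/-- `(σ, Ψ') ⊨ (ν a) {| Ψ ⊢ φ |}` -/
def AtomicConstraint.Sat (psi : PsiCalculus T C A) (D : AtomicConstraint C A) (σ : Substn T)
    (Ψ' : A) : Prop :=
  (∀ a ∈ D.names, σ.Fresh a) ∧ FreshAll D.names Ψ' ∧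
    psi.entails (psi.comp (subst D.assertion σ) Ψ') (subst D.cond σ)

/-- `(ν b) C`, which distributes over conjunctions. -/
def TransConstraint.nu (b : List Name) (D : TransConstraint C A) : TransConstraint C A :=
  D.map fun E => ⟨b ++ E.names, E.assertion, E.cond⟩

/-- The constraints. -/
inductive Constraint (psi : PsiCalculus T C A) : Type (u + 1)
  /-- transition constraints -/
  | trans (D : TransConstraint C A)
  /-- `{| M = N |}` -/
  | eq (M N : T)
  /-- `{| a # X |}` for an element `X` of a nominal data type -/
  | fresh (a : Name) {D : Type u} [DataType T D] (X : D)
  /-- `{| a # P |}` for an agent `P` -/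
  | freshAgent (a : Name) (P : Agent psi)
  /-- conjunction -/
  | and (D E : Constraint psi)

namespace Constraint

variable {psi : PsiCalculus T C A}

/-- `(σ, Ψ) ⊨ C`. -/
def Sat : Constraint psi → Substn T → A → Prop
  | trans D, σ, Ψ => ∀ E ∈ D, E.Sat psi σ Ψ
  | eq M N, σ, _ => subst M σ = subst N σ
  | fresh a X, σ, _ => Fresh a (subst X σ)
  | freshAgent a P, σ, _ => Fresh a (P.subst σ).1
  | and D E, σ, Ψ => D.Sat σ Ψ ∧ E.Sat σ Ψ

/-- `b # C`. -/
def FreshIn (b : Name) : Constraint psi → Prop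
  | trans D => ∀ E ∈ D, E.FreshIn b
  | eq M N => Fresh b M ∧ Fresh b N
  | fresh a X => b ≠ a ∧ Fresh b X
  | freshAgent a P => b ≠ a ∧ Fresh b P.1
  | and D E => D.FreshIn b ∧ E.FreshIn b

/-- `C ⇒ D`: every solution of `C` is a solution of `D`. -/
def Implies (D E : Constraint psi) : Prop := ∀ σ Ψ, D.Sat σ Ψ → E.Sat σ Ψ

/-- `C ⇒ ⋁ Ĉ`: every solution of `C` is a solution of some member of `Ĉ`. -/
def ImpliesSome (D : Constraint psi) (F : Set (Constraint psi)) : Prop :=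
  ∀ σ Ψ, D.Sat σ Ψ → ∃ E ∈ F, E.Sat σ Ψ

/-- `C ∧ {| a # P, Q |}` -/
def andFresh (D : Constraint psi) (a : List Name) (P Q : Agent psi) : Constraint psi :=
  a.foldr (fun b E => (E.and (freshAgent b P)).and (freshAgent b Q)) D

end Constraint

/-! ### The symbolic semantics -/

/-- Assertions that are equivalent under every substitution, such as those that are equal by the
laws of an abelian monoid. -/
def StablyEquivalent (psi : PsiCalculus T C A) (Ψ Ψ' : A) : Prop :=
  ∀ (σ : Substn T) (φ : C), psi.entails (subst Ψ σ) φ ↔ psi.entails (subst Ψ' σ) φ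

/-- The side conditions on the frames, the subjects and the constraints in a symbolic communication,
in an environment `Ψ`, between `P` (with frame `(ν bP) ΨP`, symbolic subject `y` and subject
constraint `(ν cP) {| ΨP' ⊢ MP ↔ y |}`) and `Q` (likewise, with subject `z`). The frame names are
among the bound names of the subject constraints. All bound names are chosen fresh, and `ΨP'`, `ΨQ'`
are `Ψ ⊗ ΨP ⊗ ΨQ` up to equivalence. -/
structure ComCondition (psi : PsiCalculus T C A) (Ψ : A) (P Q : PreAgent T C A)
    (bP bQ : List Name) (ΨP ΨQ : A) (y z : Name) (cP cQ : List Name) (ΨP' ΨQ' : A) (MP MQ : T) :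
    Prop where
  frame_left : IsFrame psi P bP ΨP
  frame_right : IsFrame psi Q bQ ΨQ
  left_sub : bP ⊆ cP
  right_sub : bQ ⊆ cQ
  disjoint : List.Disjoint cP cQ
  fresh_left : FreshAll bP P
  fresh_right : FreshAll bQ Q
  left_fresh : FreshAll cP Ψ ∧ FreshAll cP Q ∧ FreshAll cP MQ
  right_fresh : FreshAll cQ Ψ ∧ FreshAll cQ P ∧ FreshAll cQ MP
  ne : y ≠ z
  subj_fresh : ∀ w ∈ [y, z], Fresh w Ψ ∧ Fresh w P ∧ Fresh w Q ∧ w ∉ cP ∧ w ∉ cQ ∧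
    Fresh w MP ∧ Fresh w MQ
  env_left : StablyEquivalent psi ΨP' (psi.comp (psi.comp Ψ ΨP) ΨQ)
  env_right : StablyEquivalent psi ΨQ' (psi.comp (psi.comp Ψ ΨP) ΨQ)

/-- The symbolic transitions `Ψ ▷ P --α,D--> P'`, where the subject of `α` is a name and `D` is a
transition constraint. -/
inductive SymTrans (psi : PsiCalculus T C A) :
    A → PreAgent T C A → Action Name T → TransConstraint C A → PreAgent T C A → Prop
  | inp {Ψ M x P y} : Fresh y Ψ → Fresh y M → Fresh y P → y ≠ x →
      SymTrans psi Ψ (.input M x P) (.inp y x) [⟨[], Ψ, psi.chan M (var y)⟩] P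
  | out {Ψ M N P y} : Fresh y Ψ → Fresh y M → Fresh y N → Fresh y P →
      SymTrans psi Ψ (.output M N P) (.out y [] N) [⟨[], Ψ, psi.chan M (var y)⟩] P
  | case {Ψ} {n : ℕ} {φ : Fin n → C} {P : Fin n → PreAgent T C A} {i α D P'} :
      SymTrans psi Ψ (P i) α D P' →
      SymTrans psi Ψ (.case φ P) α (D ++ [⟨[], Ψ, φ i⟩]) P'
  | com_left {Ψ P Q bP bQ ΨP ΨQ y z cP cQ ΨP' ΨQ' MP MQ DP DQ a N x P' Q'} :
      ComCondition psi Ψ P Q bP bQ ΨP ΨQ y z cP cQ ΨP' ΨQ' MP MQ →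
      SymTrans psi (psi.comp Ψ ΨQ) P (.out y a N) (⟨cP, ΨP', psi.chan MP (var y)⟩ :: DP) P' →
      SymTrans psi (psi.comp Ψ ΨP) Q (.inp z x) (⟨cQ, ΨQ', psi.chan MQ (var z)⟩ :: DQ) Q' →
      FreshAll a Q → y ∉ a → z ∉ a → Fresh y N → Fresh z N →
      SymTrans psi Ψ (.par P Q) .tau
        (⟨cP ++ cQ, psi.comp (psi.comp Ψ ΨP) ΨQ, psi.chan MP MQ⟩ :: (DP ++ DQ))
        (.resList a (.par P' (Q'.subst (.single x N))))
  | com_right {Ψ P Q bP bQ ΨP ΨQ y z cP cQ ΨP' ΨQ' MP MQ DP DQ a N x P' Q'} :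
      ComCondition psi Ψ P Q bP bQ ΨP ΨQ y z cP cQ ΨP' ΨQ' MP MQ →
      SymTrans psi (psi.comp Ψ ΨQ) P (.inp y x) (⟨cP, ΨP', psi.chan MP (var y)⟩ :: DP) P' →
      SymTrans psi (psi.comp Ψ ΨP) Q (.out z a N) (⟨cQ, ΨQ', psi.chan MQ (var z)⟩ :: DQ) Q' →
      FreshAll a P → y ∉ a → z ∉ a → Fresh y N → Fresh z N →
      SymTrans psi Ψ (.par P Q) .tau
        (⟨cP ++ cQ, psi.comp (psi.comp Ψ ΨP) ΨQ, psi.chan MP MQ⟩ :: (DP ++ DQ))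
        (.resList a (.par (P'.subst (.single x N)) Q'))
  | par_left {Ψ P Q bQ ΨQ α D P'} :
      IsFrame psi Q bQ ΨQ → FreshAll bQ Ψ → FreshAll bQ P → (∀ b ∈ bQ, α.Fresh b) →
      SymTrans psi (psi.comp Ψ ΨQ) P α D P' →
      FreshAll α.bn Q → (∀ y ∈ α.subj, Fresh y Q) →
      SymTrans psi Ψ (.par P Q) α (TransConstraint.nu bQ D) (.par P' Q)
  | par_right {Ψ P Q bP ΨP α D Q'} :
      IsFrame psi P bP ΨP → FreshAll bP Ψ → FreshAll bP Q → (∀ b ∈ bP, α.Fresh b) →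
      SymTrans psi (psi.comp Ψ ΨP) Q α D Q' →
      FreshAll α.bn P → (∀ y ∈ α.subj, Fresh y P) →
      SymTrans psi Ψ (.par P Q) α (TransConstraint.nu bP D) (.par P Q')
  | scope {Ψ P α D P' a} : SymTrans psi Ψ P α D P' → α.Fresh a → Fresh a Ψ →
      SymTrans psi Ψ (.res a P) α (TransConstraint.nu [a] D) (.res a P')
  | openRes {Ψ P y N D P' a} {a₁ a₂ : List Name} : SymTrans psi Ψ P (.out y (a₁ ++ a₂) N) D P' →
      Occurs a N → a ∉ a₁ ++ a₂ → Fresh a Ψ → a ≠ y →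
      SymTrans psi Ψ (.res a P) (.out y (a₁ ++ a :: a₂) N) (TransConstraint.nu [a] D) P'
  | rep {Ψ P α D P'} : SymTrans psi Ψ (.par P (.rep P)) α D P' → SymTrans psi Ψ (.rep P) α D P'

/-- `P` and `Q` are statically equivalent for `D`. -/
def StaticEquiv {psi : PsiCalculus T C A} (D : Constraint psi) (P Q : Agent psi) : Prop :=
  ∀ σ Ψ, D.Sat σ Ψ → ∀ φ, SubstFrameEntails psi Ψ P.1 σ φ ↔ SubstFrameEntails psi Ψ Q.1 σ φ

/-- (Early) symbolic bisimulations. -/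
structure IsSymbolicBisimulation (psi : PsiCalculus T C A)
    (S : Constraint psi → Agent psi → Agent psi → Prop) : Prop where
  static : ∀ D P Q, S D P Q → StaticEquiv D P Q
  symm : ∀ D P Q, S D P Q → S D Q P
  sim : ∀ D P Q, S D P Q → ∀ (α : Action Name T) (DP : TransConstraint C A) (P' : Agent psi),
    SymTrans psi psi.unit P.1 α DP P'.1 →
    (∀ a ∈ α.bn, Fresh a P.1 ∧ Fresh a Q.1 ∧ D.FreshIn a ∧ (∀ E ∈ DP, E.FreshIn a) ∧
      ∀ y ∈ α.subj, a ≠ y) →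
    (∀ y ∈ α.subj, Fresh y P.1 ∧ Fresh y Q.1 ∧ D.FreshIn y) →
    ∃ F : Set (Constraint psi), (D.and (.trans DP)).ImpliesSome F ∧
      ∀ D' ∈ F, ∃ (Q' : Agent psi) (α' : Action Name T) (DQ : TransConstraint C A),
        SymTrans psi psi.unit Q.1 α' DQ Q'.1 ∧ D'.Implies (.trans DQ) ∧
        match α with
        | .out y a N => ∃ N', α' = .out y a N' ∧ D'.Implies (.eq N N') ∧
            S (D'.andFresh a P Q) P' Q'
        | _ => α' = α ∧ S D' P' Q'

end Agents

end Psi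

namespace Psi

open NamedTerms (var)
open HasSubst (subst)

/-! ### Permutations of names with prescribed values -/

/-! Static equivalence and symmetry pass from R to the symbolic relation at each solution
separately; for frames, `substFrameEntails_iff` identifies the frame of Pσ with the frame of P under
σ.

For the simulation clause, fix a solution (σ, Ψ) of C ∧ C_P. The symbolic transition of P becomes a
concrete transition of Pσ (`SymTrans.realized`). The bisimulation R answers it with a concrete
transition of Qσ. That answer is lifted to a symbolic transition of Q whose constraint C_Q is solved
by the same (σ, Ψ) and whose derivative Q' becomes the concrete answer under σ (`Trans.matchable`).
Definability supplies a constraint E for the pair P', Q', and (σ, Ψ) solves C' = C_Q ∧ E, joined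
with {N = N'} for outputs. The set Ĉ consists of all constraints with the required property, so it
suffices to find one of them for each solution (`Constraint.exists_cover`).

Both translations are inductions on derivations, with three delicate points.

Subjects: a symbolic subject y is a fresh name that stands for the concrete subject σ(y), and it
occurs only in the first atomic constraint (`SymTrans.exists_cons`). At a communication σ is
therefore changed at the two subject names: to the subject of the partner in the realization
(`ComCondition.sat_left`), and to the concrete subjects M and K in the lifting
(`exists_symTrans_com`), where symmetry and transitivity of channel equivalence lead from M_P
through M and K to M_Q.

Environments: they matter only up to equivalence (`Trans.congr`). The lifting carries the invariant
`IsSubjectConstraint`: the assertion in the first atomic constraint is stably equivalent to the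
environment composed with the frame of the agent, as the symbolic communication rules demand. It
survives Case and Rep because well-formedness makes the relevant frames trivial.

Bound names: frames are unique up to renaming (`IsFrame.exists_perm`), but atomic constraints keep
their names as written. Hence `Matchable` covers all renamings of a transition and lets the frame of
P and a set B of names to be avoided be prescribed. Input derivatives are compared after
substituting an arbitrary term for the bound name, and the bisimulation is used at the term σ(x).
Bound names of a symbolic output are among the names of an atomic constraint, hence fresh for every
solution, so a lifted output can be renamed back to the bound names of the original one. -/

theorem exists_perm_map_eq {l l' : List Name} (hl : l.Nodup) (hl' : l'.Nodup)
    (h : l.length = l'.length) : ∃ π : NPerm, l.map π = l' := by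
  obtain ⟨π, hπ⟩ := Equiv.Perm.exists_extending_pair (fun i : Fin l.length => l[i])
    (fun i : Fin l.length => l'[(i : ℕ)]'(h ▸ i.2))
    (fun i j hij => Fin.ext ((List.Nodup.getElem_inj_iff hl).1 hij))
    (fun i j hij => Fin.ext ((List.Nodup.getElem_inj_iff hl').1 hij))
  refine ⟨π, List.ext_getElem (by simpa using h) fun i h1 h2 => ?_⟩
  simpa using hπ ⟨i, by simpa using h1⟩

/-- A bijection between lists of names extends to a permutation that fixes finitely many given
other names. -/
theorem exists_perm_map_eq_fix {l l' : List Name} (hl : l.Nodup) (hl' : l'.Nodup)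
    (h : l.length = l'.length) (F : Finset Name) (hF : ∀ a ∈ F, a ∉ l → a ∉ l') :
    ∃ π : NPerm, l.map π = l' ∧ ∀ a ∈ F, a ∉ l → π a = a := by
  classical
  -- The names to be fixed are appended to both lists, where they are mapped to themselves.
  let m := (F.filter (· ∉ l)).toList
  have hm : ∀ a, a ∈ m ↔ a ∈ F ∧ a ∉ l := fun a => by simp [m]
  have d1 : (l ++ m).Nodup := List.nodup_append'.2 ⟨hl, Finset.nodup_toList _,
    fun a h1 h2 => ((hm a).1 h2).2 h1⟩
  have d2 : (l' ++ m).Nodup := List.nodup_append'.2 ⟨hl', Finset.nodup_toList _,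
    fun a h1 h2 => hF a ((hm a).1 h2).1 ((hm a).1 h2).2 h1⟩
  obtain ⟨π, hπ⟩ := exists_perm_map_eq d1 d2 (by simp [h])
  rw [List.map_append] at hπ
  obtain ⟨h1, h2⟩ := List.append_inj hπ (by simpa using h)
  refine ⟨π, h1, fun a haF hal => ?_⟩
  exact (List.map_inj_left (f := π) (g := id)).1 (by simpa using h2) a ((hm a).2 ⟨haF, hal⟩)

theorem exists_fresh_list (n : ℕ) (B : Finset Name) :
    ∃ l : List Name, l.Nodup ∧ l.length = n ∧ ∀ a ∈ l, a ∉ B := by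
  obtain ⟨s, hs, hn⟩ := B.finite_toSet.infinite_compl.exists_subset_card_eq n
  exact ⟨s.toList, s.nodup_toList, by simpa using hn, fun a ha => by
    simpa using hs (by simpa using ha)⟩

/-! ### Supports in nominal sets -/

section Nominal

theorem not_occurs {X : Type v} [MulAction NPerm X] {a : Name} {x : X} :
    ¬ Occurs a x ↔ Fresh a x := not_not

theorem fresh_smul_iff {X : Type v} [MulAction NPerm X] (π : NPerm) (a : Name) (x : X) :
    Fresh (π a) (π • x) ↔ Fresh a x :=
  not_iff_not.1 (occurs_smul_iff π a x)

theorem fresh_smul_iff' {X : Type v} [MulAction NPerm X] (π : NPerm) (a : Name) (x : X) :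
    Fresh a (π • x) ↔ Fresh (π⁻¹ a) x := by
  simpa using fresh_smul_iff π (π⁻¹ a) x

theorem fresh_of_supports {X : Type v} [MulAction NPerm X] {x : X} (S : Finset Name) {a : Name}
    (ha : a ∉ S) (h : ∀ π : NPerm, (∀ b ∈ S, π b = b) → π • x = x) : Fresh a x :=
  ⟨S, ha, fun π hπ => h π fun _ hb => hπ hb⟩

variable {X : Type u} [NominalSet X]

/-- The support of `x`. -/
noncomputable def nsupp (x : X) : Finset Name := (finite_occurs x).toFinset

@[simp] theorem mem_nsupp {a : Name} {x : X} : a ∈ nsupp x ↔ Occurs a x := by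
  simp [nsupp]

theorem fresh_of_notMem {a : Name} {x : X} (h : a ∉ nsupp x) : Fresh a x := by
  simpa [not_occurs] using h

theorem swap_smul_of_fresh_of_supports {X : Type v} [MulAction NPerm X] {x : X} {S : Finset Name}
    (hS : MulAction.Supports NPerm (S : Set Name) x) {a b : Name} (ha : a ∉ S) (hb : b ∉ S) :
    Equiv.swap a b • x = x :=
  hS _ fun _ hc => Equiv.swap_apply_of_ne_of_ne (fun h => ha (h ▸ hc)) (fun h => hb (h ▸ hc))

/-- The core of the existence of least supports. A permutation `π` that fixes `S` except `a` is
corrected by swaps of `a`, a far name `c` and `π c`, so that it fixes all of `S`. The swaps do not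
change `x`, since they only touch names outside `S'`. -/
theorem supports_erase {X : Type v} [MulAction NPerm X] {x : X} {S S' : Finset Name}
    (hS : MulAction.Supports NPerm (S : Set Name) x)
    (hS' : MulAction.Supports NPerm (S' : Set Name) x) {a : Name} (ha : a ∉ S') :
    MulAction.Supports NPerm ((S.erase a : Finset Name) : Set Name) x := by
  intro π hπ
  have hπ' : ∀ b ∈ S, b ≠ a → π b = b := fun b hb hba => hπ (by simp [hb, hba])
  obtain ⟨c, hc⟩ := Infinite.exists_notMem_finset
    (S ∪ S' ∪ {a} ∪ (S ∪ S' ∪ {a}).image (⇑π⁻¹))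
  simp only [Finset.mem_union, not_or, Finset.mem_image, not_exists, not_and,
    Finset.mem_singleton] at hc
  obtain ⟨⟨⟨hcS, hcS'⟩, hca⟩, hcπ⟩ := hc
  have hd : ∀ d, π c = d → ¬ ((d ∈ S ∨ d ∈ S') ∨ d = a) := fun d hcd hd =>
    hcπ d hd (by simp [← hcd])
  have hd := hd _ rfl
  simp only [not_or] at hd
  obtain ⟨⟨hdS, hdS'⟩, hda⟩ := hd
  have hac : Equiv.swap a c • x = x := swap_smul_of_fresh_of_supports hS' ha hcS'
  have hcd : Equiv.swap c (π c) • x = x := swap_smul_of_fresh_of_supports hS' hcS' hdS'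
  -- the conjugate of `π` by the swap, corrected at `c`, fixes `S`
  have key : (Equiv.swap a c * (Equiv.swap c (π c) * π) * Equiv.swap a c) • x = x := by
    refine hS _ fun b hb => ?_
    have hb : b ∈ S := hb
    have hbc : b ≠ c := fun h => hcS (h ▸ hb)
    by_cases hba : b = a
    · subst hba
      simp [Equiv.Perm.smul_def]
    · have e1 : π b = b := hπ' b hb hba
      have hbd : b ≠ π c := fun h => hdS (h ▸ hb)
      simp [Equiv.Perm.smul_def, Equiv.swap_apply_of_ne_of_ne hba hbc, e1,
        Equiv.swap_apply_of_ne_of_ne hbc hbd]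
  rw [mul_smul, hac, mul_smul, smul_eq_iff_eq_inv_smul, Equiv.swap_inv, hac, mul_smul,
    smul_eq_iff_eq_inv_smul, Equiv.swap_inv, hcd] at key
  exact key

/-- The elements of a nominal set are supported by the names that occur in them. -/
theorem smul_eq_of_fix {x : X} {π : NPerm} (h : ∀ a, Occurs a x → π a = a) : π • x = x := by
  obtain ⟨S, hS⟩ := NominalSet.exists_support x
  -- Names that do not occur in `x` are erased from a support one at a time until none is left.
  induction hn : S.card using Nat.strong_induction_on generalizing S with
  | _ n ih =>
    by_cases hex : ∃ a ∈ S, Fresh a x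
    · obtain ⟨a, haS, S', haS', hS'⟩ := hex
      exact ih _ (hn ▸ Finset.card_erase_lt_of_mem haS) _ (supports_erase hS hS' haS') rfl
    · exact hS _ fun b hb => h b fun hf => hex ⟨b, hb, hf⟩

theorem smul_eq_smul {x : X} {π ρ : NPerm} (h : ∀ a, Occurs a x → π a = ρ a) :
    π • x = ρ • x := by
  rw [← inv_smul_eq_iff, ← mul_smul]
  exact smul_eq_of_fix fun a ha => by simp [h a ha]

theorem swap_smul_of_fresh {x : X} {a b : Name} (ha : Fresh a x) (hb : Fresh b x) :
    Equiv.swap a b • x = x :=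
  smul_eq_of_fix fun _ hc => Equiv.swap_apply_of_ne_of_ne (fun h => hc (h ▸ ha))
    (fun h => hc (h ▸ hb))

/-- A test for freshness: `x` is unchanged by a permutation that takes `a` to a name known to be
fresh. -/
theorem fresh_of_smul_eq {X : Type v} [MulAction NPerm X] {x : X} {π : NPerm} {a : Name}
    (h : π • x = x) (ha : Fresh (π a) x) : Fresh a x := by
  rwa [← h, fresh_smul_iff] at ha

instance : NominalSet Name where
  exists_support a := ⟨{a}, fun _ h => h (by simp)⟩

@[simp] theorem fresh_name {a b : Name} : Fresh a b ↔ a ≠ b := by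
  refine ⟨?_, fun h => ⟨{b}, by simpa using h, fun π hπ => hπ (by simp)⟩⟩
  rintro ⟨S, ha, hS⟩ rfl
  obtain ⟨c, hc⟩ := Infinite.exists_notMem_finset (S ∪ {a})
  simp only [Finset.mem_union, not_or, Finset.mem_singleton] at hc
  have := swap_smul_of_fresh_of_supports hS ha hc.1
  rw [Equiv.Perm.smul_def, Equiv.swap_apply_left] at this
  exact hc.2 this

end Nominal

/-! ### Substitutions and data -/

section Data

variable {T : Type u} [TermType T]

@[simp] theorem fresh_var_iff {a b : Name} : Fresh a (var b : T) ↔ a ≠ b := by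
  refine ⟨?_, fresh_var⟩
  rintro h rfl
  obtain ⟨c, hc⟩ := Infinite.exists_notMem_finset ({a} : Finset Name)
  have h1 : c ≠ a := by simpa using hc
  have := swap_smul_of_fresh h (fresh_var (T := T) h1)
  rw [NamedTerms.smul_var, Equiv.swap_apply_left] at this
  exact h1 (NamedTerms.var_injective this)

@[simp] theorem occurs_var_iff {a b : Name} : Occurs a (var b : T) ↔ a = b := by
  simp [Occurs]

namespace Substn

/-- The names that a substitution moves or that occur in a term substituted for a name. -/
noncomputable def supp (σ : Substn T) : Finset Name :=
  σ.finite_dom.toFinset ∪ σ.finite_dom.toFinset.biUnion fun a => nsupp (σ a)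

theorem fresh_iff {σ : Substn T} {a : Name} : σ.Fresh a ↔ a ∉ σ.supp := by
  simp only [Fresh, supp, Finset.mem_union, Finset.mem_biUnion, not_or, not_exists, not_and,
    Set.Finite.mem_toFinset, Set.mem_ofPred_eq, ne_eq, not_not, mem_nsupp, not_occurs]
  refine and_congr_right fun h => ⟨fun h2 b hb => h2 b ?_, fun h2 b hb => ?_⟩
  · rintro rfl
    exact hb h
  · by_cases hbv : σ b = var b
    · rw [hbv]; exact fresh_var (Ne.symm hb)
    · exact h2 b hbv

theorem Fresh.apply {σ : Substn T} {a b : Name} (h : σ.Fresh a) (hb : a ≠ b) :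
    Psi.Fresh a (σ b) := h.2 b hb.symm

@[simp] theorem update_same (σ : Substn T) (x : Name) (L : T) : σ.update x L x = L := if_pos rfl

theorem update_of_ne (σ : Substn T) {x a : Name} (L : T) (h : a ≠ x) : σ.update x L a = σ a :=
  if_neg h

@[simp] theorem single_same (x : Name) (L : T) : single x L x = L := if_pos rfl

theorem single_of_ne {x a : Name} (L : T) (h : a ≠ x) : single x L a = var a := if_neg h

theorem Fresh.update {σ : Substn T} {a x : Name} {L : T} (h : σ.Fresh a) (hx : a ≠ x)
    (hL : Psi.Fresh a L) : (σ.update x L).Fresh a := by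
  refine ⟨(update_of_ne σ L hx).trans h.1, fun b hb => ?_⟩
  by_cases hbx : b = x
  · subst hbx; simpa using hL
  · rw [update_of_ne _ _ hbx]; exact h.2 b hb

theorem Fresh.single {a x : Name} {L : T} (hx : a ≠ x) (hL : Psi.Fresh a L) :
    (single x L).Fresh a := by
  exact Fresh.update ⟨rfl, fun b hb => fresh_var (Ne.symm hb)⟩ hx hL

/-- A permutation that fixes the support of `σ` commutes with `σ`. Bound names of constraints and
derivatives can therefore be renamed while `σ` stays the same. -/
theorem smul_apply_of_fix {σ : Substn T} {π : NPerm} (h : ∀ a ∈ σ.supp, π a = a) (a : Name) :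
    σ (π a) = π • σ a := by
  by_cases ha : a ∈ σ.supp
  · rw [h a ha]
    refine (smul_eq_of_fix fun b hb => ?_).symm
    by_contra hne
    have hb' := fresh_iff.2 fun hb' => hne (h b hb')
    have hab : a ≠ b := fun hab => hne (h b (hab ▸ ha))
    exact hb (hb'.2 a hab)
  · have h1 := (fresh_iff.2 ha).1
    have h2 : π a ∉ σ.supp := fun h3 => ha (by
      have := h _ h3
      have := π.injective this
      rwa [this] at h3)
    rw [h1, (fresh_iff.2 h2).1, NamedTerms.smul_var]

end Substn

variable {X : Type u} [DataType T X]

theorem smul_subst_eq {π : NPerm} {σ τ : Substn T} {x : X}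
    (h : ∀ a, Occurs a x → τ (π a) = π • σ a) : π • subst x σ = subst (π • x) τ := by
  have := smul_subst_smul π 1 1 π σ τ x fun a ha => by simpa using (h a ha).symm
  simpa using this

theorem subst_congr_of {σ τ : Substn T} {x : X} (h : ∀ a, Occurs a x → σ a = τ a) :
    subst x σ = subst x τ := LawfulSubst.subst_congr σ τ x h

theorem exists_comp (σ τ : Substn T) : ∃ ρ : Substn T, ∀ a, ρ a = subst (σ a) τ := by
  refine ⟨⟨fun a => subst (σ a) τ, (σ.finite_dom.union τ.finite_dom).subset fun a ha => ?_⟩,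
    fun a => rfl⟩
  by_contra h
  simp only [Set.mem_union, Set.mem_ofPred_eq, not_or, not_not] at h
  refine ha ?_
  rw [h.1, TermType.var_subst, h.2]

theorem subst_subst_of {σ τ ρ : Substn T} {x : X}
    (h : ∀ a, Occurs a x → ρ a = subst (σ a) τ) : subst (subst x σ) τ = subst x ρ := by
  obtain ⟨μ, hμ⟩ := exists_comp σ τ
  rw [LawfulSubst.subst_subst σ τ μ x hμ]
  exact subst_congr_of fun a ha => by rw [h a ha, hμ]

/-- Swapping `a` with a far name `c` fixes every `σ b` with `b` in `x`, hence fixes the result of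
the substitution; since `c` does not occur there, neither does `a`. -/
theorem fresh_subst_of {σ : Substn T} {x : X} {a : Name}
    (h : ∀ b, Occurs b x → Fresh a (σ b)) : Fresh a (subst x σ) := by
  classical
  obtain ⟨c, hc⟩ := Infinite.exists_notMem_finset
    (nsupp (subst x σ) ∪ (nsupp x).biUnion fun b => nsupp (σ b))
  simp only [Finset.mem_union, Finset.mem_biUnion, not_or, not_exists, not_and, mem_nsupp,
    not_occurs] at hc
  refine fresh_of_smul_eq (π := Equiv.swap a c) ?_ (by simpa using hc.1)
  have := smul_subst_smul (Equiv.swap a c) 1 1 1 σ σ x fun b hb => by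
    simpa using swap_smul_of_fresh (h b hb) (hc.2 b hb)
  simpa using this

theorem fresh_subst {σ : Substn T} {x : X} {a : Name} (hσ : σ.Fresh a) (hx : Fresh a x) :
    Fresh a (subst x σ) :=
  fresh_subst_of fun b hb => hσ.2 b fun h => hb (h ▸ hx)

theorem subst_var_fresh {σ : Substn T} {x : X} (h : ∀ a, Occurs a x → σ a = var a) :
    subst x σ = x := by
  simpa using LawfulSubst.subst_rename 1 σ x h

theorem subst_update_of_fresh {σ : Substn T} {x : X} {y : Name} {L : T} (hy : Fresh y x) :
    subst x (σ.update y L) = subst x σ :=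
  subst_congr_of fun _ ha => Substn.update_of_ne _ _ fun h => ha (h ▸ hy)

theorem occurs_subst_of {σ : Substn T} {x : X} {a b : Name} (ha : Occurs a x)
    (hb : Occurs b (σ a)) : Occurs b (subst x σ) := LawfulSubst.occurs_subst σ x a b ha hb

/-- Carries the side condition of Open, that the opened name occurs in the object, between N and Nσ.
-/
theorem occurs_subst_of_fresh {σ : Substn T} {x : X} {a : Name} (hσ : σ.Fresh a) :
    Occurs a (subst x σ) ↔ Occurs a x := by
  refine ⟨fun h => ?_, fun h => occurs_subst_of h (by rw [hσ.1]; simp)⟩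
  by_contra hx
  exact h (fresh_subst hσ (not_occurs.1 hx))

end Data

end Psi

namespace Psi

open NamedTerms (var)
open HasSubst (subst)

section AgentBasics

variable {T C A : Type u} [TermType T] [DataType T C] [DataType T A]

/-! ### Inversion of alpha-equivalence -/

namespace RawAgent

/-- At a binder `x` the permutations may differ. Both renamed binders are converted to one fresh
`z`, after which the permutations agree on every free name of the body, `x` included. -/
theorem alpha_smul_smul (P : RawAgent T C A) {π ρ : NPerm} (h : ∀ a, P.Free a → π a = ρ a) :
    Alpha (π • P) (ρ • P) := by
  have pick : ∀ (x : Name) (P : RawAgent T C A) (π ρ : NPerm),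
      (∀ a, a ≠ x → P.Free a → π a = ρ a) → ∃ z, ¬ (π • P).Free z ∧ ¬ (ρ • P).Free z ∧
      ∀ a, P.Free a → (Equiv.swap (π x) z * π) a = (Equiv.swap (ρ x) z * ρ) a := by
    intro x P π ρ h
    obtain ⟨z, hz⟩ := ((finite_free (π • P)).union (finite_free (ρ • P))).exists_notMem
    simp only [Set.mem_union, Set.mem_ofPred_eq, not_or] at hz
    refine ⟨z, hz.1, hz.2, fun a ha => ?_⟩
    by_cases hax : a = x
    · simp [hax]
    · have h1 : π a ≠ z := fun e => hz.1 (e ▸ (free_smul_iff π a P).2 ha)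
      have h2 : ρ a ≠ z := fun e => hz.2 (e ▸ (free_smul_iff ρ a P).2 ha)
      rw [Equiv.Perm.mul_apply, Equiv.Perm.mul_apply,
        Equiv.swap_apply_of_ne_of_ne (by simpa using hax) h1,
        Equiv.swap_apply_of_ne_of_ne (by simpa using hax) h2, h a hax ha]
  induction P generalizing π ρ with
  | output M N P ih =>
    have h1 : π • M = ρ • M := smul_eq_smul fun a ha => h a (Or.inl ha)
    have h2 : π • N = ρ • N := smul_eq_smul fun a ha => h a (Or.inr (Or.inl ha))
    have h3 := ih fun a ha => h a (Or.inr (Or.inr ha))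
    simp only [smul_def, perm] at h3 ⊢
    rw [h1, h2]
    exact .output _ _ h3
  | input M x P ih =>
    have h1 : π • M = ρ • M := smul_eq_smul fun a ha => h a (Or.inl ha)
    obtain ⟨z, hz1, hz2, hz⟩ := pick x P π ρ fun a hax ha => h a (Or.inr ⟨hax, ha⟩)
    have h3 := ih hz
    rw [mul_smul, mul_smul] at h3
    have := Alpha.input_of_swap (M := π • M) hz1 hz2 h3
    simp only [smul_def, perm] at this ⊢
    rwa [← h1]
  | case φ P ih =>
    have h1 : ∀ i, π • φ i = ρ • φ i := fun i => smul_eq_smul fun a ha => h a ⟨i, Or.inl ha⟩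
    have h3 := fun i => ih i fun a ha => h a ⟨i, Or.inr ha⟩
    simp only [smul_def, perm] at h3 ⊢
    simp only [h1]
    exact .case _ h3
  | res x P ih =>
    obtain ⟨z, hz1, hz2, hz⟩ := pick x P π ρ fun a hax ha => h a ⟨hax, ha⟩
    have h3 := ih hz
    rw [mul_smul, mul_smul] at h3
    exact Alpha.res_of_swap hz1 hz2 h3
  | par P Q ihP ihQ =>
    exact .par (ihP fun a ha => h a (Or.inl ha)) (ihQ fun a ha => h a (Or.inr ha))
  | rep P ih => exact .rep (ih h)
  | assertion Ψ =>
    have h1 : π • Ψ = ρ • Ψ := smul_eq_smul h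
    simp only [smul_def, perm]
    rw [h1]
    exact .refl _

theorem Alpha.free_iff {P Q : RawAgent T C A} (h : Alpha P Q) (a : Name) :
    P.Free a ↔ Q.Free a := by
  have conv : ∀ (x z : Name) (P : RawAgent T C A), ¬ P.Free z →
      ((a ≠ x ∧ P.Free a) ↔ (a ≠ z ∧ (Equiv.swap x z • P).Free a)) := by
    intro x z P hz
    have h1 := free_smul_iff (Equiv.swap x z) (Equiv.swap x z a) P
    rw [Equiv.swap_apply_self] at h1
    rw [h1]
    by_cases haz : a = z
    · subst haz; simp [hz]
    · by_cases hax : a = x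
      · subst hax; simp [hz]
      · rw [Equiv.swap_apply_of_ne_of_ne hax haz]; simp [hax, haz]
  induction h with
  | input_conv M x z P hz => exact or_congr Iff.rfl (conv x z P hz)
  | res_conv x z P hz => exact conv x z P hz
  | _ => simp_all [Free]

/-- What alpha-equivalence means for the outermost constructors. -/
def AlphaInv : RawAgent T C A → RawAgent T C A → Prop
  | output M N P, output M' N' P' => M = M' ∧ N = N' ∧ Alpha P P'
  | input M x P, input M' x' P' => M = M' ∧ ∃ L : Finset Name, ∀ z ∉ L,
      Alpha (Equiv.swap x z • P) (Equiv.swap x' z • P')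
  | @case _ _ _ n φ P, @case _ _ _ n' φ' P' => ∃ h : n = n', (∀ i, φ i = φ' (Fin.cast h i)) ∧
      ∀ i, Alpha (P i) (P' (Fin.cast h i))
  | res x P, res x' P' => ∃ L : Finset Name, ∀ z ∉ L,
      Alpha (Equiv.swap x z • P) (Equiv.swap x' z • P')
  | par P Q, par P' Q' => Alpha P P' ∧ Alpha Q Q'
  | rep P, rep P' => Alpha P P'
  | assertion Ψ, assertion Ψ' => Ψ = Ψ'
  | _, _ => False

theorem alphaInv_refl (P : RawAgent T C A) : AlphaInv P P := by
  cases P <;> simp [AlphaInv, Alpha.refl]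

theorem AlphaInv.symm {P Q : RawAgent T C A} (h : AlphaInv P Q) : AlphaInv Q P := by
  cases P <;> cases Q <;> simp only [AlphaInv] at h ⊢
  · exact ⟨h.1.symm, h.2.1.symm, h.2.2.symm⟩
  · exact ⟨h.1.symm, h.2.imp fun L hL z hz => (hL z hz).symm⟩
  · obtain ⟨rfl, h1, h2⟩ := h
    exact ⟨rfl, fun i => (h1 i).symm, fun i => (h2 i).symm⟩
  · exact h.imp fun L hL z hz => (hL z hz).symm
  · exact ⟨h.1.symm, h.2.symm⟩
  · exact h.symm
  · exact h.symm

/-- Binders are compared at all but finitely many names, so the two exceptional sets can simply be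
united. -/
theorem AlphaInv.trans {P Q R : RawAgent T C A} (h : AlphaInv P Q) (h' : AlphaInv Q R) :
    AlphaInv P R := by
  have key : ∀ {x y w : Name} {P Q R : RawAgent T C A},
      (∃ L : Finset Name, ∀ z ∉ L, Alpha (Equiv.swap x z • P) (Equiv.swap y z • Q)) →
      (∃ L : Finset Name, ∀ z ∉ L, Alpha (Equiv.swap y z • Q) (Equiv.swap w z • R)) →
      (∃ L : Finset Name, ∀ z ∉ L, Alpha (Equiv.swap x z • P) (Equiv.swap w z • R)) := by
    rintro x y w P Q R ⟨L, hL⟩ ⟨L', hL'⟩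
    refine ⟨L ∪ L', fun z hz => ?_⟩
    rw [Finset.mem_union, not_or] at hz
    exact (hL z hz.1).trans (hL' z hz.2)
  cases P <;> cases Q <;> simp only [AlphaInv] at h <;> cases R <;>
    simp only [AlphaInv] at h' ⊢
  · exact ⟨h.1.trans h'.1, h.2.1.trans h'.2.1, h.2.2.trans h'.2.2⟩
  · exact ⟨h.1.trans h'.1, key h.2 h'.2⟩
  · obtain ⟨rfl, h1, h2⟩ := h
    obtain ⟨rfl, h3, h4⟩ := h'
    exact ⟨rfl, fun i => (h1 i).trans (h3 i), fun i => (h2 i).trans (h4 i)⟩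
  · exact key h h'
  · exact ⟨h.1.trans h'.1, h.2.trans h'.2⟩
  · exact h.trans h'
  · exact h.trans h'

theorem Alpha.inv {P Q : RawAgent T C A} (h : Alpha P Q) : AlphaInv P Q := by
  have conv : ∀ (x z : Name) (P : RawAgent T C A), ¬ P.Free z → ∃ L : Finset Name, ∀ w ∉ L,
      Alpha (Equiv.swap x w • P) (Equiv.swap z w • Equiv.swap x z • P) := by
    intro x z P hz
    refine ⟨P.finite_free.toFinset ∪ {x, z}, fun w hw => ?_⟩
    simp only [Finset.mem_union, Finset.mem_insert, Finset.mem_singleton, not_or,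
      Set.Finite.mem_toFinset, Set.mem_ofPred_eq] at hw
    rw [← mul_smul]
    refine alpha_smul_smul P fun a ha => ?_
    have haz : a ≠ z := fun e => hz (e ▸ ha)
    have haw : a ≠ w := fun e => hw.1 (e ▸ ha)
    by_cases hax : a = x
    · simp [hax]
    · rw [Equiv.Perm.mul_apply, Equiv.swap_apply_of_ne_of_ne hax haw,
        Equiv.swap_apply_of_ne_of_ne hax haz, Equiv.swap_apply_of_ne_of_ne haz haw]
  induction h with
  | refl P => exact alphaInv_refl P
  | symm _ ih => exact ih.symm
  | trans _ _ ih₁ ih₂ => exact ih₁.trans ih₂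
  | output M N h _ => exact ⟨rfl, rfl, h⟩
  | input M x h _ => exact ⟨rfl, ∅, fun z _ => h.smul _⟩
  | case φ h _ => exact ⟨rfl, fun _ => rfl, h⟩
  | res a h _ => exact ⟨∅, fun z _ => h.smul _⟩
  | par h h' _ _ => exact ⟨h, h'⟩
  | rep h _ => exact h
  | input_conv M x z P hz => exact ⟨rfl, conv x z P hz⟩
  | res_conv x z P hz => exact conv x z P hz

end RawAgent

/-! ### Agents up to alpha-equivalence: induction, supports, inversion -/

namespace PreAgent

theorem mk_eq_mk {P Q : RawAgent T C A} : mk P = mk Q ↔ RawAgent.Alpha P Q :=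
  ⟨fun h => Quotient.exact h, fun h => Quotient.sound h⟩

theorem exists_mk (P : PreAgent T C A) : ∃ p, P = mk p := ⟨_, (Quotient.out_eq P).symm⟩

theorem exists_mk_fun {n : ℕ} (P : Fin n → PreAgent T C A) :
    ∃ p : Fin n → RawAgent T C A, P = fun i => mk (p i) :=
  ⟨fun i => (P i).out, funext fun i => (Quotient.out_eq (P i)).symm⟩

/-- Structural induction directly on alpha-classes. Nothing is assumed about the bound names; proofs
convert them to fresh ones when needed. -/
theorem ind {motive : PreAgent T C A → Prop}
    (output : ∀ M N P, motive P → motive (output M N P))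
    (input : ∀ M x P, motive P → motive (input M x P))
    (case : ∀ {n : ℕ} (φ : Fin n → C) (P : Fin n → PreAgent T C A), (∀ i, motive (P i)) →
      motive (case φ P))
    (res : ∀ a P, motive P → motive (res a P))
    (par : ∀ P Q, motive P → motive Q → motive (par P Q))
    (rep : ∀ P, motive P → motive (rep P))
    (assertion : ∀ Ψ, motive (assertion Ψ)) (P : PreAgent T C A) : motive P := by
  obtain ⟨p, rfl⟩ := exists_mk P
  induction p with
  | output M N P ih => exact output M N _ ih
  | input M x P ih => exact input M x _ ih
  | case φ P ih => rw [← case_mk]; exact case φ _ ih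
  | res a P ih => exact res a _ ih
  | par P Q ihP ihQ => exact par _ _ ihP ihQ
  | rep P ih => exact rep _ ih
  | assertion Ψ => exact assertion Ψ

theorem smul_mk (π : NPerm) (P : RawAgent T C A) : π • mk P = mk (π • P) := rfl

@[simp] theorem smul_output (π : NPerm) (M N : T) (P : PreAgent T C A) :
    π • output M N P = output (π • M) (π • N) (π • P) := by
  obtain ⟨p, rfl⟩ := exists_mk P; rfl

@[simp] theorem smul_input (π : NPerm) (M : T) (x : Name) (P : PreAgent T C A) :
    π • input M x P = input (π • M) (π x) (π • P) := by
  obtain ⟨p, rfl⟩ := exists_mk P; rfl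

@[simp] theorem smul_case (π : NPerm) {n : ℕ} (φ : Fin n → C) (P : Fin n → PreAgent T C A) :
    π • case φ P = case (fun i => π • φ i) (fun i => π • P i) := by
  obtain ⟨p, rfl⟩ := exists_mk_fun P
  simp only [smul_mk, case_mk]
  rfl

@[simp] theorem smul_res (π : NPerm) (a : Name) (P : PreAgent T C A) :
    π • res a P = res (π a) (π • P) := by
  obtain ⟨p, rfl⟩ := exists_mk P; rfl

@[simp] theorem smul_par (π : NPerm) (P Q : PreAgent T C A) :
    π • par P Q = par (π • P) (π • Q) := by
  obtain ⟨p, rfl⟩ := exists_mk P; obtain ⟨q, rfl⟩ := exists_mk Q; rfl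

@[simp] theorem smul_rep (π : NPerm) (P : PreAgent T C A) : π • rep P = rep (π • P) := by
  obtain ⟨p, rfl⟩ := exists_mk P; rfl

@[simp] theorem smul_assertion (π : NPerm) (Ψ : A) :
    π • (assertion Ψ : PreAgent T C A) = assertion (π • Ψ) := rfl

@[simp] theorem smul_resList (π : NPerm) (a : List Name) (P : PreAgent T C A) :
    π • resList a P = resList (a.map π) (π • P) := by
  induction a with
  | nil => rfl
  | cons b a ih => exact (smul_res π b _).trans (congrArg _ ih)

theorem smul_mk_eq_of_fix {P : RawAgent T C A} {π : NPerm} (h : ∀ a, P.Free a → π a = a) :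
    π • mk P = mk P := by
  have := RawAgent.alpha_smul_smul P (π := π) (ρ := 1) (by simpa using h)
  rw [one_smul] at this
  exact mk_eq_mk.2 this

instance : NominalSet (PreAgent T C A) where
  exists_support P := by
    obtain ⟨p, rfl⟩ := exists_mk P
    exact ⟨p.finite_free.toFinset, fun π hπ => smul_mk_eq_of_fix fun a ha => hπ (by simpa using ha)⟩

/-- The free names support the class. Conversely no free name `a` is superfluous: swapping it with a
far name `c` would make `c` free, but alpha-equivalent trees have the same free names. -/
theorem occurs_mk {a : Name} {P : RawAgent T C A} : Occurs a (mk P) ↔ P.Free a := by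
  refine ⟨fun h => ?_, fun h => ?_⟩
  · by_contra hP
    exact h (fresh_of_supports P.finite_free.toFinset (by simpa using hP)
      fun π hπ => smul_mk_eq_of_fix fun a ha => hπ a (by simpa using ha))
  · rintro ⟨S, haS, hS⟩
    obtain ⟨c, hc⟩ := Infinite.exists_notMem_finset (S ∪ P.finite_free.toFinset)
    simp only [Finset.mem_union, not_or, Set.Finite.mem_toFinset, Set.mem_ofPred_eq] at hc
    have h1 := mk_eq_mk.1 (swap_smul_of_fresh_of_supports hS haS hc.1)
    have h2 := (RawAgent.free_smul_iff (Equiv.swap a c) a P).2 h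
    rw [Equiv.swap_apply_left] at h2
    exact hc.2 ((h1.free_iff c).1 h2)

section Fresh

variable {a : Name}

@[simp] theorem occurs_output {M N : T} {P : PreAgent T C A} :
    Occurs a (output M N P) ↔ Occurs a M ∨ Occurs a N ∨ Occurs a P := by
  obtain ⟨p, rfl⟩ := exists_mk P
  rw [occurs_mk]; exact occurs_mk

@[simp] theorem occurs_input {M : T} {x : Name} {P : PreAgent T C A} :
    Occurs a (input M x P) ↔ Occurs a M ∨ (a ≠ x ∧ Occurs a P) := by
  obtain ⟨p, rfl⟩ := exists_mk P
  rw [occurs_mk]; exact occurs_mk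

@[simp] theorem occurs_case {n : ℕ} {φ : Fin n → C} {P : Fin n → PreAgent T C A} :
    Occurs a (case φ P) ↔ ∃ i, Occurs a (φ i) ∨ Occurs a (P i) := by
  obtain ⟨p, rfl⟩ := exists_mk_fun P
  simp only [occurs_mk, case_mk]
  rfl

@[simp] theorem occurs_res {b : Name} {P : PreAgent T C A} :
    Occurs a (res b P) ↔ a ≠ b ∧ Occurs a P := by
  obtain ⟨p, rfl⟩ := exists_mk P
  rw [occurs_mk]; exact occurs_mk

@[simp] theorem occurs_par {P Q : PreAgent T C A} :
    Occurs a (par P Q) ↔ Occurs a P ∨ Occurs a Q := by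
  obtain ⟨p, rfl⟩ := exists_mk P; obtain ⟨q, rfl⟩ := exists_mk Q
  rw [occurs_mk, occurs_mk]; exact occurs_mk

@[simp] theorem occurs_rep {P : PreAgent T C A} : Occurs a (rep P) ↔ Occurs a P := by
  obtain ⟨p, rfl⟩ := exists_mk P
  rw [occurs_mk]; exact occurs_mk

@[simp] theorem occurs_assertion {Ψ : A} :
    Occurs a (assertion Ψ : PreAgent T C A) ↔ Occurs a Ψ := occurs_mk

@[simp] theorem fresh_output {M N : T} {P : PreAgent T C A} :
    Fresh a (output M N P) ↔ Fresh a M ∧ Fresh a N ∧ Fresh a P := by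
  simp only [← not_occurs, occurs_output, not_or]

@[simp] theorem fresh_input {M : T} {x : Name} {P : PreAgent T C A} :
    Fresh a (input M x P) ↔ Fresh a M ∧ (a = x ∨ Fresh a P) := by
  simp only [← not_occurs, occurs_input]; tauto

@[simp] theorem fresh_case {n : ℕ} {φ : Fin n → C} {P : Fin n → PreAgent T C A} :
    Fresh a (case φ P) ↔ ∀ i, Fresh a (φ i) ∧ Fresh a (P i) := by
  simp only [← not_occurs, occurs_case, not_exists, not_or]

@[simp] theorem fresh_res {b : Name} {P : PreAgent T C A} :
    Fresh a (res b P) ↔ a = b ∨ Fresh a P := by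
  simp only [← not_occurs, occurs_res]; tauto

@[simp] theorem fresh_par {P Q : PreAgent T C A} :
    Fresh a (par P Q) ↔ Fresh a P ∧ Fresh a Q := by
  simp only [← not_occurs, occurs_par, not_or]

@[simp] theorem fresh_rep {P : PreAgent T C A} : Fresh a (rep P) ↔ Fresh a P := by
  simp only [← not_occurs, occurs_rep]

@[simp] theorem fresh_assertion {Ψ : A} :
    Fresh a (assertion Ψ : PreAgent T C A) ↔ Fresh a Ψ := by
  simp only [← not_occurs, occurs_assertion]

@[simp] theorem fresh_resList {b : List Name} {P : PreAgent T C A} :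
    Fresh a (resList b P) ↔ a ∈ b ∨ Fresh a P := by
  induction b with
  | nil => simp [resList]
  | cons c b ih =>
    have : resList (c :: b) P = res c (resList b P) := rfl
    rw [this, fresh_res, ih, List.mem_cons, or_assoc]

end Fresh

/-- The outermost constructor. -/
def tag (P : PreAgent T C A) : ℕ :=
  Quotient.lift (s := alphaSetoid T C A)
    (fun p => match p with
      | .output _ _ _ => 0
      | .input _ _ _ => 1
      | .case _ _ => 2
      | .res _ _ => 3
      | .par _ _ => 4
      | .rep _ => 5
      | .assertion _ => 6)
    (fun p q h => by
      have := RawAgent.Alpha.inv h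
      cases p <;> cases q <;> simp_all [RawAgent.AlphaInv]) P

@[simp] theorem tag_output (M N : T) (P : PreAgent T C A) : (output M N P).tag = 0 := by
  obtain ⟨p, rfl⟩ := exists_mk P; rfl

@[simp] theorem tag_input (M : T) (x : Name) (P : PreAgent T C A) : (input M x P).tag = 1 := by
  obtain ⟨p, rfl⟩ := exists_mk P; rfl

@[simp] theorem tag_case {n : ℕ} (φ : Fin n → C) (P : Fin n → PreAgent T C A) :
    (case φ P).tag = 2 := rfl

@[simp] theorem tag_res (a : Name) (P : PreAgent T C A) : (res a P).tag = 3 := by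
  obtain ⟨p, rfl⟩ := exists_mk P; rfl

@[simp] theorem tag_par (P Q : PreAgent T C A) : (par P Q).tag = 4 := by
  obtain ⟨p, rfl⟩ := exists_mk P; obtain ⟨q, rfl⟩ := exists_mk Q; rfl

@[simp] theorem tag_rep (P : PreAgent T C A) : (rep P).tag = 5 := by
  obtain ⟨p, rfl⟩ := exists_mk P; rfl

@[simp] theorem tag_assertion (Ψ : A) : (assertion Ψ : PreAgent T C A).tag = 6 := rfl

theorem output_inj {M N M' N' : T} {P P' : PreAgent T C A} (h : output M N P = output M' N' P') :
    M = M' ∧ N = N' ∧ P = P' := by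
  obtain ⟨p, rfl⟩ := exists_mk P; obtain ⟨p', rfl⟩ := exists_mk P'
  have := RawAgent.Alpha.inv (mk_eq_mk.1 h)
  simp only [mk_eq_mk]
  exact this

theorem par_inj {P Q P' Q' : PreAgent T C A} (h : par P Q = par P' Q') : P = P' ∧ Q = Q' := by
  obtain ⟨p, rfl⟩ := exists_mk P; obtain ⟨p', rfl⟩ := exists_mk P'
  obtain ⟨q, rfl⟩ := exists_mk Q; obtain ⟨q', rfl⟩ := exists_mk Q'
  have := RawAgent.Alpha.inv (mk_eq_mk.1 h)
  simp only [mk_eq_mk]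
  exact this

theorem rep_inj {P P' : PreAgent T C A} (h : rep P = rep P') : P = P' := by
  obtain ⟨p, rfl⟩ := exists_mk P; obtain ⟨p', rfl⟩ := exists_mk P'
  have := RawAgent.Alpha.inv (mk_eq_mk.1 h)
  simp only [mk_eq_mk]
  exact this

theorem assertion_inj {Ψ Ψ' : A} (h : (assertion Ψ : PreAgent T C A) = assertion Ψ') : Ψ = Ψ' :=
  RawAgent.Alpha.inv (mk_eq_mk.1 h)

theorem case_inj {n n' : ℕ} {φ : Fin n → C} {P : Fin n → PreAgent T C A} {φ' : Fin n' → C}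
    {P' : Fin n' → PreAgent T C A} (h : case φ P = case φ' P') :
    ∃ e : n = n', (∀ i, φ i = φ' (Fin.cast e i)) ∧ ∀ i, P i = P' (Fin.cast e i) := by
  obtain ⟨p, rfl⟩ := exists_mk_fun P; obtain ⟨p', rfl⟩ := exists_mk_fun P'
  rw [case_mk, case_mk] at h
  have := RawAgent.Alpha.inv (mk_eq_mk.1 h)
  simp only [mk_eq_mk]
  exact this

/-- One sufficiently fresh `z` turns the comparison at almost all names into a single swap of the
two binders. -/
theorem eq_swap_of_swap_eq {a b : Name} {P Q : PreAgent T C A}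
    (h : ∃ L : Finset Name, ∀ z ∉ L, Equiv.swap a z • P = Equiv.swap b z • Q) :
    Q = Equiv.swap a b • P ∧ (a = b ∨ Fresh b P) := by
  obtain ⟨L, hL⟩ := h
  obtain ⟨z, hz⟩ := Infinite.exists_notMem_finset (L ∪ nsupp P ∪ nsupp Q ∪ {a, b})
  simp only [Finset.mem_union, not_or, mem_nsupp, Finset.mem_insert, Finset.mem_singleton] at hz
  obtain ⟨⟨⟨hzL, hzP⟩, hzQ⟩, hza, hzb⟩ := hz
  have e := hL z hzL
  by_cases hab : a = b
  · subst hab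
    refine ⟨?_, Or.inl rfl⟩
    rw [smul_left_cancel_iff] at e
    rw [e, Equiv.swap_self]
    exact (one_smul _ _).symm
  · have hb : Fresh b P := by
      have h1 : Fresh b (Equiv.swap b z • Q) := by
        have := (fresh_smul_iff (Equiv.swap b z) z Q).2 (not_occurs.1 hzQ)
        rwa [Equiv.swap_apply_right] at this
      rw [← e, fresh_smul_iff', Equiv.swap_inv,
        Equiv.swap_apply_of_ne_of_ne (Ne.symm hab) (Ne.symm hzb)] at h1
      exact h1
    refine ⟨?_, Or.inr hb⟩
    rw [← inv_smul_eq_iff, Equiv.swap_inv, ← mul_smul] at e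
    rw [← e]
    refine smul_eq_smul (x := P) fun c hc => ?_
    have hcb : c ≠ b := fun h => hc (h ▸ hb)
    have hcz : c ≠ z := fun h => hzP (h ▸ hc)
    by_cases hca : c = a
    · subst hca; simp
    · rw [Equiv.Perm.mul_apply, Equiv.swap_apply_of_ne_of_ne hca hcz,
        Equiv.swap_apply_of_ne_of_ne hca hcb, Equiv.swap_apply_of_ne_of_ne hcb hcz]

theorem res_inj {a b : Name} {P Q : PreAgent T C A} (h : res a P = res b Q) :
    Q = Equiv.swap a b • P ∧ (a = b ∨ Fresh b P) := by
  refine eq_swap_of_swap_eq ?_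
  obtain ⟨p, rfl⟩ := exists_mk P; obtain ⟨p', rfl⟩ := exists_mk Q
  have := RawAgent.Alpha.inv (mk_eq_mk.1 h)
  simp only [smul_mk, mk_eq_mk]
  exact this

theorem input_inj {M M' : T} {a b : Name} {P Q : PreAgent T C A}
    (h : input M a P = input M' b Q) :
    M = M' ∧ Q = Equiv.swap a b • P ∧ (a = b ∨ Fresh b P) := by
  suffices M = M' ∧ ∃ L : Finset Name, ∀ z ∉ L, Equiv.swap a z • P = Equiv.swap b z • Q from
    ⟨this.1, eq_swap_of_swap_eq this.2⟩
  obtain ⟨p, rfl⟩ := exists_mk P; obtain ⟨p', rfl⟩ := exists_mk Q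
  have := RawAgent.Alpha.inv (mk_eq_mk.1 h)
  simp only [smul_mk, mk_eq_mk]
  exact this

theorem res_conv {a b : Name} {P : PreAgent T C A} (h : a = b ∨ Fresh b P) :
    res a P = res b (Equiv.swap a b • P) := by
  rcases h with rfl | h
  · rw [Equiv.swap_self]
    exact congrArg _ (one_smul _ _).symm
  · obtain ⟨p, rfl⟩ := exists_mk P
    exact mk_eq_mk.2 (.res_conv a b p fun hf => occurs_mk.2 hf h)

theorem input_conv {M : T} {a b : Name} {P : PreAgent T C A} (h : a = b ∨ Fresh b P) :
    input M a P = input M b (Equiv.swap a b • P) := by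
  rcases h with rfl | h
  · rw [Equiv.swap_self]
    exact congrArg _ (one_smul _ _).symm
  · obtain ⟨p, rfl⟩ := exists_mk P
    exact mk_eq_mk.2 (.input_conv M a b p fun hf => occurs_mk.2 hf h)

end PreAgent

end AgentBasics

end Psi

namespace Psi

open NamedTerms (var)
open HasSubst (subst)

section AgentSubst

variable {T C A : Type u} [TermType T] [DataType T C] [DataType T A]

/-! ### Substitution in agents -/

/-- Every capture-free name `w` serves as well as the chosen `freshName`. Substitution under a
binder can thus use whichever new binder is convenient. -/
theorem RawAgent.alpha_swap_rsubst_of_fresh (P : RawAgent T C A) (σ : Substn T) (x w z : Name)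
    (hw : ∀ a, P.Free a → a ≠ x → Fresh w (σ a)) (hz : ∀ a, P.Free a → Fresh z (σ a)) :
    Alpha (Equiv.swap w z • P.rsubst (σ.update x (var w))) (P.rsubst (σ.update x (var z))) := by
  have := alpha_smul_rsubst_smul P (Equiv.swap w z * 1) 1 1 1
    (σ.update x (var w)) (σ.update x (var z)) (fun a ha => by
      have := binder_step 1 1 σ x w z P (by simpa using hw) (by simpa using hz) a ha
      simp only [Equiv.Perm.one_apply, one_smul] at this ⊢
      exact this)
  simpa using this

theorem RawAgent.exists_fresh_pair (P R S : RawAgent T C A) (σ : Substn T) :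
    ∃ z, ¬ R.Free z ∧ ¬ S.Free z ∧ ∀ a, P.Free a → Fresh z (σ a) := by
  obtain ⟨z, hz, hzf⟩ := exists_fresh ({a | R.Free a} ∪ {a | S.Free a})
    (R.finite_free.union S.finite_free) P σ
  simp only [Set.mem_union, Set.mem_ofPred_eq, not_or] at hz
  exact ⟨z, hz.1, hz.2, hzf⟩

namespace PreAgent

theorem subst_mk (P : RawAgent T C A) (σ : Substn T) : (mk P).subst σ = mk (P.rsubst σ) := rfl

@[simp] theorem subst_output (M N : T) (P : PreAgent T C A) (σ : Substn T) :
    (output M N P).subst σ = output (HasSubst.subst M σ) (HasSubst.subst N σ) (P.subst σ) := by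
  obtain ⟨p, rfl⟩ := exists_mk P; rfl

@[simp] theorem subst_case {n : ℕ} (φ : Fin n → C) (P : Fin n → PreAgent T C A) (σ : Substn T) :
    (case φ P).subst σ = case (fun i => HasSubst.subst (φ i) σ) (fun i => (P i).subst σ) := by
  obtain ⟨p, rfl⟩ := exists_mk_fun P
  simp only [subst_mk, case_mk]
  rfl

@[simp] theorem subst_par (P Q : PreAgent T C A) (σ : Substn T) :
    (par P Q).subst σ = par (P.subst σ) (Q.subst σ) := by
  obtain ⟨p, rfl⟩ := exists_mk P; obtain ⟨q, rfl⟩ := exists_mk Q; rfl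

@[simp] theorem subst_rep (P : PreAgent T C A) (σ : Substn T) :
    (rep P).subst σ = rep (P.subst σ) := by
  obtain ⟨p, rfl⟩ := exists_mk P; rfl

@[simp] theorem subst_assertion (Ψ : A) (σ : Substn T) :
    (assertion Ψ : PreAgent T C A).subst σ = assertion (HasSubst.subst Ψ σ) := rfl

theorem subst_res_of {x w : Name} {P : PreAgent T C A} {σ : Substn T}
    (hw : ∀ a, Occurs a P → a ≠ x → Fresh w (σ a)) :
    (res x P).subst σ = res w (P.subst (σ.update x (var w))) := by
  obtain ⟨p, rfl⟩ := exists_mk P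
  obtain ⟨z, h1, h2, h3⟩ := RawAgent.exists_fresh_pair p
    (p.rsubst (σ.update x (var (p.freshName x σ)))) (p.rsubst (σ.update x (var w))) σ
  exact mk_eq_mk.2 (RawAgent.Alpha.res_of_swap h1 h2
    ((p.alpha_swap_rsubst_of_fresh σ x _ z (p.freshName_spec x σ) h3).trans
      (p.alpha_swap_rsubst_of_fresh σ x w z (fun a ha => hw a (occurs_mk.2 ha)) h3).symm))

theorem subst_input_of {M : T} {x w : Name} {P : PreAgent T C A} {σ : Substn T}
    (hw : ∀ a, Occurs a P → a ≠ x → Fresh w (σ a)) :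
    (input M x P).subst σ = input (HasSubst.subst M σ) w (P.subst (σ.update x (var w))) := by
  obtain ⟨p, rfl⟩ := exists_mk P
  obtain ⟨z, h1, h2, h3⟩ := RawAgent.exists_fresh_pair p
    (p.rsubst (σ.update x (var (p.freshName x σ)))) (p.rsubst (σ.update x (var w))) σ
  exact mk_eq_mk.2 (RawAgent.Alpha.input_of_swap h1 h2
    ((p.alpha_swap_rsubst_of_fresh σ x _ z (p.freshName_spec x σ) h3).trans
      (p.alpha_swap_rsubst_of_fresh σ x w z (fun a ha => hw a (occurs_mk.2 ha)) h3).symm))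

theorem smul_subst_smul (P : PreAgent T C A) (π π' ρ ρ' : NPerm) (σ σ' : Substn T)
    (h : ∀ a, Occurs a P → π • σ (ρ a) = π' • σ' (ρ' a)) :
    π • (ρ • P).subst σ = π' • (ρ' • P).subst σ' := by
  obtain ⟨p, rfl⟩ := exists_mk P
  exact mk_eq_mk.2 (p.alpha_smul_rsubst_smul π π' ρ ρ' σ σ' fun a ha => h a (occurs_mk.2 ha))

theorem subst_congr {P : PreAgent T C A} {σ τ : Substn T} (h : ∀ a, Occurs a P → σ a = τ a) :
    P.subst σ = P.subst τ := by
  simpa using smul_subst_smul P 1 1 1 1 σ τ (by simpa using h)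

theorem exists_binder (σ τ : Substn T) (B : Finset Name) (P : PreAgent T C A) :
    ∃ w, w ∉ B ∧ σ.Fresh w ∧ τ.Fresh w ∧ Fresh w P := by
  obtain ⟨w, hw⟩ := Infinite.exists_notMem_finset (B ∪ σ.supp ∪ τ.supp ∪ nsupp P)
  simp only [Finset.mem_union, not_or, mem_nsupp, not_occurs, ← Substn.fresh_iff] at hw
  exact ⟨w, hw.1.1.1, hw.1.1.2, hw.1.2, hw.2⟩

theorem fresh_apply_of_occurs {P : PreAgent T C A} {σ : Substn T} {x w : Name} (hσ : σ.Fresh w)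
    (hP : w = x ∨ Fresh w P) (a : Name) (ha : Occurs a P) (hax : a ≠ x) : Fresh w (σ a) :=
  hσ.2 a fun h => hP.elim (fun e => hax (h.trans e)) fun e => ha (h ▸ e)

theorem subst_res {x w : Name} {P : PreAgent T C A} {σ : Substn T} (hσ : σ.Fresh w)
    (hP : w = x ∨ Fresh w P) : (res x P).subst σ = res w (P.subst (σ.update x (var w))) :=
  subst_res_of (fresh_apply_of_occurs hσ hP)

theorem subst_input {M : T} {x w : Name} {P : PreAgent T C A} {σ : Substn T} (hσ : σ.Fresh w)
    (hP : w = x ∨ Fresh w P) :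
    (input M x P).subst σ = input (HasSubst.subst M σ) w (P.subst (σ.update x (var w))) :=
  subst_input_of (fresh_apply_of_occurs hσ hP)

theorem subst_rename (P : PreAgent T C A) {π : NPerm} {σ : Substn T}
    (h : ∀ a, Occurs a P → σ a = var (π a)) : P.subst σ = π • P := by
  -- Converting the binder to a fresh `w` on both sides extends `σ` by `x ↦ w` and composes `π` with
  -- the swap of `π x` and `w`; the two still agree on the body.
  have step : ∀ (x w : Name) (P : PreAgent T C A) (π : NPerm) (σ : Substn T), σ.Fresh w →
      Fresh w (π • P) → (∀ a, a ≠ x → Occurs a P → σ a = var (π a)) →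
      ∀ a, Occurs a P → (σ.update x (var w)) a = var ((Equiv.swap (π x) w * π) a) := by
    intro x w P π σ hσ hw h a ha
    by_cases hax : a = x
    · subst hax; simp
    · rw [Substn.update_of_ne _ _ hax, h a hax ha, Equiv.Perm.mul_apply,
        Equiv.swap_apply_of_ne_of_ne (by simpa using hax)]
      rintro rfl
      exact (occurs_smul_iff π a P).2 ha hw
  induction P using PreAgent.ind generalizing π σ with
  | output M N P ih =>
    simp only [subst_output, smul_output]
    rw [ih fun a ha => h a (by simp [ha]),
      LawfulSubst.subst_rename π σ M fun a ha => h a (by simp [ha]),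
      LawfulSubst.subst_rename π σ N fun a ha => h a (by simp [ha])]
  | input M x P ih =>
    obtain ⟨w, hw, h1, -, h2⟩ := exists_binder σ σ (nsupp (π • P)) P
    have hw := fresh_of_notMem hw
    rw [subst_input h1 (Or.inr h2), smul_input, input_conv (b := w) (Or.inr hw), ← mul_smul,
      LawfulSubst.subst_rename π σ M fun a ha => h a (by simp [ha])]
    congr 1
    exact ih (step x w P π σ h1 hw fun a hax ha => h a (by simpa using Or.inr ⟨hax, ha⟩))
  | case φ P ih =>
    simp only [subst_case, smul_case]
    congr 1
    · exact funext fun i => LawfulSubst.subst_rename π σ (φ i) fun a ha =>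
        h a (by simpa using ⟨i, Or.inl ha⟩)
    · exact funext fun i => ih i fun a ha => h a (by simpa using ⟨i, Or.inr ha⟩)
  | res x P ih =>
    obtain ⟨w, hw, h1, -, h2⟩ := exists_binder σ σ (nsupp (π • P)) P
    have hw := fresh_of_notMem hw
    rw [subst_res h1 (Or.inr h2), smul_res, res_conv (b := w) (Or.inr hw), ← mul_smul]
    congr 1
    exact ih (step x w P π σ h1 hw fun a hax ha => h a (by simpa using ⟨hax, ha⟩))
  | par P Q ihP ihQ =>
    simp only [subst_par, smul_par]
    rw [ihP fun a ha => h a (by simp [ha]), ihQ fun a ha => h a (by simp [ha])]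
  | rep P ih =>
    simp only [subst_rep, smul_rep]
    rw [ih fun a ha => h a (by simp [ha])]
  | assertion Ψ =>
    simp only [subst_assertion, smul_assertion]
    rw [LawfulSubst.subst_rename π σ Ψ fun a ha => h a (by simp [ha])]

theorem subst_subst (P : PreAgent T C A) {σ τ ρ : Substn T}
    (h : ∀ a, Occurs a P → ρ a = HasSubst.subst (σ a) τ) :
    (P.subst σ).subst τ = P.subst ρ := by
  -- All three substitutions use the same new binder `w`: it replaces `x` in the first and in the
  -- composite, and is kept by the second.
  have step : ∀ (x w : Name) (P : PreAgent T C A) (σ τ ρ : Substn T), σ.Fresh w → Fresh w P →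
      (∀ a, a ≠ x → Occurs a P → ρ a = HasSubst.subst (σ a) τ) →
      ∀ a, Occurs a P → (ρ.update x (var w)) a =
        HasSubst.subst ((σ.update x (var w)) a) (τ.update w (var w)) := by
    intro x w P σ τ ρ hσ hw h a ha
    by_cases hax : a = x
    · subst hax; simp [TermType.var_subst]
    · rw [Substn.update_of_ne _ _ hax, Substn.update_of_ne _ _ hax, h a hax ha]
      let _ := TermType.dataType T
      exact (subst_update_of_fresh (hσ.2 a fun e => ha (e ▸ hw))).symm
  induction P using PreAgent.ind generalizing σ τ ρ with
  | output M N P ih =>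
    let _ := TermType.dataType T
    simp only [subst_output]
    rw [ih fun a ha => h a (by simp [ha]),
      subst_subst_of (x := M) fun a ha => h a (by simp [ha]),
      subst_subst_of (x := N) fun a ha => h a (by simp [ha])]
  | input M x P ih =>
    let _ := TermType.dataType T
    obtain ⟨w, hw, h1, h2, h3⟩ := exists_binder σ τ ρ.supp P
    have hw := Substn.fresh_iff.2 hw
    rw [subst_input h1 (Or.inr h3), subst_input h2 (Or.inl rfl), subst_input hw (Or.inr h3),
      ih (step x w P σ τ ρ h1 h3 fun a hax ha => h a (by simpa using Or.inr ⟨hax, ha⟩)),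
      subst_subst_of (x := M) fun a ha => h a (by simp [ha])]
  | case φ P ih =>
    simp only [subst_case]
    congr 1
    · exact funext fun i => subst_subst_of fun a ha =>
        h a (by simpa using ⟨i, Or.inl ha⟩)
    · exact funext fun i => ih i fun a ha => h a (by simpa using ⟨i, Or.inr ha⟩)
  | res x P ih =>
    obtain ⟨w, hw, h1, h2, h3⟩ := exists_binder σ τ ρ.supp P
    have hw := Substn.fresh_iff.2 hw
    rw [subst_res h1 (Or.inr h3), subst_res h2 (Or.inl rfl), subst_res hw (Or.inr h3),
      ih (step x w P σ τ ρ h1 h3 fun a hax ha => h a (by simpa using ⟨hax, ha⟩))]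
  | par P Q ihP ihQ =>
    simp only [subst_par]
    rw [ihP fun a ha => h a (by simp [ha]), ihQ fun a ha => h a (by simp [ha])]
  | rep P ih =>
    simp only [subst_rep]
    rw [ih fun a ha => h a (by simp [ha])]
  | assertion Ψ =>
    simp only [subst_assertion]
    rw [subst_subst_of (x := Ψ) fun a ha => h a (by simp [ha])]

theorem occurs_subst (P : PreAgent T C A) {σ : Substn T} {a b : Name} (ha : Occurs a P)
    (hb : Occurs b (σ a)) : Occurs b (P.subst σ) := by
  induction P using PreAgent.ind generalizing σ with
  | output M N P ih =>
    simp only [subst_output, occurs_output] at ha ⊢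
    rcases ha with ha | ha | ha
    · exact Or.inl (LawfulSubst.occurs_subst σ M a b ha hb)
    · exact Or.inr (Or.inl (LawfulSubst.occurs_subst σ N a b ha hb))
    · exact Or.inr (Or.inr (ih ha hb))
  | input M x P ih =>
    obtain ⟨w, hw, h1, -, h3⟩ := exists_binder σ σ {b} P
    rw [subst_input h1 (Or.inr h3)]
    simp only [occurs_input] at ha ⊢
    rcases ha with ha | ⟨hax, ha⟩
    · exact Or.inl (LawfulSubst.occurs_subst σ M a b ha hb)
    · exact Or.inr ⟨fun e => hw (by simp [e]), ih ha (by rwa [Substn.update_of_ne _ _ hax])⟩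
  | case φ P ih =>
    simp only [subst_case, occurs_case] at ha ⊢
    obtain ⟨i, ha⟩ := ha
    exact ⟨i, ha.imp (fun ha => LawfulSubst.occurs_subst σ (φ i) a b ha hb) fun ha => ih i ha hb⟩
  | res x P ih =>
    obtain ⟨w, hw, h1, -, h3⟩ := exists_binder σ σ {b} P
    rw [subst_res h1 (Or.inr h3)]
    simp only [occurs_res] at ha ⊢
    exact ⟨fun e => hw (by simp [e]), ih ha.2 (by rwa [Substn.update_of_ne _ _ ha.1])⟩
  | par P Q ihP ihQ =>
    simp only [subst_par, occurs_par] at ha ⊢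
    exact ha.imp (fun ha => ihP ha hb) fun ha => ihQ ha hb
  | rep P ih =>
    simp only [subst_rep, occurs_rep] at ha ⊢
    exact ih ha hb
  | assertion Ψ =>
    simp only [subst_assertion, occurs_assertion] at ha ⊢
    exact LawfulSubst.occurs_subst σ Ψ a b ha hb

/-- Agents are a nominal data type. -/
noncomputable instance : DataType T (PreAgent T C A) where
  subst := PreAgent.subst
  smul_subst π σ τ P h := by
    simpa using smul_subst_smul P π 1 1 π σ τ fun a _ => by simpa using (h a).symm
  subst_congr _ _ _ h := subst_congr h
  subst_rename _ _ P h := subst_rename P h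
  subst_subst _ _ _ P h := subst_subst P fun a _ => h a
  occurs_subst _ P _ _ ha hb := occurs_subst P ha hb

theorem fresh_subst {P : PreAgent T C A} {σ : Substn T} {a : Name} (hσ : σ.Fresh a)
    (hP : Fresh a P) : Fresh a (P.subst σ) := Psi.fresh_subst (X := PreAgent T C A) hσ hP

theorem fresh_subst_of {P : PreAgent T C A} {σ : Substn T} {a : Name}
    (h : ∀ b, Occurs b P → Fresh a (σ b)) : Fresh a (P.subst σ) :=
  Psi.fresh_subst_of (x := P) (σ := σ) h

theorem subst_update {P : PreAgent T C A} {σ : Substn T} {y : Name} {L : T} (hy : Fresh y P) :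
    P.subst (σ.update y L) = P.subst σ := subst_update_of_fresh (x := P) (σ := σ) hy

theorem smul_subst_eq {π : NPerm} {σ τ : Substn T} {P : PreAgent T C A}
    (h : ∀ a, Occurs a P → τ (π a) = π • σ a) : π • P.subst σ = (π • P).subst τ :=
  Psi.smul_subst_eq (x := P) (σ := σ) h

theorem smul_subst_single (π : NPerm) (x : Name) (L : T) (P : PreAgent T C A) :
    π • P.subst (.single x L) = (π • P).subst (.single (π x) (π • L)) := by
  refine smul_subst_eq fun a _ => ?_
  by_cases h : a = x
  · subst h; simp
  · rw [Substn.single_of_ne _ h, Substn.single_of_ne _ (by simpa using h), NamedTerms.smul_var]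

theorem subst_res_of_fresh {x : Name} {P : PreAgent T C A} {σ : Substn T} (hσ : σ.Fresh x) :
    (res x P).subst σ = res x (P.subst σ) := by
  rw [subst_res hσ (Or.inl rfl)]
  congr 1
  refine subst_congr fun a _ => ?_
  by_cases h : a = x
  · subst h; simp [hσ.1]
  · rw [Substn.update_of_ne _ _ h]

theorem subst_resList_of_fresh {b : List Name} {P : PreAgent T C A} {σ : Substn T}
    (hσ : ∀ a ∈ b, σ.Fresh a) : (resList b P).subst σ = resList b (P.subst σ) := by
  induction b with
  | nil => rfl
  | cons c b ih =>
    have e : ∀ Q : PreAgent T C A, resList (c :: b) Q = res c (resList b Q) := fun _ => rfl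
    rw [e, e, subst_res_of_fresh (hσ c (by simp)), ih fun a ha => hσ a (by simp [ha])]

-- An agent has the same outermost constructor as its instances, which is what allows a concrete
-- derivation from Pσ to be traced back to P.
@[simp] theorem tag_subst (P : PreAgent T C A) (σ : Substn T) : (P.subst σ).tag = P.tag := by
  induction P using PreAgent.ind with
  | input M x P _ =>
    obtain ⟨w, -, h1, -, h3⟩ := exists_binder σ σ ∅ P
    rw [subst_input h1 (Or.inr h3)]; simp
  | res x P _ =>
    obtain ⟨w, -, h1, -, h3⟩ := exists_binder σ σ ∅ P
    rw [subst_res h1 (Or.inr h3)]; simp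
  | _ => simp

theorem exists_output_of_tag {P : PreAgent T C A} (h : P.tag = 0) : ∃ M N P', P = output M N P' := by
  induction P using PreAgent.ind with
  | output M N P _ => exact ⟨M, N, P, rfl⟩
  | _ => simp at h

theorem exists_input_of_tag {P : PreAgent T C A} (h : P.tag = 1) : ∃ M x P', P = input M x P' := by
  induction P using PreAgent.ind with
  | input M x P _ => exact ⟨M, x, P, rfl⟩
  | _ => simp at h

theorem exists_case_of_tag {P : PreAgent T C A} (h : P.tag = 2) :
    ∃ (n : ℕ) (φ : Fin n → C) (P' : Fin n → PreAgent T C A), P = case φ P' := by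
  induction P using PreAgent.ind with
  | case φ P _ => exact ⟨_, φ, P, rfl⟩
  | _ => simp at h

theorem exists_res_of_tag {P : PreAgent T C A} (h : P.tag = 3) : ∃ a P', P = res a P' := by
  induction P using PreAgent.ind with
  | res a P _ => exact ⟨a, P, rfl⟩
  | _ => simp at h

theorem exists_par_of_tag {P : PreAgent T C A} (h : P.tag = 4) : ∃ P' Q', P = par P' Q' := by
  induction P using PreAgent.ind with
  | par P Q _ _ => exact ⟨P, Q, rfl⟩
  | _ => simp at h

theorem exists_rep_of_tag {P : PreAgent T C A} (h : P.tag = 5) : ∃ P', P = rep P' := by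
  induction P using PreAgent.ind with
  | rep P _ => exact ⟨P, rfl⟩
  | _ => simp at h

theorem subst_eq_output {P R : PreAgent T C A} {σ : Substn T} {M N : T}
    (h : P.subst σ = output M N R) :
    ∃ M' N' P', P = output M' N' P' ∧ HasSubst.subst M' σ = M ∧ HasSubst.subst N' σ = N ∧ P'.subst σ = R := by
  obtain ⟨M', N', P', rfl⟩ := exists_output_of_tag (P := P) (by simpa using congrArg tag h)
  rw [subst_output] at h
  obtain ⟨h1, h2, h3⟩ := output_inj h
  exact ⟨M', N', P', rfl, h1, h2, h3⟩

theorem subst_eq_par {P R S : PreAgent T C A} {σ : Substn T} (h : P.subst σ = par R S) :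
    ∃ P' Q', P = par P' Q' ∧ P'.subst σ = R ∧ Q'.subst σ = S := by
  obtain ⟨P', Q', rfl⟩ := exists_par_of_tag (P := P) (by simpa using congrArg tag h)
  rw [subst_par] at h
  obtain ⟨h1, h2⟩ := par_inj h
  exact ⟨P', Q', rfl, h1, h2⟩

theorem subst_eq_rep {P R : PreAgent T C A} {σ : Substn T} (h : P.subst σ = rep R) :
    ∃ P', P = rep P' ∧ P'.subst σ = R := by
  obtain ⟨P', rfl⟩ := exists_rep_of_tag (P := P) (by simpa using congrArg tag h)
  rw [subst_rep] at h
  exact ⟨P', rfl, rep_inj h⟩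

theorem subst_eq_case {n : ℕ} {P : PreAgent T C A} {φ : Fin n → C} {R : Fin n → PreAgent T C A}
    {σ : Substn T} (h : P.subst σ = case φ R) :
    ∃ (φ' : Fin n → C) (P' : Fin n → PreAgent T C A), P = case φ' P' ∧
      (∀ i, HasSubst.subst (φ' i) σ = φ i) ∧ ∀ i, (P' i).subst σ = R i := by
  obtain ⟨m, φ', P', rfl⟩ := exists_case_of_tag (P := P) (by simpa using congrArg tag h)
  rw [subst_case] at h
  obtain ⟨rfl, h1, h2⟩ := case_inj h
  exact ⟨φ', P', rfl, h1, h2⟩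

end PreAgent

end AgentSubst

end Psi

namespace Psi

open NamedTerms (var)
open HasSubst (subst)

section FramesOfAgents

variable {T C A : Type u} [TermType T] [DataType T C] [DataType T A]

/-! ### Assertions up to equivalence -/

/-- Equivalence of assertions, as a setoid. -/
def assertionSetoid (psi : PsiCalculus T C A) : Setoid A where
  r Ψ Ψ' := ∀ φ, psi.entails Ψ φ ↔ psi.entails Ψ' φ
  iseqv := ⟨fun _ _ => Iff.rfl, fun h φ => (h φ).symm, fun h h' φ => (h φ).trans (h' φ)⟩

/-- Assertions up to equivalence. -/
def AssertionClass (psi : PsiCalculus T C A) : Type u := Quotient (assertionSetoid psi)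

/-- The equivalence class of an assertion. -/
def cls (psi : PsiCalculus T C A) (Ψ : A) : AssertionClass psi :=
  Quotient.mk (assertionSetoid psi) Ψ

section Classes

variable {psi : PsiCalculus T C A}

theorem cls_eq {Ψ Ψ' : A} : cls psi Ψ = cls psi Ψ' ↔ ∀ φ, psi.entails Ψ φ ↔ psi.entails Ψ' φ :=
  ⟨fun h => Quotient.exact h, fun h => Quotient.sound (s := assertionSetoid psi) h⟩

/-- The requisite on composition concerns the left factor only; commutativity transfers it to the
right one. -/
theorem comp_congr {Ψ₁ Ψ₂ Φ₁ Φ₂ : A} (h : cls psi Ψ₁ = cls psi Ψ₂) (h' : cls psi Φ₁ = cls psi Φ₂) :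
    cls psi (psi.comp Ψ₁ Φ₁) = cls psi (psi.comp Ψ₂ Φ₂) := by
  rw [cls_eq] at *
  intro φ
  rw [psi.composition _ _ _ h, psi.commutativity, psi.composition _ _ _ h', psi.commutativity]

/-- Rearrangements of composed environments and frames become identities in a commutative monoid, so
that `ac_rfl` proves them. -/
instance : CommMonoid (AssertionClass psi) where
  mul := Quotient.map₂ (sa := assertionSetoid psi) (sb := assertionSetoid psi)
    (sc := assertionSetoid psi) psi.comp fun _ _ h _ _ h' =>
      cls_eq.1 (comp_congr (cls_eq.2 h) (cls_eq.2 h'))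
  one := cls psi psi.unit
  mul_assoc a b c := by
    induction a using Quotient.ind; induction b using Quotient.ind; induction c using Quotient.ind
    exact cls_eq.2 (psi.associativity _ _ _)
  one_mul a := by
    induction a using Quotient.ind
    exact cls_eq.2 fun φ => (psi.commutativity _ _ _).trans (psi.identity _ _)
  mul_one a := by
    induction a using Quotient.ind
    exact cls_eq.2 (psi.identity _)
  mul_comm a b := by
    induction a using Quotient.ind; induction b using Quotient.ind
    exact cls_eq.2 (psi.commutativity _ _)

@[simp] theorem cls_comp (Ψ Ψ' : A) : cls psi (psi.comp Ψ Ψ') = cls psi Ψ * cls psi Ψ' := rfl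

@[simp] theorem cls_unit : cls psi psi.unit = 1 := rfl

theorem entails_of_cls {Ψ Ψ' : A} {φ : C} (h : cls psi Ψ = cls psi Ψ') (hΨ : psi.entails Ψ φ) :
    psi.entails Ψ' φ := (cls_eq.1 h φ).1 hΨ

theorem entails_smul_iff (π : NPerm) {Ψ : A} {φ : C} :
    psi.entails (π • Ψ) (π • φ) ↔ psi.entails Ψ φ :=
  ⟨fun h => by simpa using psi.smul_entails π⁻¹ _ _ h, psi.smul_entails π Ψ φ⟩

theorem cls_smul (π : NPerm) {Ψ Ψ' : A} (h : cls psi Ψ = cls psi Ψ') :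
    cls psi (π • Ψ) = cls psi (π • Ψ') := by
  rw [cls_eq] at *
  intro φ
  have := h (π⁻¹ • φ)
  rwa [← entails_smul_iff π, ← entails_smul_iff (Ψ := Ψ') π, smul_inv_smul] at this

theorem stablyEquivalent_iff {Ψ Ψ' : A} :
    StablyEquivalent psi Ψ Ψ' ↔ ∀ σ : Substn T, cls psi (subst Ψ σ) = cls psi (subst Ψ' σ) :=
  forall_congr' fun _ => cls_eq.symm

theorem fresh_comp {Ψ Ψ' : A} {a : Name} (h : Fresh a Ψ) (h' : Fresh a Ψ') :
    Fresh a (psi.comp Ψ Ψ') := by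
  classical
  refine fresh_of_supports (nsupp Ψ ∪ nsupp Ψ') (by simp [not_occurs, h, h']) fun π hπ => ?_
  rw [psi.smul_comp, smul_eq_of_fix fun b hb => hπ b (by simp [hb]),
    smul_eq_of_fix fun b hb => hπ b (by simp [hb])]

theorem fresh_unit {a : Name} : Fresh a psi.unit :=
  fresh_of_supports ∅ (by simp) fun π _ => psi.smul_unit π

end Classes

theorem freshAll_smul {X : Type v} [MulAction NPerm X] {l : List Name} {x : X} (π : NPerm)
    (h : FreshAll l x) : FreshAll (l.map π) (π • x) := by
  intro a ha
  obtain ⟨b, hb, rfl⟩ := List.mem_map.1 ha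
  exact (fresh_smul_iff π b x).2 (h b hb)

theorem disjoint_map {l l' : List Name} (π : NPerm) (h : List.Disjoint l l') :
    List.Disjoint (l.map π) (l'.map π) := List.disjoint_map π.injective h

/-! ### Well-formed agents -/

/-- The unguarded assertions of `P` satisfy `p`. -/
def PreAgent.Unguarded (p : A → Prop) (P : PreAgent T C A) : Prop :=
  ∃ q, P = mk q ∧ q.Unguarded p

section WellFormed

variable {psi : PsiCalculus T C A}

theorem PreAgent.unguarded_mk {p : A → Prop} (hp : ∀ (π : NPerm) Ψ, p Ψ → p (π • Ψ))
    {q : RawAgent T C A} : (mk q).Unguarded p ↔ q.Unguarded p :=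
  ⟨fun ⟨_, e, h⟩ => ((mk_eq_mk.1 e).unguarded_iff p hp).2 h, fun h => ⟨q, rfl, h⟩⟩

theorem smul_eq_unit (π : NPerm) (Ψ : A) (h : Ψ = psi.unit) : π • Ψ = psi.unit := by
  rw [h, psi.smul_unit]

@[simp] theorem wellFormed_output {M N : T} {P : PreAgent T C A} :
    (PreAgent.output M N P).WellFormed psi ↔ P.WellFormed psi := by
  obtain ⟨p, rfl⟩ := P.exists_mk; exact Iff.rfl

@[simp] theorem wellFormed_input {M : T} {x : Name} {P : PreAgent T C A} :
    (PreAgent.input M x P).WellFormed psi ↔ P.WellFormed psi := by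
  obtain ⟨p, rfl⟩ := P.exists_mk; exact Iff.rfl

@[simp] theorem wellFormed_case {n : ℕ} {φ : Fin n → C} {P : Fin n → PreAgent T C A} :
    (PreAgent.case φ P).WellFormed psi ↔
      ∀ i, (P i).WellFormed psi ∧ (P i).Unguarded (fun Ψ => Ψ = psi.unit) := by
  obtain ⟨p, rfl⟩ := PreAgent.exists_mk_fun P
  simp only [PreAgent.unguarded_mk (smul_eq_unit (psi := psi)), PreAgent.case_mk]
  exact Iff.rfl

@[simp] theorem wellFormed_res {a : Name} {P : PreAgent T C A} :
    (PreAgent.res a P).WellFormed psi ↔ P.WellFormed psi := by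
  obtain ⟨p, rfl⟩ := P.exists_mk; exact Iff.rfl

@[simp] theorem wellFormed_resList {a : List Name} {P : PreAgent T C A} :
    (PreAgent.resList a P).WellFormed psi ↔ P.WellFormed psi := by
  induction a with
  | nil => exact Iff.rfl
  | cons b a ih => exact wellFormed_res.trans ih

@[simp] theorem wellFormed_par {P Q : PreAgent T C A} :
    (PreAgent.par P Q).WellFormed psi ↔ P.WellFormed psi ∧ Q.WellFormed psi := by
  obtain ⟨p, rfl⟩ := P.exists_mk; obtain ⟨q, rfl⟩ := Q.exists_mk; exact Iff.rfl

@[simp] theorem wellFormed_rep {P : PreAgent T C A} :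
    (PreAgent.rep P).WellFormed psi ↔ P.WellFormed psi ∧ P.Unguarded (fun _ => False) := by
  obtain ⟨p, rfl⟩ := P.exists_mk
  rw [PreAgent.unguarded_mk fun _ _ h => h]
  exact Iff.rfl

theorem PreAgent.Unguarded.mono {p q : A → Prop} (h : ∀ Ψ, p Ψ → q Ψ) {P : PreAgent T C A}
    (hP : P.Unguarded p) : P.Unguarded q := by
  obtain ⟨r, rfl, hr⟩ := hP
  refine ⟨r, rfl, ?_⟩
  induction r <;> simp_all [RawAgent.Unguarded]

end WellFormed

/-! ### Frames -/

section Frames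

variable {psi : PsiCalculus T C A}

namespace IsFrame

theorem nodup {P : PreAgent T C A} {b : List Name} {Ψ : A} (h : IsFrame psi P b Ψ) : b.Nodup := by
  induction h with
  | par _ _ hd _ _ ihP ihQ => exact List.nodup_append'.2 ⟨ihP, ihQ, hd⟩
  | res _ ha ih => exact List.nodup_cons.2 ⟨ha, ih⟩
  | _ => exact List.nodup_nil

protected theorem smul {P : PreAgent T C A} {b : List Name} {Ψ : A} (π : NPerm)
    (h : IsFrame psi P b Ψ) : IsFrame psi (π • P) (b.map π) (π • Ψ) := by
  induction h with
  | output M N P => rw [psi.smul_unit, PreAgent.smul_output]; exact .output _ _ _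
  | input M x P => rw [psi.smul_unit, PreAgent.smul_input]; exact .input _ _ _
  | case φ P => rw [psi.smul_unit, PreAgent.smul_case]; exact .case _ _
  | rep P => rw [psi.smul_unit, PreAgent.smul_rep]; exact .rep _
  | assertion Ψ => rw [PreAgent.smul_assertion]; exact .assertion _
  | par _ _ hd h1 h2 ihP ihQ =>
    rw [psi.smul_comp, PreAgent.smul_par, List.map_append]
    exact .par ihP ihQ (disjoint_map π hd) (freshAll_smul π h1) (freshAll_smul π h2)
  | res _ ha ih =>
    rw [PreAgent.smul_res]
    exact .res ih (by simpa using ha)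

theorem fresh {P : PreAgent T C A} {b : List Name} {Ψ : A} (h : IsFrame psi P b Ψ) {w : Name}
    (hw : Fresh w P) (hb : w ∉ b) : Fresh w Ψ := by
  induction h with
  | par _ _ _ _ _ ihP ihQ =>
    simp only [PreAgent.fresh_par, List.mem_append, not_or] at hw hb
    exact fresh_comp (ihP hw.1 hb.1) (ihQ hw.2 hb.2)
  | res _ _ ih =>
    simp only [PreAgent.fresh_res, List.mem_cons, not_or] at hw hb
    exact ih (hw.resolve_left hb.1) hb.2
  | assertion Ψ => simpa using hw
  | _ => exact fresh_unit

protected theorem subst {P : PreAgent T C A} {b : List Name} {Ψ : A} {σ : Substn T}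
    (h : IsFrame psi P b Ψ) (hσ : ∀ a ∈ b, σ.Fresh a) :
    IsFrame psi (P.subst σ) b (subst Ψ σ) := by
  induction h with
  | output M N P => rw [psi.unit_subst, PreAgent.subst_output]; exact .output _ _ _
  | input M x P =>
    obtain ⟨w, -, h1, -, h3⟩ := PreAgent.exists_binder σ σ ∅ P
    rw [psi.unit_subst, PreAgent.subst_input h1 (Or.inr h3)]; exact .input _ _ _
  | case φ P => rw [psi.unit_subst, PreAgent.subst_case]; exact .case _ _
  | rep P => rw [psi.unit_subst, PreAgent.subst_rep]; exact .rep _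
  | assertion Ψ => exact .assertion _
  | par _ _ hd h1 h2 ihP ihQ =>
    rw [psi.comp_subst, PreAgent.subst_par]
    exact .par (ihP fun a ha => hσ a (by simp [ha])) (ihQ fun a ha => hσ a (by simp [ha])) hd
      (fun a ha => fresh_subst (hσ a (by simp [ha])) (h1 a ha))
      (fun a ha => fresh_subst (hσ a (by simp [ha])) (h2 a ha))
  | res _ ha ih =>
    rw [PreAgent.subst_res_of_fresh (hσ _ (by simp))]
    exact .res (ih fun a ha => hσ a (by simp [ha])) ha

theorem nil_of_tag {P : PreAgent T C A} {b : List Name} {Ψ : A} (h : IsFrame psi P b Ψ)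
    (hP : P.tag ∈ [0, 1, 2, 5]) : b = [] ∧ Ψ = psi.unit := by
  induction h with
  | par => simp at hP
  | res => simp at hP
  | assertion => simp at hP
  | _ => exact ⟨rfl, rfl⟩

theorem par_inv {P Q : PreAgent T C A} {b : List Name} {Ψ : A}
    (h : IsFrame psi (.par P Q) b Ψ) : ∃ bP bQ ΨP ΨQ, b = bP ++ bQ ∧ Ψ = psi.comp ΨP ΨQ ∧
      IsFrame psi P bP ΨP ∧ IsFrame psi Q bQ ΨQ ∧ List.Disjoint bP bQ ∧ FreshAll bP ΨQ ∧
      FreshAll bQ ΨP := by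
  generalize hR : PreAgent.par P Q = R at h
  induction h with
  | par hP hQ hd h1 h2 _ _ =>
    obtain ⟨rfl, rfl⟩ := PreAgent.par_inj hR
    exact ⟨_, _, _, _, rfl, rfl, hP, hQ, hd, h1, h2⟩
  | _ => simpa using congrArg PreAgent.tag hR

/-- The frame names determine which alpha-variant of the restriction was used, so the new binder
need not be the given one. -/
theorem res_inv {a : Name} {P : PreAgent T C A} {b : List Name} {Ψ : A}
    (h : IsFrame psi (.res a P) b Ψ) : ∃ a' P' b', b = a' :: b' ∧
      PreAgent.res a P = .res a' P' ∧ IsFrame psi P' b' Ψ ∧ a' ∉ b' := by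
  generalize hR : PreAgent.res a P = R at h
  induction h with
  | res h ha _ => exact ⟨_, _, _, rfl, rfl, h, ha⟩
  | _ => simpa using congrArg PreAgent.tag hR

theorem assertion_inv {Ψ Ψ' : A} {b : List Name}
    (h : IsFrame psi (PreAgent.assertion Ψ : PreAgent T C A) b Ψ') : b = [] ∧ Ψ' = Ψ := by
  generalize hR : (PreAgent.assertion Ψ : PreAgent T C A) = R at h
  induction h with
  | assertion => exact ⟨rfl, (PreAgent.assertion_inj hR).symm⟩
  | _ => simpa using congrArg PreAgent.tag hR

/-- When the two lists are disjoint, the renamings obtained for the components of a parallel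
composition do not interfere, and their product renames the whole frame. -/
theorem exists_perm_of_disjoint {P : PreAgent T C A} {b c : List Name} {Ψ Ψ' : A}
    (h : IsFrame psi P b Ψ) (h' : IsFrame psi P c Ψ') (hd : List.Disjoint b c) :
    ∃ π : NPerm, b.map π = c ∧ π • Ψ = Ψ' ∧ ∀ e, e ∉ b → e ∉ c → π e = e := by
  have triv : ∀ {P : PreAgent T C A} {c : List Name} {Ψ' : A}, IsFrame psi P c Ψ' →
      P.tag ∈ [0, 1, 2, 5] → ∃ π : NPerm, [].map π = c ∧ π • psi.unit = Ψ' ∧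
        ∀ e, e ∉ ([] : List Name) → e ∉ c → π e = e := by
    intro P c Ψ' h hP
    obtain ⟨rfl, rfl⟩ := nil_of_tag h hP
    exact ⟨1, rfl, one_smul _ _, fun _ _ _ => rfl⟩
  induction h generalizing c Ψ' with
  | assertion Ψ =>
    obtain ⟨rfl, rfl⟩ := assertion_inv h'
    exact ⟨1, rfl, one_smul _ _, fun _ _ _ => rfl⟩
  | @par P Q bP bQ ΨP ΨQ hP hQ hPQ h1 h2 ihP ihQ =>
    obtain ⟨cP, cQ, ΦP, ΦQ, rfl, rfl, hP', hQ', hPQ', h1', h2'⟩ := par_inv h'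
    simp only [List.disjoint_append_left, List.disjoint_append_right] at hd
    obtain ⟨⟨dPP, dQP⟩, dPQ, dQQ⟩ := hd
    obtain ⟨π, hπ, hπΨ, hπf⟩ := ihP hP' dPP
    obtain ⟨ρ, hρ, hρΨ, hρf⟩ := ihQ hQ' dQQ
    -- The names moved by `ρ` are frame names of the right component, old or new. The old ones are
    -- fresh for `ΨP` by assumption; the new ones are fresh for `ΦP`, which is `ΨP` renamed by `π`,
    -- and `π` fixes them.
    have eP : ρ • ΨP = ΨP := by
      refine smul_eq_of_fix fun e he => hρf e (fun h => he (h2 e h)) fun h => he ?_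
      have := h2' e h
      rwa [← hπΨ, fresh_smul_iff', show π⁻¹ e = e by
        rw [Equiv.Perm.inv_eq_iff_eq]
        exact (hπf e (fun h' => dPQ h' h) fun h' => hPQ' h' h).symm] at this
    have eQ : π • ΦQ = ΦQ := by
      refine smul_eq_of_fix fun e he => hπf e (fun h => he ?_) fun h => he (h1' e h)
      have := h1 e h
      rwa [← hρΨ, fresh_smul_iff', show ρ⁻¹ e = e by
        rw [Equiv.Perm.inv_eq_iff_eq]
        exact (hρf e (fun h' => hPQ h h') fun h' => dPQ h h').symm]
    refine ⟨π * ρ, ?_, ?_, fun e he he' => ?_⟩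
    · rw [List.map_append, ← hπ, ← hρ]
      congr 1
      · refine List.map_congr_left fun e he => congrArg π ?_
        exact hρf e (fun h => hPQ he h) fun h => dPQ he h
      · refine List.map_congr_left fun e he => ?_
        have : ρ e ∈ cQ := hρ ▸ List.mem_map_of_mem he
        exact hπf _ (fun h => dPQ h this) fun h => hPQ' h this
    · rw [psi.smul_comp, mul_smul, mul_smul, eP, hπΨ, hρΨ, eQ]
    · simp only [List.mem_append, not_or] at he he'
      rw [Equiv.Perm.mul_apply, hρf e he.2 he'.2, hπf e he.1 he'.1]
  | @res a P b Ψ hP ha ih =>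
    obtain ⟨a', P', c', rfl, hR, hP', ha'⟩ := res_inv h'
    have haa : a ≠ a' := fun h => hd (List.mem_cons_self) (h ▸ List.mem_cons_self)
    have hac : a ∉ c' := fun h => hd (List.mem_cons_self) (List.mem_cons_of_mem _ h)
    have hbc : List.Disjoint b c' := fun e h h' =>
      hd (List.mem_cons_of_mem _ h) (List.mem_cons_of_mem _ h')
    obtain ⟨rfl, -⟩ := PreAgent.res_inj hR
    have hP2 := hP'.smul (Equiv.swap a a')
    have hc' : c'.map (Equiv.swap a a') = c' := by
      refine (List.map_congr_left (g := _root_.id) fun e he => ?_).trans (List.map_id _)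
      exact Equiv.swap_apply_of_ne_of_ne (fun h => hac (h ▸ he)) fun h => ha' (h ▸ he)
    rw [← mul_smul, Equiv.swap_mul_self, one_smul, hc'] at hP2
    obtain ⟨π, hπ, hπΨ, hπf⟩ := ih hP2 hbc
    refine ⟨Equiv.swap a a' * π, ?_, ?_, fun e he he' => ?_⟩
    · rw [List.map_cons, Equiv.Perm.mul_apply, hπf a ha hac, Equiv.swap_apply_left]
      congr 1
      rw [Equiv.Perm.coe_mul, ← List.map_map, hπ, hc']
    · rw [mul_smul, hπΨ, ← mul_smul, Equiv.swap_mul_self, one_smul]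
    · simp only [List.mem_cons, not_or] at he he'
      rw [Equiv.Perm.mul_apply, hπf e he.2 he'.2, Equiv.swap_apply_of_ne_of_ne he.1 he'.1]
  | _ => exact triv h' (by simp)

end IsFrame

theorem exists_isFrame (psi : PsiCalculus T C A) (P : PreAgent T C A) (B : Finset Name) :
    ∃ b Ψ, IsFrame psi P b Ψ ∧ ∀ a ∈ b, a ∉ B := by
  classical
  induction P using PreAgent.ind generalizing B with
  | output M N P => exact ⟨_, _, .output M N P, by simp⟩
  | input M x P => exact ⟨_, _, .input M x P, by simp⟩
  | case φ P => exact ⟨_, _, .case φ P, by simp⟩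
  | rep P => exact ⟨_, _, .rep P, by simp⟩
  | assertion Ψ => exact ⟨_, _, .assertion Ψ, by simp⟩
  | par P Q ihP ihQ =>
    -- The right frame is chosen first, away from `P`; the left one then avoids the right one. That
    -- `bQ` is fresh for `ΨP` follows afterwards, since `ΨP` only has names from `P` and `bP`.
    obtain ⟨bQ, ΨQ, hQ, hbQ⟩ := ihQ (B ∪ nsupp P)
    obtain ⟨bP, ΨP, hP, hbP⟩ := ihP (B ∪ nsupp ΨQ ∪ bQ.toFinset)
    simp only [Finset.mem_union, not_or, mem_nsupp, not_occurs, List.mem_toFinset] at hbQ hbP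
    have hd : List.Disjoint bP bQ := fun a ha => (hbP a ha).2
    refine ⟨_, _, .par hP hQ hd (fun a ha => (hbP a ha).1.2) (fun a ha => hP.fresh (hbQ a ha).2
      fun h => hd h ha), fun a ha => ?_⟩
    exact (List.mem_append.1 ha).elim (fun h => (hbP a h).1.1) fun h => (hbQ a h).1
  | res a P ih =>
    obtain ⟨c, hc⟩ := Infinite.exists_notMem_finset (B ∪ nsupp P)
    simp only [Finset.mem_union, not_or, mem_nsupp, not_occurs] at hc
    obtain ⟨b, Ψ, h, hb⟩ := ih ((B ∪ {c}).image (Equiv.swap a c))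
    have hb' : ∀ e ∈ b.map (Equiv.swap a c), e ∉ B ∪ {c} := by
      intro e he heB
      obtain ⟨d, hd, rfl⟩ := List.mem_map.1 he
      exact hb d hd (Finset.mem_image.2 ⟨_, heB, Equiv.swap_apply_self _ _ _⟩)
    rw [PreAgent.res_conv (Or.inr hc.2)]
    refine ⟨_, _, .res (h.smul (Equiv.swap a c)) fun h => hb' c h (by simp), fun e he => ?_⟩
    rcases List.mem_cons.1 he with rfl | he
    · exact hc.1
    · exact fun h => hb' e he (by simp [h])

/-- Frames are unique up to renaming their bound names. -/
theorem IsFrame.exists_perm {P : PreAgent T C A} {b c : List Name} {Ψ Ψ' : A}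
    (h : IsFrame psi P b Ψ) (h' : IsFrame psi P c Ψ') (B : Finset Name) :
    ∃ π : NPerm, b.map π = c ∧ π • Ψ = Ψ' ∧ ∀ e ∈ B, e ∉ b → e ∉ c → π e = e := by
  classical
  -- Disjointness is removed by passing through a third frame whose names avoid both others.
  obtain ⟨d, Φ, hd, hdB⟩ := exists_isFrame psi P (B ∪ b.toFinset ∪ c.toFinset)
  simp only [Finset.mem_union, not_or, List.mem_toFinset] at hdB
  obtain ⟨π, h1, h2, h3⟩ := h.exists_perm_of_disjoint hd fun e he he' => (hdB e he').1.2 he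
  obtain ⟨ρ, h4, h5, h6⟩ := hd.exists_perm_of_disjoint h' fun e he he' => (hdB e he).2 he'
  refine ⟨ρ * π, ?_, ?_, fun e he heb hec => ?_⟩
  · rw [Equiv.Perm.coe_mul, ← List.map_map, h1, h4]
  · rw [mul_smul, h2, h5]
  · have hed : e ∉ d := fun h => (hdB e h).1.1 he
    rw [Equiv.Perm.mul_apply, h3 e heb hed, h6 e hed hec]

/-- A permutation that converts the bound names of one frame to those of another one, and fixes the
free names, converts one frame to the other one. -/
theorem IsFrame.smul_eq {P : PreAgent T C A} {b c : List Name} {Ψ Ψ' : A}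
    (h : IsFrame psi P b Ψ) (h' : IsFrame psi P c Ψ') (hc : FreshAll c P)
    {π : NPerm} (hπ : b.map π = c) (hP : ∀ e, Occurs e P → π e = e) : π • Ψ = Ψ' := by
  obtain ⟨ρ, h1, rfl, h3⟩ := h.exists_perm h' (nsupp P)
  refine smul_eq_smul fun e he => ?_
  by_cases heb : e ∈ b
  · exact (List.map_inj_left (f := π) (g := ρ)).1 (hπ.trans h1.symm) e heb
  · have heP : Occurs e P := fun heP => he (h.fresh heP heb)
    rw [hP e heP, h3 e (by simpa using heP) heb fun hec => heP (hc e hec)]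

/-- A frame of P with names fresh for σ becomes a frame of Pσ when σ is applied to its assertion.
Any other frame of Pσ differs from it by a renaming that fixes `Ψ` and `φ`, and entailment is
equivariant. -/
theorem substFrameEntails_iff {Ψ : A} {P : PreAgent T C A} {σ : Substn T} {φ : C} :
    SubstFrameEntails psi Ψ P σ φ ↔ FrameEntails psi Ψ (P.subst σ) φ := by
  classical
  constructor
  · rintro ⟨b, ΨP, h, hσ, hΨ, hφ, he⟩
    exact ⟨b, _, h.subst hσ, hΨ, hφ, he⟩
  · rintro ⟨b, Φ, h, hΨ, hφ, he⟩
    obtain ⟨c, ΨP, hc, hcB⟩ := exists_isFrame psi P (σ.supp ∪ nsupp Ψ ∪ nsupp φ)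
    simp only [Finset.mem_union, not_or, mem_nsupp, not_occurs, ← Substn.fresh_iff] at hcB
    obtain ⟨π, h1, h2, h3⟩ := h.exists_perm (hc.subst fun a ha => (hcB a ha).1.1)
      (nsupp Ψ ∪ nsupp φ)
    refine ⟨c, ΨP, hc, fun a ha => (hcB a ha).1.1, fun a ha => (hcB a ha).1.2,
      fun a ha => (hcB a ha).2, ?_⟩
    have := psi.smul_entails π _ _ he
    rwa [psi.smul_comp, h2, smul_eq_of_fix fun e he => h3 e (by simp [he]) (fun h => he (hΨ e h))
      fun h => he (hcB e h).1.2, smul_eq_of_fix fun e he => h3 e (by simp [he])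
      (fun h => he (hφ e h)) fun h => he (hcB e h).2] at this

/-- Without proper unguarded assertions, frames are trivial. -/
theorem IsFrame.cls_subst_of_unguarded {P : PreAgent T C A} {b : List Name} {Ψ : A}
    (h : IsFrame psi P b Ψ) (hP : P.Unguarded fun Ψ => Ψ = psi.unit) (σ : Substn T) :
    cls psi (subst Ψ σ) = 1 := by
  have key := @PreAgent.unguarded_mk T C A _ _ _ _ (smul_eq_unit (psi := psi))
  induction h with
  | @par P Q _ _ _ _ _ _ _ _ _ ihP ihQ =>
    obtain ⟨p, rfl⟩ := P.exists_mk; obtain ⟨q, rfl⟩ := Q.exists_mk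
    have h2 : (RawAgent.par p q).Unguarded fun Ψ => Ψ = psi.unit := key.1 hP
    rw [psi.comp_subst, cls_comp, ihP (key.2 h2.1), ihQ (key.2 h2.2), mul_one]
  | @res a P _ _ _ _ ih =>
    obtain ⟨p, rfl⟩ := P.exists_mk
    have h2 : (RawAgent.res a p).Unguarded fun Ψ => Ψ = psi.unit := key.1 hP
    exact ih (key.2 h2)
  | assertion Ψ =>
    have h2 : Ψ = psi.unit := key.1 hP
    rw [h2, psi.unit_subst, cls_unit]
  | _ => rw [psi.unit_subst, cls_unit]

end Frames

end FramesOfAgents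

end Psi

namespace Psi

open NamedTerms (var)
open HasSubst (subst)

section ConcreteTransitions

variable {T C A : Type u} [TermType T] [DataType T C] [DataType T A]

/-! ### Actions -/

namespace Action

variable {S : Type v}

instance [MulAction NPerm S] : MulAction NPerm (Action S T) where
  smul π α := match α with
    | tau => tau
    | inp M x => inp (π • M) (π x)
    | out M a N => out (π • M) (a.map π) (π • N)
  one_smul α := by
    cases α with
    | tau => rfl
    | inp M x => exact congrArg (inp · x) (one_smul NPerm M)
    | out M a N =>
      change out ((1 : NPerm) • M) (a.map _root_.id) ((1 : NPerm) • N) = _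
      rw [one_smul, one_smul, List.map_id]
  mul_smul π ρ α := by
    cases α with
    | tau => rfl
    | inp M x => exact congrArg (inp · _) (mul_smul π ρ M)
    | out M a N =>
      change out ((π * ρ) • M) (a.map (π ∘ ρ)) ((π * ρ) • N) =
        out (π • ρ • M) ((a.map ρ).map π) (π • ρ • N)
      rw [mul_smul, mul_smul, List.map_map]

section

variable [MulAction NPerm S]

@[simp] theorem smul_tau (π : NPerm) : π • (tau : Action S T) = tau := rfl

@[simp] theorem smul_inp (π : NPerm) (M : S) (x : Name) :
    π • (inp M x : Action S T) = inp (π • M) (π x) := rfl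

@[simp] theorem smul_out (π : NPerm) (M : S) (a : List Name) (N : T) :
    π • out M a N = out (π • M) (a.map π) (π • N) := rfl

@[simp] theorem bn_smul (π : NPerm) (α : Action S T) : (π • α).bn = α.bn.map π := by
  cases α <;> simp [bn]

theorem subj_smul (π : NPerm) (α : Action S T) : (π • α).subj = α.subj.map (π • ·) := by
  cases α <;> simp [subj]

theorem fresh_smul {π : NPerm} {α : Action S T} {b : Name} (h : α.Fresh b) :
    (π • α).Fresh (π b) := by
  cases α with
  | tau => trivial
  | inp M x => exact ⟨Psi.fresh_smul π h.1, by simpa using h.2⟩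
  | out M a N => exact ⟨Psi.fresh_smul π h.1, by simpa using h.2.1, Psi.fresh_smul π h.2.2⟩

theorem Fresh.notMem_bn {α : Action S T} {b : Name} (h : α.Fresh b) : b ∉ α.bn := by
  cases α with
  | tau => simp [bn]
  | inp M x => simpa [bn] using h.2
  | out M a N => exact h.2.1

/-- The name is fresh for the object of an output. -/
def ObjFresh (b : Name) : Action S T → Prop
  | out _ _ N => Psi.Fresh b N
  | _ => True

end

/-- The support of an action, including its bound names. -/
noncomputable def supp [NominalSet S] : Action S T → Finset Name
  | tau => ∅
  | inp M x => nsupp M ∪ {x}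
  | out M a N => nsupp M ∪ a.toFinset ∪ nsupp N

theorem fresh_iff [NominalSet S] {α : Action S T} {b : Name} : α.Fresh b ↔ b ∉ α.supp := by
  cases α <;> simp [supp, Fresh, not_occurs, and_comm, and_assoc]

theorem smul_eq_of_fix [NominalSet S] {α : Action S T} {π : NPerm} (h : ∀ e ∈ α.supp, π e = e) :
    π • α = α := by
  cases α with
  | tau => rfl
  | inp M x =>
    rw [smul_inp, Psi.smul_eq_of_fix fun e he => h e (by simp [supp, he]), h x (by simp [supp])]
  | out M a N =>
    rw [smul_out, Psi.smul_eq_of_fix fun e he => h e (by simp [supp, he]),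
      Psi.smul_eq_of_fix fun e he => h e (by simp [supp, he])]
    congr 1
    exact (List.map_congr_left (g := _root_.id) fun e he => h e (by simp [supp, he])).trans
      (List.map_id _)

end Action

theorem smul_swap_smul {X : Type v} [MulAction NPerm X] (π : NPerm) (x z : Name) (P : X) :
    π • Equiv.swap x z • P = Equiv.swap (π x) (π z) • π • P := by
  rw [← mul_smul, ← mul_smul, Equiv.mul_swap_eq_swap_mul]

theorem map_swap_map (π : NPerm) (x z : Name) (l : List Name) :
    (l.map (Equiv.swap x z)).map π = (l.map π).map (Equiv.swap (π x) (π z)) := by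
  rw [List.map_map, List.map_map, ← Equiv.Perm.coe_mul, ← Equiv.Perm.coe_mul,
    Equiv.mul_swap_eq_swap_mul]

/-- The derivative of a communication has no new free names: those of the received object come from
the sender, and the input variable is replaced. -/
theorem fresh_com {P' Q' : PreAgent T C A} {N : T} {w x : Name} {a : List Name}
    (h : w ∈ a ∨ (Fresh w N ∧ Fresh w P')) (h' : w = x ∨ Fresh w Q') :
    w ∈ a ∨ (Fresh w P' ∧ Fresh w (Q'.subst (.single x N))) := by
  refine h.imp_right fun h => ⟨h.2, PreAgent.fresh_subst_of fun b hb => ?_⟩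
  by_cases hbx : b = x
  · subst hbx; simpa using h.1
  · rw [Substn.single_of_ne _ hbx]
    rcases h' with rfl | h'
    · exact fresh_var (Ne.symm hbx)
    · exact fresh_var fun e => hb (e ▸ h')

/-! ### Concrete transitions -/

namespace Trans

variable {psi : PsiCalculus T C A}

protected theorem smul {Ψ : A} {P P' : PreAgent T C A} {α : Action T T} (π : NPerm)
    (h : Trans psi Ψ P α P') : Trans psi (π • Ψ) (π • P) (π • α) (π • P') := by
  induction h with
  | inp h =>
    rw [PreAgent.smul_input]
    exact .inp (by rw [← psi.smul_chan]; exact psi.smul_entails _ _ _ h)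
  | out h =>
    rw [PreAgent.smul_output]
    exact .out (by rw [← psi.smul_chan]; exact psi.smul_entails _ _ _ h)
  | case _ h ih =>
    rw [PreAgent.smul_case]
    exact .case ih (psi.smul_entails _ _ _ h)
  | com_left h1 h2 h3 h4 h5 h6 h7 h8 h9 h10 h11 _ _ h12 h13 ih1 ih2 =>
    rw [psi.smul_comp] at ih1 ih2
    rw [PreAgent.smul_par, PreAgent.smul_resList, PreAgent.smul_par, PreAgent.smul_subst_single]
    refine .com_left (h1.smul π) (h2.smul π) (disjoint_map π h3) (freshAll_smul π h4)
      (freshAll_smul π h5) (freshAll_smul π h6) (freshAll_smul π h7) (freshAll_smul π h8)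
      (freshAll_smul π h9) (freshAll_smul π h10) (freshAll_smul π h11) ih1 ih2 ?_
      (freshAll_smul π h13)
    rw [← psi.smul_comp, ← psi.smul_comp, ← psi.smul_chan]
    exact psi.smul_entails _ _ _ h12
  | com_right h1 h2 h3 h4 h5 h6 h7 h8 h9 h10 h11 _ _ h12 h13 ih1 ih2 =>
    rw [psi.smul_comp] at ih1 ih2
    rw [PreAgent.smul_par, PreAgent.smul_resList, PreAgent.smul_par, PreAgent.smul_subst_single]
    refine .com_right (h1.smul π) (h2.smul π) (disjoint_map π h3) (freshAll_smul π h4)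
      (freshAll_smul π h5) (freshAll_smul π h6) (freshAll_smul π h7) (freshAll_smul π h8)
      (freshAll_smul π h9) (freshAll_smul π h10) (freshAll_smul π h11) ih1 ih2 ?_
      (freshAll_smul π h13)
    rw [← psi.smul_comp, ← psi.smul_comp, ← psi.smul_chan]
    exact psi.smul_entails _ _ _ h12
  | par_left h1 h2 h3 h4 _ h5 ih =>
    rw [psi.smul_comp] at ih
    rw [PreAgent.smul_par, PreAgent.smul_par]
    exact .par_left (h1.smul π) (freshAll_smul π h2) (freshAll_smul π h3)
      (by simpa using fun b hb => Action.fresh_smul (h4 b hb)) ih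
      (by rw [Action.bn_smul]; exact freshAll_smul π h5)
  | par_right h1 h2 h3 h4 _ h5 ih =>
    rw [psi.smul_comp] at ih
    rw [PreAgent.smul_par, PreAgent.smul_par]
    exact .par_right (h1.smul π) (freshAll_smul π h2) (freshAll_smul π h3)
      (by simpa using fun b hb => Action.fresh_smul (h4 b hb)) ih
      (by rw [Action.bn_smul]; exact freshAll_smul π h5)
  | scope _ h1 h2 ih =>
    rw [PreAgent.smul_res, PreAgent.smul_res]
    exact .scope ih (Action.fresh_smul h1) (fresh_smul π h2)
  | openRes _ h1 h2 h3 h4 ih =>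
    rw [PreAgent.smul_res, Action.smul_out, List.map_append, List.map_cons]
    rw [Action.smul_out, List.map_append] at ih
    refine .openRes ih ?_ (fresh_smul π h2) (fresh_smul π h3) ((occurs_smul_iff π _ _).2 h4)
    rw [← List.map_append]
    simpa using h1
  | rep _ ih =>
    rw [PreAgent.smul_par, PreAgent.smul_rep] at ih
    rw [PreAgent.smul_rep]
    exact .rep ih
  | inp_conv _ h ih =>
    rw [smul_swap_smul]
    exact .inp_conv ih (fresh_smul π h)
  | out_conv _ h1 h2 h3 h4 ih =>
    rw [smul_swap_smul, Action.smul_out, map_swap_map, smul_swap_smul]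
    exact .out_conv ih (List.mem_map_of_mem h1) (by simpa using h2) (fresh_smul π h3)
      (fresh_smul π h4)

theorem bn_nodup {Ψ : A} {P P' : PreAgent T C A} {α : Action T T}
    (h : Trans psi Ψ P α P') : α.bn.Nodup := by
  induction h with
  | openRes _ h1 _ _ _ ih =>
    simp only [Action.bn] at ih ⊢
    rw [List.nodup_middle]
    exact List.nodup_cons.2 ⟨h1, ih⟩
  | out_conv _ _ _ _ _ ih => exact List.Nodup.map (Equiv.injective _) ih
  | _ => simp_all [Action.bn]

theorem fresh_swap_smul {X : Type v} [MulAction NPerm X] {x : X} {b c w : Name}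
    (hc : Fresh c x) (hw : w ≠ b → Fresh w x) (hwc : w ≠ c) : Fresh w (Equiv.swap b c • x) := by
  rw [fresh_smul_iff', Equiv.swap_inv]
  by_cases h : w = b
  · subst h; rwa [Equiv.swap_apply_left]
  · rw [Equiv.swap_apply_of_ne_of_ne h hwc]; exact hw h

/-- Transitions do not create free names. -/
theorem fresh {Ψ : A} {P P' : PreAgent T C A} {α : Action T T} (h : Trans psi Ψ P α P') {w : Name}
    (hw : Fresh w P) : w ∈ α.bn ∨ (α.ObjFresh w ∧ Fresh w P') := by
  induction h with
  | inp h => simp_all [Action.bn, Action.ObjFresh]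
  | out h => simp_all [Action.bn, Action.ObjFresh]
  | case _ _ ih => exact ih ((PreAgent.fresh_case.1 hw _).2)
  | com_left _ _ _ _ _ _ _ _ _ _ _ _ _ _ _ ih1 ih2 =>
    rw [PreAgent.fresh_par] at hw
    have := fresh_com (ih1 hw.1) (by simpa [Action.bn, Action.ObjFresh] using ih2 hw.2)
    simpa [Action.bn, Action.ObjFresh] using this
  | com_right _ _ _ _ _ _ _ _ _ _ _ _ _ _ _ ih1 ih2 =>
    rw [PreAgent.fresh_par] at hw
    have := fresh_com (ih2 hw.2) (by simpa [Action.bn, Action.ObjFresh] using ih1 hw.1)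
    simpa [Action.bn, Action.ObjFresh, and_comm] using this
  | par_left _ _ _ _ _ _ ih =>
    rw [PreAgent.fresh_par] at hw ⊢
    exact (ih hw.1).imp_right fun h => ⟨h.1, h.2, hw.2⟩
  | par_right _ _ _ _ _ _ ih =>
    rw [PreAgent.fresh_par] at hw ⊢
    exact (ih hw.2).imp_right fun h => ⟨h.1, hw.1, h.2⟩
  | @scope _ _ α _ b _ h _ ih =>
    rw [PreAgent.fresh_res] at hw ⊢
    rcases hw with rfl | hw
    · refine Or.inr ⟨?_, Or.inl rfl⟩
      cases α with
      | out M a N => exact h.2.2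
      | _ => trivial
    · exact (ih hw).imp_right fun h => ⟨h.1, Or.inr h.2⟩
  | openRes _ _ _ _ _ ih =>
    rw [PreAgent.fresh_res] at hw
    rcases hw with rfl | hw
    · simp [Action.bn]
    · refine (ih hw).imp_left fun h => ?_
      simp only [Action.bn, List.mem_append, List.mem_cons] at h ⊢
      tauto
  | rep _ ih => exact ih (by simpa using hw)
  | inp_conv _ h ih =>
    have ih := ih hw
    simp only [Action.bn, Action.ObjFresh, List.mem_singleton, true_and] at ih ⊢
    exact or_iff_not_imp_left.2 fun hz =>
      fresh_swap_smul h (fun hx => ih.resolve_left hx) hz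
  | @out_conv _ _ _ _ _ _ b c _ hb hc h1 h2 ih =>
    have ih := ih hw
    simp only [Action.bn, Action.ObjFresh] at ih ⊢
    refine or_iff_not_imp_left.2 fun hz => ?_
    have hwc : w ≠ c := fun e => hz (List.mem_map.2 ⟨b, hb, by simp [e]⟩)
    have : w ≠ b → w ∉ _ := fun hwb h => hz (List.mem_map.2 ⟨w, h,
      Equiv.swap_apply_of_ne_of_ne hwb hwc⟩)
    exact ⟨fresh_swap_smul h1 (fun hwb => (ih.resolve_left (this hwb)).1) hwc,
      fresh_swap_smul h2 (fun hwb => (ih.resolve_left (this hwb)).2) hwc⟩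

theorem fresh_of_tau {Ψ : A} {P P' : PreAgent T C A} (h : Trans psi Ψ P .tau P') {w : Name}
    (hw : Fresh w P) : Fresh w P' := by
  simpa [Action.bn, Action.ObjFresh] using h.fresh hw

/-- A permutation that fixes the names of `P` and of the action also fixes those of `P'`, because
transitions create no names. Hence the environment alone can be renamed. -/
theorem of_smul {Ψ : A} {P P' : PreAgent T C A} {α : Action T T} (π : NPerm)
    (h : Trans psi (π⁻¹ • Ψ) P α P') (hP : ∀ e, Occurs e P → π e = e)
    (hα : ∀ e ∈ α.supp, π e = e) : Trans psi Ψ P α P' := by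
  have := h.smul π
  rwa [smul_inv_smul, smul_eq_of_fix hP, Action.smul_eq_of_fix hα, smul_eq_of_fix] at this
  intro e he
  by_cases heP : Occurs e P
  · exact hP e heP
  · refine hα e ?_
    by_contra hn
    exact (h.fresh (not_occurs.1 heP)).elim (Action.fresh_iff.2 hn).notMem_bn fun h => he h.2

/-- Bound names of a transition can be chosen fresh. -/
theorem exists_perm_fresh {l : List Name} (hl : l.Nodup) (F : Finset Name) :
    ∃ π : NPerm, (∀ a ∈ l, π a ∉ F) ∧ ∀ a ∈ F, a ∉ l → π a = a := by
  obtain ⟨l', hl', hlen, hF⟩ := exists_fresh_list l.length F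
  obtain ⟨π, h1, h2⟩ := exists_perm_map_eq_fix hl hl' hlen.symm F fun a ha _ h => hF a h ha
  exact ⟨π, fun a ha => hF _ (h1 ▸ List.mem_map_of_mem ha), h2⟩

theorem fresh_inv_smul {X : Type u} [NominalSet X] {x : X} {π : NPerm} {a : Name}
    (h : π a ∉ nsupp x) : Fresh a (π⁻¹ • x) := by
  rw [fresh_smul_iff', inv_inv]
  exact fresh_of_notMem h

/-- Transitions depend on the environment only up to equivalence. -/
theorem congr {Ψ : A} {P P' : PreAgent T C A} {α : Action T T} (h : Trans psi Ψ P α P') {Ψ₁ : A}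
    (hΨ : cls psi Ψ₁ = cls psi Ψ) : Trans psi Ψ₁ P α P' := by
  classical
  have back : ∀ {Ψ Ψ₁ : A} {π : NPerm}, cls psi Ψ₁ = cls psi Ψ → (∀ e, Occurs e Ψ → π e = e) →
      cls psi (π⁻¹ • Ψ₁) = cls psi Ψ := by
    intro Ψ Ψ₁ π h hπ
    rw [cls_smul π⁻¹ h, inv_smul_eq_iff.2 (smul_eq_of_fix hπ).symm]
  -- The frame names need not be fresh for `Ψ₁`. A permutation `π` that moves them away from
  -- everything fixes `Ψ`, so `π⁻¹ • Ψ₁` is still equivalent to `Ψ` and now satisfies the side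
  -- conditions; `of_smul` then leads back to `Ψ₁`.
  have com : ∀ {Ψ Ψ₁ ΨP ΨQ : A} {P Q R : PreAgent T C A} {bP bQ : List Name},
      IsFrame psi P bP ΨP → IsFrame psi Q bQ ΨQ → List.Disjoint bP bQ →
      FreshAll bP Ψ → FreshAll bP Q → FreshAll bP P →
      FreshAll bQ Ψ → FreshAll bQ P → FreshAll bQ Q → cls psi Ψ₁ = cls psi Ψ →
      (∀ Ψ₂, cls psi Ψ₂ = cls psi Ψ → FreshAll bP Ψ₂ → FreshAll bQ Ψ₂ →
        Trans psi Ψ₂ (.par P Q) .tau R) → Trans psi Ψ₁ (.par P Q) .tau R := by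
    intro Ψ Ψ₁ ΨP ΨQ P Q R bP bQ hP hQ hd h1 h2 h3 h4 h5 h6 hc h
    obtain ⟨π, hπ, hf⟩ := exists_perm_fresh (List.nodup_append'.2 ⟨hP.nodup, hQ.nodup, hd⟩)
      (nsupp Ψ ∪ nsupp Ψ₁ ∪ nsupp P ∪ nsupp Q)
    simp only [List.mem_append, not_or, Finset.mem_union, mem_nsupp] at hπ hf
    refine of_smul π (h _ (back hc fun e he => hf e (Or.inl (Or.inl (Or.inl he)))
      ⟨fun h => he (h1 e h), fun h => he (h4 e h)⟩)
      (fun a ha => fresh_inv_smul (by simpa using (hπ a (Or.inl ha)).1.1.2))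
      (fun a ha => fresh_inv_smul (by simpa using (hπ a (Or.inr ha)).1.1.2))) (fun e he => ?_)
      (by simp [Action.supp])
    rcases PreAgent.occurs_par.1 he with he | he
    · exact hf e (Or.inl (Or.inr he)) ⟨fun h => he (h3 e h), fun h => he (h5 e h)⟩
    · exact hf e (Or.inr he) ⟨fun h => he (h2 e h), fun h => he (h6 e h)⟩
  -- Par does not require the frame names of `Q` to be fresh for `Q`, so `π` may change `Q` and the
  -- rule cannot be transported as in the communication case. A new frame of `Q` is taken instead,
  -- and only the premise on `P` is renamed.
  have par : ∀ {Ψ Ψ₁ ΨQ : A} {P Q P' : PreAgent T C A} {α : Action T T} {bQ : List Name},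
      IsFrame psi Q bQ ΨQ → FreshAll bQ Ψ → FreshAll bQ P → (∀ b ∈ bQ, α.Fresh b) →
      cls psi Ψ₁ = cls psi Ψ →
      (∀ Ψ₂, cls psi Ψ₂ = cls psi (psi.comp ΨQ Ψ) → Trans psi Ψ₂ P α P') →
      ∃ b Φ, IsFrame psi Q b Φ ∧ FreshAll b Ψ₁ ∧ FreshAll b P ∧ (∀ a ∈ b, α.Fresh a) ∧
        Trans psi (psi.comp Φ Ψ₁) P α P' := by
    intro Ψ Ψ₁ ΨQ P Q P' α bQ hQ h1 h2 h3 hc h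
    obtain ⟨b, Φ, hb, hB⟩ := exists_isFrame psi Q (nsupp Ψ₁ ∪ nsupp P ∪ α.supp ∪ nsupp Ψ)
    obtain ⟨π, h4, h5, h6⟩ := hQ.exists_perm hb (nsupp Ψ ∪ nsupp P ∪ α.supp)
    simp only [Finset.mem_union, not_or, mem_nsupp, not_occurs, ← Action.fresh_iff] at hB h6
    refine ⟨b, Φ, hb, fun a ha => (hB a ha).1.1.1, fun a ha => (hB a ha).1.1.2,
      fun a ha => (hB a ha).1.2, of_smul π (h _ ?_) (fun e he => ?_) fun e he => ?_⟩
    · rw [psi.smul_comp, ← h5, inv_smul_smul, cls_comp, cls_comp, back hc]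
      exact fun e he => h6 e (Or.inl (Or.inl he)) (fun h => he (h1 e h)) fun h => he (hB e h).2
    · exact h6 e (Or.inl (Or.inr he)) (fun h => he (h2 e h)) fun h => he (hB e h).1.1.2
    · exact h6 e (Or.inr he) (fun h => Action.fresh_iff.1 (h3 e h) he)
        fun h => Action.fresh_iff.1 (hB e h).1.2 he
  induction h generalizing Ψ₁ with
  | inp h => exact .inp (entails_of_cls hΨ.symm h)
  | out h => exact .out (entails_of_cls hΨ.symm h)
  | case _ h ih => exact .case (ih hΨ) (entails_of_cls hΨ.symm h)
  | com_left h1 h2 h3 h4 h5 h6 h7 h8 h9 h10 h11 _ _ h12 h13 ih1 ih2 =>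
    refine com h1 h2 h3 h4 h5 h7 h8 h9 h11 hΨ fun Ψ₂ hc hP hQ => ?_
    exact .com_left h1 h2 h3 hP h5 h6 h7 hQ h9 h10 h11 (ih1 (by simp [hc])) (ih2 (by simp [hc]))
      (entails_of_cls (by simp [hc]) h12) h13
  | com_right h1 h2 h3 h4 h5 h6 h7 h8 h9 h10 h11 _ _ h12 h13 ih1 ih2 =>
    refine com h1 h2 h3 h4 h5 h7 h8 h9 h11 hΨ fun Ψ₂ hc hP hQ => ?_
    exact .com_right h1 h2 h3 hP h5 h6 h7 hQ h9 h10 h11 (ih1 (by simp [hc])) (ih2 (by simp [hc]))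
      (entails_of_cls (by simp [hc]) h12) h13
  | par_left h1 h2 h3 h4 _ h5 ih =>
    obtain ⟨b, Φ, g1, g2, g3, g4, g5⟩ := par h1 h2 h3 h4 hΨ fun _ => ih
    exact .par_left g1 g2 g3 g4 g5 h5
  | par_right h1 h2 h3 h4 _ h5 ih =>
    obtain ⟨b, Φ, g1, g2, g3, g4, g5⟩ := par h1 h2 h3 h4 hΨ fun _ => ih
    exact .par_right g1 g2 g3 g4 g5 h5
  | @scope Ψ P α P' b _ h1 h2 ih =>
    obtain ⟨π, hπ, hf⟩ := exists_perm_fresh (List.nodup_singleton b)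
      (nsupp Ψ ∪ nsupp Ψ₁ ∪ nsupp P ∪ α.supp)
    simp only [List.mem_singleton, forall_eq, not_or, Finset.mem_union] at hπ hf
    refine of_smul π (.scope (ih (back hΨ fun e he => hf e (by simp [he]) fun h => he (h ▸ h2)))
      h1 (fresh_inv_smul hπ.1.1.2)) (fun e he => ?_) fun e he => ?_
    · rw [PreAgent.occurs_res] at he
      exact hf e (by simp [he.2]) he.1
    · exact hf e (by simp [he]) fun h => Action.fresh_iff.1 h1 (h ▸ he)
  | @openRes Ψ P M N P' b a₁ a₂ hT h1 h2 h3 h4 ih =>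
    -- Here `b` belongs to the action, so `of_smul` does not apply. The whole transition is renamed
    -- by swapping `b` with a fresh `c`, and the bound name of the action is then converted back
    -- from `c` to `b`.
    obtain ⟨c, hc⟩ := Infinite.exists_notMem_finset
      (nsupp Ψ ∪ nsupp Ψ₁ ∪ nsupp P ∪ nsupp M ∪ nsupp N ∪ nsupp P' ∪ (b :: (a₁ ++ a₂)).toFinset)
    simp only [Finset.mem_union, not_or, mem_nsupp, not_occurs, List.mem_toFinset,
      List.mem_cons] at hc
    obtain ⟨⟨⟨⟨⟨⟨c1, c2⟩, c3⟩, c4⟩, c5⟩, c6⟩, c7, c8⟩ := hc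
    have hfix : ∀ {X : Type u} [NominalSet X] {x : X}, Fresh b x → Fresh c x →
        ∀ e, Occurs e x → Equiv.swap b c e = e := fun hb hc e he =>
      Equiv.swap_apply_of_ne_of_ne (fun h => he (h ▸ hb)) fun h => he (h ▸ hc)
    have h5 := (Trans.openRes (ih (Ψ₁ := (Equiv.swap b c)⁻¹ • Ψ₁) (back hΨ (hfix h2 c1))) h1
      (fresh_inv_smul (by simpa [not_occurs] using c2)) h3 h4).smul (Equiv.swap b c)
    rw [smul_inv_smul, smul_eq_of_fix (hfix (by simp) (by simp [c3])), Action.smul_out,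
      smul_eq_of_fix (hfix h3 c4)] at h5
    have hca : c ∉ a₁ ++ b :: a₂ := by
      simp only [List.mem_append, not_or, List.mem_cons] at c8 ⊢
      exact ⟨c8.1, c7, c8.2⟩
    have h6 := h5.out_conv (b := c) (c := b) (List.mem_map.2 ⟨b, by simp, by simp⟩)
      (fun h => by
        obtain ⟨e, he, h⟩ := List.mem_map.1 h
        rw [Equiv.swap_apply_eq_iff, Equiv.swap_apply_left] at h
        exact hca (h ▸ he))
      (by rw [fresh_smul_iff', Equiv.swap_inv, Equiv.swap_apply_left]; exact c5)
      (by rw [fresh_smul_iff', Equiv.swap_inv, Equiv.swap_apply_left]; exact c6)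
    rw [Equiv.swap_comm c b, List.map_map, ← Equiv.Perm.coe_mul, ← mul_smul, ← mul_smul,
      Equiv.swap_mul_self, one_smul, one_smul, Equiv.Perm.coe_one, List.map_id] at h6
    exact h6
  | rep _ ih => exact .rep (ih hΨ)
  | inp_conv _ h ih => exact .inp_conv (ih hΨ) h
  | out_conv _ h1 h2 h3 h4 ih => exact .out_conv (ih hΨ) h1 h2 h3 h4

end Trans

end ConcreteTransitions

end Psi

/-! ### Symbolic transitions: renaming, solutions of their constraints, freshness of subjects -/

namespace Psi

open NamedTerms (var)
open HasSubst (subst)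

section Renaming

variable {C A : Type u} [MulAction NPerm C] [MulAction NPerm A]

/-- Renaming an atomic constraint, including its bound names. -/
def AtomicConstraint.perm (π : NPerm) (E : AtomicConstraint C A) : AtomicConstraint C A :=
  ⟨E.names.map π, π • E.assertion, π • E.cond⟩

/-- Renaming a transition constraint, including its bound names. -/
def TransConstraint.perm (π : NPerm) (D : TransConstraint C A) : TransConstraint C A :=
  D.map (AtomicConstraint.perm π)

theorem TransConstraint.perm_nu (π : NPerm) (b : List Name) (D : TransConstraint C A) :
    (D.nu b).perm π = (D.perm π).nu (b.map π) := by
  simp [nu, perm, AtomicConstraint.perm]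

end Renaming

section SymbolicTransitions

variable {T C A : Type u} [TermType T] [DataType T C] [DataType T A]

theorem Substn.exists_conj (π : NPerm) (σ : Substn T) :
    ∃ τ : Substn T, ∀ a, σ (π a) = π • τ a := by
  refine ⟨⟨fun a => π⁻¹ • σ (π a), ?_⟩, fun a => (smul_inv_smul _ _).symm⟩
  refine (σ.finite_dom.preimage π.injective.injOn).subset fun a ha h => ha ?_
  rw [h, NamedTerms.smul_var]; simp

variable {psi : PsiCalculus T C A}

/-- Bound names of a solved atomic constraint avoid `σ` and `Ψ`, so they can be renamed by any
permutation that fixes these two, without losing the solution. -/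
theorem AtomicConstraint.Sat.perm {E : AtomicConstraint C A} {σ : Substn T} {Ψ : A} {π : NPerm}
    (h : E.Sat psi σ Ψ) (hσ : ∀ a ∈ σ.supp, π a = a) (hΨ : ∀ a, Occurs a Ψ → π a = a) :
    (E.perm π).Sat psi σ Ψ := by
  obtain ⟨h1, h2, h3⟩ := h
  have e := smul_eq_of_fix hΨ
  refine ⟨?_, ?_, ?_⟩
  · intro a ha
    obtain ⟨b, hb, rfl⟩ := List.mem_map.1 ha
    refine Substn.fresh_iff.2 fun h => Substn.fresh_iff.1 (h1 b hb) ?_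
    rwa [π.injective (hσ _ h)] at h
  · rw [← e]; exact freshAll_smul π h2
  · have := psi.smul_entails π _ _ h3
    rwa [psi.smul_comp, e, smul_subst_eq fun a _ => Substn.smul_apply_of_fix hσ a,
      smul_subst_eq fun a _ => Substn.smul_apply_of_fix hσ a] at this

theorem sat_nu {b : List Name} {D : TransConstraint C A} {σ : Substn T} {Ψ : A}
    (hσ : ∀ a ∈ b, σ.Fresh a) (hΨ : FreshAll b Ψ) (h : ∀ E ∈ D, E.Sat psi σ Ψ) :
    ∀ E ∈ TransConstraint.nu b D, E.Sat psi σ Ψ := by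
  intro E hE
  obtain ⟨F, hF, rfl⟩ := List.mem_map.1 hE
  obtain ⟨h1, h2, h3⟩ := h F hF
  refine ⟨fun a ha => ?_, fun a ha => ?_, h3⟩
  · exact (List.mem_append.1 ha).elim (hσ a) (h1 a)
  · exact (List.mem_append.1 ha).elim (hΨ a) (h2 a)

/-- Since restriction distributes over conjunction, an empty conjunction would forget `b`; this is
the reason for `hD`, which `SymTrans.ne_nil` provides. -/
theorem sat_of_sat_nu {b : List Name} {D : TransConstraint C A} {σ : Substn T} {Ψ : A}
    (hD : D ≠ []) (h : ∀ E ∈ TransConstraint.nu b D, E.Sat psi σ Ψ) :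
    (∀ a ∈ b, σ.Fresh a) ∧ FreshAll b Ψ ∧ ∀ E ∈ D, E.Sat psi σ Ψ := by
  obtain ⟨F, hF⟩ := List.exists_mem_of_ne_nil D hD
  have key : ∀ F ∈ D, (⟨b ++ F.names, F.assertion, F.cond⟩ : AtomicConstraint C A).Sat psi σ Ψ :=
    fun F hF => h _ (List.mem_map_of_mem hF)
  refine ⟨fun a ha => (key F hF).1 a (by simp [ha]), fun a ha => (key F hF).2.1 a (by simp [ha]),
    fun F hF => ⟨fun a ha => (key F hF).1 a (by simp [ha]),
      fun a ha => (key F hF).2.1 a (by simp [ha]), (key F hF).2.2⟩⟩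

theorem Substn.Fresh.of_update {σ : Substn T} {a y : Name} {L : T} (hσ : σ.Fresh y) (hay : a ≠ y)
    (h : (σ.update y L).Fresh a) : σ.Fresh a := by
  refine ⟨by simpa [Substn.update_of_ne _ _ hay] using h.1, fun b hb => ?_⟩
  by_cases hby : b = y
  · subst hby
    rw [hσ.1]; exact fresh_var hay
  · simpa [Substn.update_of_ne _ _ hby] using h.2 b hb

/-- Satisfaction does not depend on names that do not occur in the constraint. -/
theorem AtomicConstraint.Sat.of_update {E : AtomicConstraint C A} {σ : Substn T} {Ψ : A}
    {y : Name} {L : T} (hσ : σ.Fresh y) (h : E.Sat psi (σ.update y L) Ψ)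
    (hE : y ∉ E.names ∧ Fresh y E.assertion ∧ Fresh y E.cond) : E.Sat psi σ Ψ := by
  obtain ⟨h1, h2, h3⟩ := h
  rw [subst_update_of_fresh hE.2.1, subst_update_of_fresh hE.2.2] at h3
  exact ⟨fun a ha => Substn.Fresh.of_update hσ (fun e => hE.1 (e ▸ ha)) (h1 a ha), h2, h3⟩

theorem AtomicConstraint.Sat.update {E : AtomicConstraint C A} {σ : Substn T} {Ψ : A}
    {y : Name} {L : T} (h : E.Sat psi σ Ψ) (hL : ∀ a ∈ E.names, Fresh a L)
    (hE : y ∉ E.names ∧ Fresh y E.assertion ∧ Fresh y E.cond) :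
    E.Sat psi (σ.update y L) Ψ := by
  obtain ⟨h1, h2, h3⟩ := h
  refine ⟨fun a ha => (h1 a ha).update (fun e => hE.1 (e ▸ ha)) (hL a ha), h2, ?_⟩
  rwa [subst_update_of_fresh hE.2.1, subst_update_of_fresh hE.2.2]

/-- Stable equivalence ranges over all substitutions, in particular over the conjugate of a given
one by `π`. -/
theorem StablyEquivalent.smul {Ψ Ψ' : A} (π : NPerm) (h : StablyEquivalent psi Ψ Ψ') :
    StablyEquivalent psi (π • Ψ) (π • Ψ') := by
  rw [stablyEquivalent_iff] at *
  intro σ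
  obtain ⟨τ, hτ⟩ := Substn.exists_conj π σ
  rw [← smul_subst_eq fun a _ => hτ a, ← smul_subst_eq fun a _ => hτ a]
  exact cls_smul π (h τ)

theorem ComCondition.smul {Ψ : A} {P Q : PreAgent T C A} {bP bQ : List Name} {ΨP ΨQ : A}
    {y z : Name} {cP cQ : List Name} {ΨP' ΨQ' : A} {MP MQ : T} (π : NPerm)
    (h : ComCondition psi Ψ P Q bP bQ ΨP ΨQ y z cP cQ ΨP' ΨQ' MP MQ) :
    ComCondition psi (π • Ψ) (π • P) (π • Q) (bP.map π) (bQ.map π) (π • ΨP) (π • ΨQ) (π y) (π z)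
      (cP.map π) (cQ.map π) (π • ΨP') (π • ΨQ') (π • MP) (π • MQ) where
  frame_left := h.frame_left.smul π
  frame_right := h.frame_right.smul π
  left_sub := List.map_subset _ h.left_sub
  right_sub := List.map_subset _ h.right_sub
  disjoint := disjoint_map π h.disjoint
  fresh_left := freshAll_smul π h.fresh_left
  fresh_right := freshAll_smul π h.fresh_right
  left_fresh := ⟨freshAll_smul π h.left_fresh.1, freshAll_smul π h.left_fresh.2.1,
    freshAll_smul π h.left_fresh.2.2⟩
  right_fresh := ⟨freshAll_smul π h.right_fresh.1, freshAll_smul π h.right_fresh.2.1,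
    freshAll_smul π h.right_fresh.2.2⟩
  ne := by simpa using h.ne
  subj_fresh w hw := by
    obtain ⟨v, hv, rfl⟩ : ∃ v ∈ [y, z], π v = w := by
      simpa [eq_comm] using hw
    obtain ⟨h1, h2, h3, h4, h5, h6, h7⟩ := h.subj_fresh v hv
    exact ⟨fresh_smul π h1, fresh_smul π h2, fresh_smul π h3, by simpa using h4,
      by simpa using h5, fresh_smul π h6, fresh_smul π h7⟩
  env_left := by simpa only [psi.smul_comp] using h.env_left.smul π
  env_right := by simpa only [psi.smul_comp] using h.env_right.smul π

/-- The bound names of an output. -/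
def Action.outBn {S : Type v} : Action S T → List Name
  | out _ a _ => a
  | _ => []

namespace SymTrans

theorem perm_cons_chan (π : NPerm) (c : List Name) (Ψ : A) (M : T) (y : Name)
    (D : TransConstraint C A) :
    TransConstraint.perm π (⟨c, Ψ, psi.chan M (var y)⟩ :: D) =
      ⟨c.map π, π • Ψ, psi.chan (π • M) (var (π y))⟩ :: D.perm π := by
  simp [TransConstraint.perm, AtomicConstraint.perm, psi.smul_chan, NamedTerms.smul_var]

protected theorem smul {Ψ : A} {P P' : PreAgent T C A} {α : Action Name T}
    {D : TransConstraint C A} (π : NPerm) (h : SymTrans psi Ψ P α D P') :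
    SymTrans psi (π • Ψ) (π • P) (π • α) (D.perm π) (π • P') := by
  induction h with
  | inp h1 h2 h3 h4 =>
    rw [PreAgent.smul_input, perm_cons_chan]
    exact .inp (fresh_smul π h1) (fresh_smul π h2) (fresh_smul π h3) (π.injective.ne h4)
  | out h1 h2 h3 h4 =>
    rw [PreAgent.smul_output, perm_cons_chan, Action.smul_out, List.map_nil]
    exact .out (fresh_smul π h1) (fresh_smul π h2) (fresh_smul π h3) (fresh_smul π h4)
  | case _ ih =>
    rw [PreAgent.smul_case]
    simp only [TransConstraint.perm, List.map_append] at ih ⊢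
    exact .case (φ := fun i => π • _) ih
  | com_left h0 _ _ h1 h2 h3 h4 h5 ih1 ih2 =>
    rw [psi.smul_comp, perm_cons_chan] at ih1 ih2
    rw [PreAgent.smul_par, PreAgent.smul_resList, PreAgent.smul_par, PreAgent.smul_subst_single]
    have := SymTrans.com_left (h0.smul π) ih1 ih2 (freshAll_smul π h1)
      (by rw [List.mem_map_of_injective π.injective]; exact h2)
      (by rw [List.mem_map_of_injective π.injective]; exact h3) (fresh_smul π h4) (fresh_smul π h5)
    simpa [TransConstraint.perm, AtomicConstraint.perm, psi.smul_chan, psi.smul_comp] using this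
  | com_right h0 _ _ h1 h2 h3 h4 h5 ih1 ih2 =>
    rw [psi.smul_comp, perm_cons_chan] at ih1 ih2
    rw [PreAgent.smul_par, PreAgent.smul_resList, PreAgent.smul_par, PreAgent.smul_subst_single]
    have := SymTrans.com_right (h0.smul π) ih1 ih2 (freshAll_smul π h1)
      (by rw [List.mem_map_of_injective π.injective]; exact h2)
      (by rw [List.mem_map_of_injective π.injective]; exact h3) (fresh_smul π h4) (fresh_smul π h5)
    simpa [TransConstraint.perm, AtomicConstraint.perm, psi.smul_chan, psi.smul_comp] using this
  | par_left h1 h2 h3 h4 _ h5 h6 ih =>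
    rw [psi.smul_comp] at ih
    rw [PreAgent.smul_par, PreAgent.smul_par, TransConstraint.perm_nu]
    exact .par_left (h1.smul π) (freshAll_smul π h2) (freshAll_smul π h3)
      (by simpa using fun b hb => Action.fresh_smul (h4 b hb)) ih
      (by rw [Action.bn_smul]; exact freshAll_smul π h5)
      (by
        rw [Action.subj_smul]
        intro y hy
        obtain ⟨w, hw, rfl⟩ := Option.mem_map.1 hy
        exact fresh_smul π (h6 w hw))
  | par_right h1 h2 h3 h4 _ h5 h6 ih =>
    rw [psi.smul_comp] at ih
    rw [PreAgent.smul_par, PreAgent.smul_par, TransConstraint.perm_nu]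
    exact .par_right (h1.smul π) (freshAll_smul π h2) (freshAll_smul π h3)
      (by simpa using fun b hb => Action.fresh_smul (h4 b hb)) ih
      (by rw [Action.bn_smul]; exact freshAll_smul π h5)
      (by
        rw [Action.subj_smul]
        intro y hy
        obtain ⟨w, hw, rfl⟩ := Option.mem_map.1 hy
        exact fresh_smul π (h6 w hw))
  | scope _ h1 h2 ih =>
    rw [PreAgent.smul_res, PreAgent.smul_res, TransConstraint.perm_nu]
    exact .scope ih (Action.fresh_smul h1) (fresh_smul π h2)
  | openRes _ h1 h2 h3 h4 ih =>
    rw [PreAgent.smul_res, Action.smul_out, List.map_append, List.map_cons,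
      TransConstraint.perm_nu]
    rw [Action.smul_out, List.map_append] at ih
    refine .openRes ih ((occurs_smul_iff π _ _).2 h1) ?_ (fresh_smul π h3) (by simpa using h4)
    rw [← List.map_append]
    simpa using h2
  | rep _ ih =>
    rw [PreAgent.smul_par, PreAgent.smul_rep] at ih
    rw [PreAgent.smul_rep]
    exact .rep ih

/-- Symbolic transitions do not create free names. -/
theorem fresh {Ψ : A} {P P' : PreAgent T C A} {α : Action Name T} {D : TransConstraint C A}
    (h : SymTrans psi Ψ P α D P') {w : Name} (hw : Fresh w P) :
    w ∈ α.bn ∨ (α.ObjFresh w ∧ Fresh w P') := by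
  induction h with
  | inp => simp_all [Action.bn, Action.ObjFresh]
  | out => simp_all [Action.bn, Action.ObjFresh]
  | case _ ih => exact ih ((PreAgent.fresh_case.1 hw _).2)
  | com_left _ _ _ _ _ _ _ _ ih1 ih2 =>
    rw [PreAgent.fresh_par] at hw
    have := fresh_com (ih1 hw.1) (by simpa [Action.bn, Action.ObjFresh] using ih2 hw.2)
    simpa [Action.bn, Action.ObjFresh] using this
  | com_right _ _ _ _ _ _ _ _ ih1 ih2 =>
    rw [PreAgent.fresh_par] at hw
    have := fresh_com (ih2 hw.2) (by simpa [Action.bn, Action.ObjFresh] using ih1 hw.1)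
    simpa [Action.bn, Action.ObjFresh, and_comm] using this
  | par_left _ _ _ _ _ _ _ ih =>
    rw [PreAgent.fresh_par] at hw ⊢
    exact (ih hw.1).imp_right fun h => ⟨h.1, h.2, hw.2⟩
  | par_right _ _ _ _ _ _ _ ih =>
    rw [PreAgent.fresh_par] at hw ⊢
    exact (ih hw.2).imp_right fun h => ⟨h.1, hw.1, h.2⟩
  | @scope _ _ α _ _ b _ h _ ih =>
    rw [PreAgent.fresh_res] at hw ⊢
    rcases hw with rfl | hw
    · refine Or.inr ⟨?_, Or.inl rfl⟩
      cases α with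
      | out M a N => exact h.2.2
      | _ => trivial
    · exact (ih hw).imp_right fun h => ⟨h.1, Or.inr h.2⟩
  | openRes _ _ _ _ _ ih =>
    rw [PreAgent.fresh_res] at hw
    rcases hw with rfl | hw
    · simp [Action.bn]
    · refine (ih hw).imp_left fun h => ?_
      simp only [Action.bn, List.mem_append, List.mem_cons] at h ⊢
      tauto
  | rep _ ih => exact ih (by simpa using hw)

theorem wellFormed {Ψ : A} {P P' : PreAgent T C A} {α : Action Name T} {D : TransConstraint C A}
    (h : SymTrans psi Ψ P α D P') (hP : P.WellFormed psi) : P'.WellFormed psi := by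
  induction h with
  | inp => simpa using hP
  | out => simpa using hP
  | @case _ _ _ _ i _ _ _ _ ih => exact ih (wellFormed_case.1 hP i).1
  | com_left _ _ _ _ _ _ _ _ ih1 ih2 =>
    rw [wellFormed_par] at hP
    rw [wellFormed_resList, wellFormed_par]
    exact ⟨ih1 hP.1, (ih2 hP.2).subst _⟩
  | com_right _ _ _ _ _ _ _ _ ih1 ih2 =>
    rw [wellFormed_par] at hP
    rw [wellFormed_resList, wellFormed_par]
    exact ⟨(ih1 hP.1).subst _, ih2 hP.2⟩
  | par_left _ _ _ _ _ _ _ ih =>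
    rw [wellFormed_par] at hP ⊢
    exact ⟨ih hP.1, hP.2⟩
  | par_right _ _ _ _ _ _ _ ih =>
    rw [wellFormed_par] at hP ⊢
    exact ⟨hP.1, ih hP.2⟩
  | scope _ _ _ ih =>
    rw [wellFormed_res] at hP ⊢
    exact ih hP
  | openRes _ _ _ _ _ ih => exact ih (wellFormed_res.1 hP)
  | rep _ ih => exact ih (wellFormed_par.2 ⟨(wellFormed_rep.1 hP).1, hP⟩)

theorem ne_nil {Ψ : A} {P P' : PreAgent T C A} {α : Action Name T} {D : TransConstraint C A}
    (h : SymTrans psi Ψ P α D P') : D ≠ [] := by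
  induction h <;> simp_all [TransConstraint.nu]

theorem subj_notMem_bn {Ψ : A} {P P' : PreAgent T C A} {α : Action Name T}
    {D : TransConstraint C A} (h : SymTrans psi Ψ P α D P') : ∀ y ∈ α.subj, y ∉ α.bn := by
  induction h with
  | openRes _ _ _ _ h ih => simp_all [Action.subj, Action.bn, Ne.symm h]
  | _ => simp_all [Action.subj, Action.bn]

/-- The bound names of an output are among the names of some atomic constraint. -/
theorem exists_outBn_subset {Ψ : A} {P P' : PreAgent T C A} {α : Action Name T}
    {D : TransConstraint C A} (h : SymTrans psi Ψ P α D P') :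
    ∃ E ∈ D, ∀ b ∈ α.outBn, b ∈ E.names := by
  have nu : ∀ {D : TransConstraint C A} {l b : List Name},
      (∃ E ∈ D, ∀ b ∈ l, b ∈ E.names) → ∃ E ∈ D.nu b, ∀ c ∈ l, c ∈ E.names :=
    fun ⟨E, hE, h⟩ => ⟨_, List.mem_map_of_mem hE, fun c hc => List.mem_append_right _ (h c hc)⟩
  induction h with
  | inp => simp [Action.outBn]
  | out => simp [Action.outBn]
  | com_left => simp [Action.outBn]
  | com_right => simp [Action.outBn]
  | case h ih =>
    obtain ⟨E, hE, h⟩ := ih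
    exact ⟨E, List.mem_append_left _ hE, h⟩
  | par_left _ _ _ _ _ _ _ ih => exact nu ih
  | par_right _ _ _ _ _ _ _ ih => exact nu ih
  | scope _ _ _ ih => exact nu ih
  | openRes _ _ _ _ _ ih =>
    obtain ⟨E, hE, h⟩ := ih
    refine ⟨_, List.mem_map_of_mem hE, fun b hb => ?_⟩
    simp only [Action.outBn, List.mem_append, List.mem_cons] at hb h ⊢
    have := h b
    simp only [List.not_mem_nil, or_false]
    tauto
  | rep _ ih => exact ih

/-- The subject occurs in the first atomic constraint only, which has the most bound names. -/
theorem exists_cons {Ψ : A} {P P' : PreAgent T C A} {α : Action Name T}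
    {D : TransConstraint C A} (h : SymTrans psi Ψ P α D P') {y : Name} (hy : y ∈ α.subj)
    (hΨ : Fresh y Ψ) (hP : Fresh y P) : ∃ E D', D = E :: D' ∧ y ∉ E.names ∧
      ∀ F ∈ D', F.names ⊆ E.names ∧ Fresh y F.assertion ∧ Fresh y F.cond := by
  have nu : ∀ {D : TransConstraint C A} {b : List Name}, y ∉ b →
      (∃ E D', D = E :: D' ∧ y ∉ E.names ∧
        ∀ F ∈ D', F.names ⊆ E.names ∧ Fresh y F.assertion ∧ Fresh y F.cond) →
      ∃ E D', D.nu b = E :: D' ∧ y ∉ E.names ∧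
        ∀ F ∈ D', F.names ⊆ E.names ∧ Fresh y F.assertion ∧ Fresh y F.cond := by
    rintro _ b hb ⟨E, D', rfl, h, h'⟩
    refine ⟨_, TransConstraint.nu b D', rfl, by simp [hb, h], fun F hF => ?_⟩
    obtain ⟨G, hG, rfl⟩ := List.mem_map.1 hF
    exact ⟨List.append_subset.2 ⟨List.subset_append_left _ _, List.subset_append_of_subset_right _ (h' G hG).1⟩, (h' G hG).2⟩
  have ne : ∀ {α : Action Name T} {a : Name}, y ∈ α.subj → α.Fresh a → y ≠ a := by
    rintro (_ | _ | _) a hy h rfl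
    · simp [Action.subj] at hy
    · obtain rfl : _ = _ := Option.some.inj hy
      exact fresh_name.1 h.1 rfl
    · obtain rfl : _ = _ := Option.some.inj hy
      exact fresh_name.1 h.1 rfl
  induction h with
  | inp => exact ⟨_, _, rfl, by simp, by simp⟩
  | out => exact ⟨_, _, rfl, by simp, by simp⟩
  | case h ih =>
    rw [PreAgent.fresh_case] at hP
    obtain ⟨E, D', rfl, h1, h2⟩ := ih hy hΨ (hP _).2
    refine ⟨E, _, rfl, h1, fun F hF => ?_⟩
    rcases List.mem_append.1 hF with hF | hF
    · exact h2 F hF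
    · rw [List.mem_singleton.1 hF]
      exact ⟨by simp, hΨ, (hP _).1⟩
  | com_left => simp [Action.subj] at hy
  | com_right => simp [Action.subj] at hy
  | par_left h1 _ _ h4 _ _ h6 ih =>
    have hb := fun h => ne hy (h4 y h) rfl
    rw [PreAgent.fresh_par] at hP
    exact nu hb (ih hy (fresh_comp hΨ (h1.fresh hP.2 hb)) hP.1)
  | par_right h1 _ _ h4 _ _ h6 ih =>
    have hb := fun h => ne hy (h4 y h) rfl
    rw [PreAgent.fresh_par] at hP
    exact nu hb (ih hy (fresh_comp hΨ (h1.fresh hP.1 hb)) hP.2)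
  | scope _ h1 _ ih =>
    have := ne hy h1
    rw [PreAgent.fresh_res] at hP
    exact nu (by simpa using this) (ih hy hΨ (hP.resolve_left this))
  | openRes _ _ _ _ h1 ih =>
    obtain rfl : _ = _ := Option.some.inj hy
    rw [PreAgent.fresh_res] at hP
    exact nu (by simpa using Ne.symm h1) (ih rfl hΨ (hP.resolve_left (Ne.symm h1)))
  | rep _ ih => exact ih hy hΨ (by simpa using hP)

end SymTrans

end SymbolicTransitions

end Psi

/-! ### From symbolic to concrete transitions -/

namespace Psi

open NamedTerms (var)
open HasSubst (subst)

section Soundness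

variable {T C A : Type u} [TermType T] [DataType T C] [DataType T A] {psi : PsiCalculus T C A}

/-- The concrete transitions of `P σ` that a symbolic transition of `P` stands for. -/
def Action.Realized (psi : PsiCalculus T C A) (Ψ : A) (σ : Substn T) (P P' : PreAgent T C A) :
    Action Name T → TransConstraint C A → Prop
  | tau, _ => Trans psi Ψ (P.subst σ) .tau (P'.subst σ)
  | inp y x, D => ∀ z, (∀ E ∈ D, z ∉ E.names) → Psi.Fresh z (P.subst σ) →
      Trans psi Ψ (P.subst σ) (.inp (σ y) z) (P'.subst (σ.update x (var z)))
  | out y a N, _ => Trans psi Ψ (P.subst σ) (.out (σ y) a (subst N σ)) (P'.subst σ)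

theorem fresh_subst_term {σ : Substn T} {M : T} {a : Name} (hσ : σ.Fresh a) (h : Fresh a M) :
    Fresh a (subst M σ) := by
  let _ := TermType.dataType T
  exact fresh_subst hσ h

theorem occurs_subst_term_of_fresh {σ : Substn T} {M : T} {a : Name} (hσ : σ.Fresh a) :
    Occurs a (subst M σ) ↔ Occurs a M := by
  let _ := TermType.dataType T
  exact occurs_subst_of_fresh hσ

theorem subst_term_update {σ : Substn T} {M : T} {y : Name} {L : T} (hy : Fresh y M) :
    subst M (σ.update y L) = subst M σ := by
  let _ := TermType.dataType T
  exact subst_update_of_fresh hy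

theorem subst_term_single_of_fresh {M : T} {y : Name} {L : T} (hy : Fresh y M) :
    subst M (.single y L) = M := by
  let _ := TermType.dataType T
  exact subst_var_fresh fun b hb => Substn.single_of_ne _ fun e => hb (e ▸ hy)

/-- Relates communication before and after `σ`: the symbolic rule substitutes for the input variable
`x`, the concrete one for the bound name `w` of the realized input. -/
theorem PreAgent.subst_single_subst {x w : Name} {N : T} {P : PreAgent T C A} {σ : Substn T}
    (hσ : σ.Fresh w) (hw : Fresh w P) :
    (P.subst (.single x N)).subst σ =
      (P.subst (σ.update x (var w))).subst (.single w (HasSubst.subst N σ)) := by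
  rw [PreAgent.subst_subst P (ρ := σ.update x (HasSubst.subst N σ)),
    PreAgent.subst_subst P (ρ := σ.update x (HasSubst.subst N σ))]
  · intro a ha
    by_cases h : a = x
    · subst h; simp [TermType.var_subst]
    · rw [Substn.update_of_ne _ _ h, Substn.update_of_ne _ _ h]
      have : w ≠ a := fun e => ha (e ▸ hw)
      exact (subst_term_single_of_fresh (hσ.apply this)).symm
  · intro a _
    by_cases h : a = x
    · subst h; simp
    · rw [Substn.update_of_ne _ _ h, Substn.single_of_ne _ h, TermType.var_subst]

theorem PreAgent.fresh_subst_of_input {M : T} {x z : Name} {P : PreAgent T C A} {σ : Substn T}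
    (h : Fresh z ((PreAgent.input M x P).subst σ)) :
    ∀ a, Occurs a P → a ≠ x → Fresh z (σ a) := by
  intro a ha hax
  by_contra hz
  exact PreAgent.occurs_subst (.input M x P) (a := a)
    (by simp [Occurs, hax] at ha ⊢; tauto) hz h

variable {Ψ Ψ₀ : A} {P Q : PreAgent T C A} {bP bQ cP cQ : List Name} {ΨP ΨQ ΨP' ΨQ' : A}
  {y z : Name} {MP MQ : T} {σ : Substn T}

theorem ComCondition.symm
    (h : ComCondition psi Ψ P Q bP bQ ΨP ΨQ y z cP cQ ΨP' ΨQ' MP MQ) :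
    ComCondition psi Ψ Q P bQ bP ΨQ ΨP z y cQ cP ΨQ' ΨP' MQ MP where
  frame_left := h.frame_right
  frame_right := h.frame_left
  left_sub := h.right_sub
  right_sub := h.left_sub
  disjoint := h.disjoint.symm
  fresh_left := h.fresh_right
  fresh_right := h.fresh_left
  left_fresh := h.right_fresh
  right_fresh := h.left_fresh
  ne := h.ne.symm
  subj_fresh w hw := by
    have := h.subj_fresh w (by simp_all [or_comm])
    tauto
  env_left := by
    have := h.env_right
    rw [stablyEquivalent_iff] at this ⊢
    intro τ
    rw [this τ]
    simp only [psi.comp_subst, cls_comp]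
    ac_rfl
  env_right := by
    have := h.env_left
    rw [stablyEquivalent_iff] at this ⊢
    intro τ
    rw [this τ]
    simp only [psi.comp_subst, cls_comp]
    ac_rfl

/-- A solution of the constraint of a communication yields one of the constraint of the left
premise. -/
theorem ComCondition.sat_left {DP : TransConstraint C A} {α : Action Name T} {P' : PreAgent T C A}
    (h : ComCondition psi Ψ P Q bP bQ ΨP ΨQ y z cP cQ ΨP' ΨQ' MP MQ)
    (hP : SymTrans psi (psi.comp Ψ ΨQ) P α (⟨cP, ΨP', psi.chan MP (var y)⟩ :: DP) P')
    (hy : y ∈ α.subj)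
    (hE : (⟨cP ++ cQ, psi.comp (psi.comp Ψ ΨP) ΨQ, psi.chan MP MQ⟩ :
      AtomicConstraint C A).Sat psi σ Ψ₀) (hD : ∀ E ∈ DP, E.Sat psi σ Ψ₀) :
    ∀ E ∈ (⟨cP, ΨP', psi.chan MP (var y)⟩ :: DP : TransConstraint C A),
      E.Sat psi (σ.update y (subst MQ σ)) Ψ₀ := by
  obtain ⟨h1, h2, h3⟩ := hE
  obtain ⟨yΨ, yP, yQ, ycP, ycQ, yMP, yMQ⟩ := h.subj_fresh y (by simp)
  have yΨP := h.frame_left.fresh yP fun h' => ycP (h.left_sub h')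
  have yΨQ := h.frame_right.fresh yQ fun h' => ycQ (h.right_sub h')
  have hc : ∀ a ∈ cP, Fresh a (subst MQ σ) := fun a ha =>
    fresh_subst_term (h1 a (by simp [ha])) (h.left_fresh.2.2 a ha)
  obtain ⟨E, D', e, _, htail⟩ := hP.exists_cons hy (fresh_comp yΨ yΨQ) yP
  obtain ⟨rfl, rfl⟩ := List.cons.inj e
  intro F hF
  rcases List.mem_cons.1 hF with rfl | hF
  · refine ⟨fun a ha => (h1 a (by simp [ha])).update (fun e => ycP (e ▸ ha)) (hc a ha),
      fun a ha => h2 a (by simp [ha]), ?_⟩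
    refine entails_of_cls ?_ ?_ (Ψ := psi.comp (subst (psi.comp (psi.comp Ψ ΨP) ΨQ) σ) Ψ₀)
    · rw [cls_comp, cls_comp, (stablyEquivalent_iff.1 h.env_left) _,
        subst_update_of_fresh (fresh_comp (fresh_comp yΨ yΨP) yΨQ)]
    -- The value of `y` is the instance of `MQ`, which turns the premise's subject condition into
    -- the condition of the communication.
    · rw [psi.chan_subst, subst_term_update yMP, TermType.var_subst, Substn.update_same,
        ← psi.chan_subst]
      exact h3
  · obtain ⟨t1, t2, t3⟩ := htail F hF
    exact (hD F hF).update (fun a ha => hc a (t1 ha)) ⟨fun h => ycP (t1 h), t2, t3⟩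

/-- The first atomic constraint has the largest list of names, and some atomic constraint lists all
bound names of the output. In a solution of the communication these names are therefore fresh for
the substitution and can be restricted outside it. -/
theorem ComCondition.outBn_subset {DP : TransConstraint C A} {α : Action Name T}
    {P' : PreAgent T C A}
    (h : ComCondition psi Ψ P Q bP bQ ΨP ΨQ y z cP cQ ΨP' ΨQ' MP MQ)
    (hP : SymTrans psi (psi.comp Ψ ΨQ) P α (⟨cP, ΨP', psi.chan MP (var y)⟩ :: DP) P')
    (hy : y ∈ α.subj) : ∀ a ∈ α.outBn, a ∈ cP := by
  obtain ⟨yΨ, yP, yQ, ycP, ycQ, yMP, yMQ⟩ := h.subj_fresh y (by simp)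
  have yΨQ := h.frame_right.fresh yQ fun h' => ycQ (h.right_sub h')
  obtain ⟨E, D', e, _, htail⟩ := hP.exists_cons hy (fresh_comp yΨ yΨQ) yP
  obtain ⟨rfl, rfl⟩ := List.cons.inj e
  obtain ⟨F, hF, hb⟩ := hP.exists_outBn_subset
  rcases List.mem_cons.1 hF with rfl | hF
  · exact hb
  · exact fun a ha => (htail F hF).1 (hb a ha)

theorem mem_foldr_names {D : TransConstraint C A} {E : AtomicConstraint C A} {a : Name}
    (hE : E ∈ D) (ha : a ∈ E.names) : a ∈ D.foldr (fun E S => E.names.toFinset ∪ S) ∅ := by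
  induction D with
  | nil => simp at hE
  | cons F D ih =>
    rcases List.mem_cons.1 hE with rfl | h
    · simp [ha]
    · simp [ih h]

/-- Each solution of the constraint of a symbolic transition yields a concrete transition. -/
theorem SymTrans.realized {P' : PreAgent T C A} {α : Action Name T} {D : TransConstraint C A}
    (h : SymTrans psi Ψ P α D P') (σ : Substn T) (Ψ₀ : A) (hD : ∀ E ∈ D, E.Sat psi σ Ψ₀) :
    α.Realized psi (psi.comp (subst Ψ σ) Ψ₀) σ P P' D := by
  induction h generalizing σ with
  | @inp Ψ M x P y h1 h2 h3 h4 =>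
    intro z _ hz
    rw [PreAgent.subst_input_of (PreAgent.fresh_subst_of_input hz)]
    have := (hD _ (List.mem_singleton_self _)).2.2
    rw [psi.chan_subst, TermType.var_subst] at this
    exact .inp this
  | @out Ψ M N P y h1 h2 h3 h4 =>
    have := (hD _ (List.mem_singleton_self _)).2.2
    rw [psi.chan_subst, TermType.var_subst] at this
    simp only [Action.Realized, PreAgent.subst_output]
    exact .out this
  | @case Ψ n φ P i α D P' h ih =>
    have ih := ih σ fun E hE => hD E (by simp [hE])
    have hφ := (hD ⟨[], Ψ, φ i⟩ (by simp)).2.2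
    cases α with
    | tau =>
      simp only [Action.Realized, PreAgent.subst_case]
      exact .case (P := fun i => (P i).subst σ) (φ := fun i => subst (φ i) σ) ih hφ
    | out y a N =>
      simp only [Action.Realized, PreAgent.subst_case]
      exact .case (P := fun i => (P i).subst σ) (φ := fun i => subst (φ i) σ) ih hφ
    | inp y x =>
      simp only [Action.Realized, PreAgent.subst_case]
      intro z hz hzP
      exact .case (P := fun i => (P i).subst σ) (φ := fun i => subst (φ i) σ)
        (ih z (fun E hE => hz E (by simp [hE])) (PreAgent.fresh_case.1 hzP i).2) hφ
  | @com_left Ψ P Q bP bQ ΨP ΨQ y z cP cQ ΨP' ΨQ' MP MQ DP DQ a N x P' Q' h0 hP hQ h1 h2 h3 h4 h5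
      ih1 ih2 =>
    obtain ⟨yΨ, yP, yQ, ycP, ycQ, yMP, yMQ⟩ := h0.subj_fresh y (by simp)
    obtain ⟨zΨ, zP, zQ, zcP, zcQ, zMP, zMQ⟩ := h0.subj_fresh z (by simp)
    have yΨP := h0.frame_left.fresh yP fun h' => ycP (h0.left_sub h')
    have yΨQ := h0.frame_right.fresh yQ fun h' => ycQ (h0.right_sub h')
    have zΨP := h0.frame_left.fresh zP fun h' => zcP (h0.left_sub h')
    have zΨQ := h0.frame_right.fresh zQ fun h' => zcQ (h0.right_sub h')
    obtain ⟨hσ, hΨ, hE⟩ := hD _ (List.mem_cons_self ..)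
    have hDP : ∀ E ∈ DP, E.Sat psi σ Ψ₀ := fun E h => hD E (by simp [h])
    have hDQ : ∀ E ∈ DQ, E.Sat psi σ Ψ₀ := fun E h => hD E (by simp [h])
    have hσP : ∀ a ∈ cP, σ.Fresh a := fun a ha => hσ a (by simp [ha])
    have hσQ : ∀ a ∈ cQ, σ.Fresh a := fun a ha => hσ a (by simp [ha])
    have hΨP : FreshAll cP Ψ₀ := fun a ha => hΨ a (by simp [ha])
    have hΨQ : FreshAll cQ Ψ₀ := fun a ha => hΨ a (by simp [ha])
    have hE' : (⟨cQ ++ cP, psi.comp (psi.comp Ψ ΨQ) ΨP, psi.chan MQ MP⟩ :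
        AtomicConstraint C A).Sat psi σ Ψ₀ := by
      refine ⟨fun a ha => hσ a (by simpa [or_comm] using ha),
        fun a ha => hΨ a (by simpa [or_comm] using ha), ?_⟩
      rw [psi.chan_subst] at hE ⊢
      refine entails_of_cls ?_ (psi.chan_symm _ _ _ hE)
      simp only [psi.comp_subst, cls_comp]
      ac_rfl
    -- P acts on the subject of Q and Q on the subject of P: `y` is sent to `MQ` under `σ` and `z`
    -- to `MP` under `σ`. The channel condition of the concrete rule is then `hE` up to symmetry,
    -- and freshness of the frame names for the subjects comes from `cP` # `MQ` and `cQ` # `MP`.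
    have ih1 := ih1 _ (h0.sat_left hP rfl ⟨hσ, hΨ, hE⟩ hDP)
    have ih2 := ih2 _ (h0.symm.sat_left hQ rfl hE' hDQ)
    have ha : ∀ b ∈ a, b ∈ cP := h0.outBn_subset hP rfl
    have hxz : z ≠ x := by simpa [Action.bn] using hQ.subj_notMem_bn z rfl
    obtain ⟨yN, yP'⟩ := (hP.fresh yP).resolve_left h2
    have zQ' := ((hQ.fresh zQ).resolve_left (by simpa [Action.bn] using hxz)).2
    classical
    -- The input is realized only at bound names that are fresh for the instance of Q and occur in
    -- no name list of its constraint; such a `w` is chosen here.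
    obtain ⟨w, hw, hwσ, -, hwQ'⟩ := PreAgent.exists_binder σ σ
      ((⟨cQ, ΨQ', psi.chan MQ (var z)⟩ :: DQ : TransConstraint C A).foldr
        (fun E S => E.names.toFinset ∪ S) ∅ ∪ nsupp (Q.subst σ)) Q'
    simp only [Finset.mem_union, not_or, mem_nsupp, not_occurs] at hw
    simp only [Action.Realized, Substn.update_same, PreAgent.subst_update yP, subst_term_update yN,
      PreAgent.subst_update yP', subst_update_of_fresh (fresh_comp yΨ yΨQ)] at ih1
    have ih2 := ih2 w (fun E hE hwE => hw.1 (mem_foldr_names hE hwE))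
      (by rw [PreAgent.subst_update zQ]; exact hw.2)
    rw [Substn.update_same, PreAgent.subst_update zQ, subst_update_of_fresh (fresh_comp zΨ zΨP),
      PreAgent.subst_congr (P := Q') (τ := σ.update x (var w))] at ih2
    swap
    · intro b hb
      by_cases h : b = x
      · subst h; simp
      · rw [Substn.update_of_ne _ _ h, Substn.update_of_ne _ _ h,
          Substn.update_of_ne _ _ fun e : b = z => hb (e ▸ zQ')]
    simp only [Action.Realized]
    rw [PreAgent.subst_resList_of_fresh fun b hb => hσP b (ha b hb), PreAgent.subst_par,
      PreAgent.subst_par, PreAgent.subst_single_subst hwσ hwQ']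
    refine .com_left (h0.frame_left.subst fun b hb => hσP b (h0.left_sub hb))
      (h0.frame_right.subst fun b hb => hσQ b (h0.right_sub hb))
      (fun b hb hb' => h0.disjoint (h0.left_sub hb) (h0.right_sub hb'))
      ?_ ?_ ?_ ?_ ?_ ?_ ?_ ?_ (ih1.congr ?_) (ih2.congr ?_) ?_ ?_
    · exact fun b hb => fresh_comp (fresh_subst (hσP b (h0.left_sub hb))
        (h0.left_fresh.1 b (h0.left_sub hb))) (hΨP b (h0.left_sub hb))
    · exact fun b hb => PreAgent.fresh_subst (hσP b (h0.left_sub hb))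
        (h0.left_fresh.2.1 b (h0.left_sub hb))
    · exact fun b hb => fresh_subst_term (hσP b (h0.left_sub hb))
        (h0.left_fresh.2.2 b (h0.left_sub hb))
    · exact fun b hb => PreAgent.fresh_subst (hσP b (h0.left_sub hb)) (h0.fresh_left b hb)
    · exact fun b hb => fresh_comp (fresh_subst (hσQ b (h0.right_sub hb))
        (h0.right_fresh.1 b (h0.right_sub hb))) (hΨQ b (h0.right_sub hb))
    · exact fun b hb => PreAgent.fresh_subst (hσQ b (h0.right_sub hb))
        (h0.right_fresh.2.1 b (h0.right_sub hb))
    · exact fun b hb => fresh_subst_term (hσQ b (h0.right_sub hb))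
        (h0.right_fresh.2.2 b (h0.right_sub hb))
    · exact fun b hb => PreAgent.fresh_subst (hσQ b (h0.right_sub hb)) (h0.fresh_right b hb)
    · simp only [psi.comp_subst, cls_comp]; ac_rfl
    · simp only [psi.comp_subst, cls_comp]; ac_rfl
    · rw [psi.chan_subst] at hE
      refine entails_of_cls ?_ (psi.chan_symm _ _ _ hE)
      simp only [psi.comp_subst, cls_comp]
      ac_rfl
    · exact fun b hb => PreAgent.fresh_subst (hσP b (ha b hb)) (h1 b hb)
  | @com_right Ψ P Q bP bQ ΨP ΨQ y z cP cQ ΨP' ΨQ' MP MQ DP DQ a N x P' Q' h0 hP hQ h1 h2 h3 h4 h5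
      ih1 ih2 =>
    obtain ⟨yΨ, yP, yQ, ycP, ycQ, yMP, yMQ⟩ := h0.subj_fresh y (by simp)
    obtain ⟨zΨ, zP, zQ, zcP, zcQ, zMP, zMQ⟩ := h0.subj_fresh z (by simp)
    have yΨP := h0.frame_left.fresh yP fun h' => ycP (h0.left_sub h')
    have yΨQ := h0.frame_right.fresh yQ fun h' => ycQ (h0.right_sub h')
    have zΨP := h0.frame_left.fresh zP fun h' => zcP (h0.left_sub h')
    have zΨQ := h0.frame_right.fresh zQ fun h' => zcQ (h0.right_sub h')
    obtain ⟨hσ, hΨ, hE⟩ := hD _ (List.mem_cons_self ..)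
    have hDP : ∀ E ∈ DP, E.Sat psi σ Ψ₀ := fun E h => hD E (by simp [h])
    have hDQ : ∀ E ∈ DQ, E.Sat psi σ Ψ₀ := fun E h => hD E (by simp [h])
    have hσP : ∀ a ∈ cP, σ.Fresh a := fun a ha => hσ a (by simp [ha])
    have hσQ : ∀ a ∈ cQ, σ.Fresh a := fun a ha => hσ a (by simp [ha])
    have hΨP : FreshAll cP Ψ₀ := fun a ha => hΨ a (by simp [ha])
    have hΨQ : FreshAll cQ Ψ₀ := fun a ha => hΨ a (by simp [ha])
    have hE' : (⟨cQ ++ cP, psi.comp (psi.comp Ψ ΨQ) ΨP, psi.chan MQ MP⟩ :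
        AtomicConstraint C A).Sat psi σ Ψ₀ := by
      refine ⟨fun a ha => hσ a (by simpa [or_comm] using ha),
        fun a ha => hΨ a (by simpa [or_comm] using ha), ?_⟩
      rw [psi.chan_subst] at hE ⊢
      refine entails_of_cls ?_ (psi.chan_symm _ _ _ hE)
      simp only [psi.comp_subst, cls_comp]
      ac_rfl
    have ih1 := ih1 _ (h0.sat_left hP rfl ⟨hσ, hΨ, hE⟩ hDP)
    have ih2 := ih2 _ (h0.symm.sat_left hQ rfl hE' hDQ)
    have ha : ∀ b ∈ a, b ∈ cQ := h0.symm.outBn_subset hQ rfl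
    have hxy : y ≠ x := by simpa [Action.bn] using hP.subj_notMem_bn y rfl
    obtain ⟨zN, zQ'⟩ := (hQ.fresh zQ).resolve_left h3
    have yP' := ((hP.fresh yP).resolve_left (by simpa [Action.bn] using hxy)).2
    -- As in the mirror case, a bound name is chosen at which the input, now of P, is realized.
    classical
    obtain ⟨w, hw, hwσ, -, hwP'⟩ := PreAgent.exists_binder σ σ
      ((⟨cP, ΨP', psi.chan MP (var y)⟩ :: DP : TransConstraint C A).foldr
        (fun E S => E.names.toFinset ∪ S) ∅ ∪ nsupp (P.subst σ)) P'
    simp only [Finset.mem_union, not_or, mem_nsupp, not_occurs] at hw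
    simp only [Action.Realized, Substn.update_same, PreAgent.subst_update zQ, subst_term_update zN,
      PreAgent.subst_update zQ', subst_update_of_fresh (fresh_comp zΨ zΨP)] at ih2
    have ih1 := ih1 w (fun E hE hwE => hw.1 (mem_foldr_names hE hwE))
      (by rw [PreAgent.subst_update yP]; exact hw.2)
    rw [Substn.update_same, PreAgent.subst_update yP, subst_update_of_fresh (fresh_comp yΨ yΨQ),
      PreAgent.subst_congr (P := P') (τ := σ.update x (var w))] at ih1
    swap
    · intro b hb
      by_cases h : b = x
      · subst h; simp
      · rw [Substn.update_of_ne _ _ h, Substn.update_of_ne _ _ h,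
          Substn.update_of_ne _ _ fun e : b = y => hb (e ▸ yP')]
    simp only [Action.Realized]
    rw [PreAgent.subst_resList_of_fresh fun b hb => hσQ b (ha b hb), PreAgent.subst_par,
      PreAgent.subst_par, PreAgent.subst_single_subst hwσ hwP']
    refine .com_right (h0.frame_left.subst fun b hb => hσP b (h0.left_sub hb))
      (h0.frame_right.subst fun b hb => hσQ b (h0.right_sub hb))
      (fun b hb hb' => h0.disjoint (h0.left_sub hb) (h0.right_sub hb'))
      ?_ ?_ ?_ ?_ ?_ ?_ ?_ ?_ (ih1.congr ?_) (ih2.congr ?_) ?_ ?_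
    · exact fun b hb => fresh_comp (fresh_subst (hσP b (h0.left_sub hb))
        (h0.left_fresh.1 b (h0.left_sub hb))) (hΨP b (h0.left_sub hb))
    · exact fun b hb => PreAgent.fresh_subst (hσP b (h0.left_sub hb))
        (h0.left_fresh.2.1 b (h0.left_sub hb))
    · exact fun b hb => fresh_subst_term (hσP b (h0.left_sub hb))
        (h0.left_fresh.2.2 b (h0.left_sub hb))
    · exact fun b hb => PreAgent.fresh_subst (hσP b (h0.left_sub hb)) (h0.fresh_left b hb)
    · exact fun b hb => fresh_comp (fresh_subst (hσQ b (h0.right_sub hb))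
        (h0.right_fresh.1 b (h0.right_sub hb))) (hΨQ b (h0.right_sub hb))
    · exact fun b hb => PreAgent.fresh_subst (hσQ b (h0.right_sub hb))
        (h0.right_fresh.2.1 b (h0.right_sub hb))
    · exact fun b hb => fresh_subst_term (hσQ b (h0.right_sub hb))
        (h0.right_fresh.2.2 b (h0.right_sub hb))
    · exact fun b hb => PreAgent.fresh_subst (hσQ b (h0.right_sub hb)) (h0.fresh_right b hb)
    · simp only [psi.comp_subst, cls_comp]; ac_rfl
    · simp only [psi.comp_subst, cls_comp]; ac_rfl
    · rw [psi.chan_subst] at hE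
      refine entails_of_cls ?_ (psi.chan_symm _ _ _ hE)
      simp only [psi.comp_subst, cls_comp]
      ac_rfl
    · exact fun b hb => PreAgent.fresh_subst (hσQ b (ha b hb)) (h1 b hb)
  | @par_left Ψ P Q bQ ΨQ α D P' h1 h2 h3 h4 hP h5 h6 ih =>
    obtain ⟨hσ, hΨ, hD'⟩ := sat_of_sat_nu hP.ne_nil hD
    have ih := ih σ hD'
    have hfr := h1.subst hσ
    have hΨ' := fun b hb => fresh_comp (psi := psi) (fresh_subst (hσ b hb) (h2 b hb)) (hΨ b hb)
    have hP' := fun b hb => PreAgent.fresh_subst (hσ b hb) (h3 b hb)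
    cases α with
    | tau =>
      simp only [Action.Realized, PreAgent.subst_par]
      refine .par_left hfr hΨ' hP' (fun b hb => trivial) (ih.congr ?_) (by simp [Action.bn, FreshAll])
      simp only [psi.comp_subst, cls_comp]; ac_rfl
    | out y a N =>
      simp only [Action.Realized, PreAgent.subst_par]
      -- The bound names of the output are listed in `E`, so they are fresh for `σ` and remain fresh
      -- for the instance of `Q`.
      obtain ⟨E, hE, ha⟩ := hP.exists_outBn_subset
      refine .par_left hfr hΨ' hP' (fun b hb => ⟨(hσ b hb).apply (fresh_name.1 (h4 b hb).1),
        (h4 b hb).2.1, fresh_subst_term (hσ b hb) (h4 b hb).2.2⟩) (ih.congr ?_)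
        fun b hb => PreAgent.fresh_subst ((hD' E hE).1 b (ha b hb)) (h5 b hb)
      simp only [psi.comp_subst, cls_comp]; ac_rfl
    | inp y x =>
      simp only [Action.Realized, PreAgent.subst_par]
      intro z hz hzP
      rw [PreAgent.fresh_par] at hzP
      have hz' : z ∉ bQ ∧ ∀ E ∈ D, z ∉ E.names := by
        obtain ⟨E, hE⟩ := List.exists_mem_of_ne_nil D hP.ne_nil
        have key : ∀ E ∈ D, ¬ (z ∈ bQ ∨ z ∈ E.names) := fun E hE => List.mem_append.not.1
          (hz _ (List.mem_map_of_mem (f := fun E : AtomicConstraint C A =>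
            (⟨bQ ++ E.names, E.assertion, E.cond⟩ : AtomicConstraint C A)) hE))
        exact ⟨fun h => key E hE (Or.inl h), fun E hE h => key E hE (Or.inr h)⟩
      rw [PreAgent.subst_update (h5 x (by simp [Action.bn]))]
      refine .par_left hfr hΨ' hP' (fun b hb => ⟨(hσ b hb).apply (fresh_name.1 (h4 b hb).1),
        fun e => hz'.1 (e ▸ hb)⟩) ((ih z hz'.2 hzP.1).congr ?_) (by simpa [Action.bn, FreshAll]
          using hzP.2)
      simp only [psi.comp_subst, cls_comp]; ac_rfl
  | @par_right Ψ P Q bP ΨP α D Q' h1 h2 h3 h4 hP h5 h6 ih =>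
    obtain ⟨hσ, hΨ, hD'⟩ := sat_of_sat_nu hP.ne_nil hD
    have ih := ih σ hD'
    have hfr := h1.subst hσ
    have hΨ' := fun b hb => fresh_comp (psi := psi) (fresh_subst (hσ b hb) (h2 b hb)) (hΨ b hb)
    have hP' := fun b hb => PreAgent.fresh_subst (hσ b hb) (h3 b hb)
    cases α with
    | tau =>
      simp only [Action.Realized, PreAgent.subst_par]
      refine .par_right hfr hΨ' hP' (fun b hb => trivial) (ih.congr ?_) (by simp [Action.bn, FreshAll])
      simp only [psi.comp_subst, cls_comp]; ac_rfl
    | out y a N =>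
      simp only [Action.Realized, PreAgent.subst_par]
      obtain ⟨E, hE, ha⟩ := hP.exists_outBn_subset
      refine .par_right hfr hΨ' hP' (fun b hb => ⟨(hσ b hb).apply (fresh_name.1 (h4 b hb).1),
        (h4 b hb).2.1, fresh_subst_term (hσ b hb) (h4 b hb).2.2⟩) (ih.congr ?_)
        fun b hb => PreAgent.fresh_subst ((hD' E hE).1 b (ha b hb)) (h5 b hb)
      simp only [psi.comp_subst, cls_comp]; ac_rfl
    | inp y x =>
      simp only [Action.Realized, PreAgent.subst_par]
      intro z hz hzP
      rw [PreAgent.fresh_par] at hzP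
      have hz' : z ∉ bP ∧ ∀ E ∈ D, z ∉ E.names := by
        obtain ⟨E, hE⟩ := List.exists_mem_of_ne_nil D hP.ne_nil
        have key : ∀ E ∈ D, ¬ (z ∈ bP ∨ z ∈ E.names) := fun E hE => List.mem_append.not.1
          (hz _ (List.mem_map_of_mem (f := fun E : AtomicConstraint C A =>
            (⟨bP ++ E.names, E.assertion, E.cond⟩ : AtomicConstraint C A)) hE))
        exact ⟨fun h => key E hE (Or.inl h), fun E hE h => key E hE (Or.inr h)⟩
      rw [PreAgent.subst_update (h5 x (by simp [Action.bn]))]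
      refine .par_right hfr hΨ' hP' (fun b hb => ⟨(hσ b hb).apply (fresh_name.1 (h4 b hb).1),
        fun e => hz'.1 (e ▸ hb)⟩) ((ih z hz'.2 hzP.2).congr ?_) (by simpa [Action.bn, FreshAll]
          using hzP.1)
      simp only [psi.comp_subst, cls_comp]; ac_rfl
  | @scope Ψ P α D P' a h h1 h2 ih =>
    obtain ⟨hσ, hΨ, hD'⟩ := sat_of_sat_nu h.ne_nil hD
    simp only [List.mem_singleton, forall_eq, FreshAll] at hσ hΨ
    have ih := ih σ hD'
    have hΨ' := fresh_comp (psi := psi) (fresh_subst hσ h2) hΨ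
    cases α with
    | tau =>
      simp only [Action.Realized, PreAgent.subst_res_of_fresh hσ]
      exact .scope ih trivial hΨ'
    | out y b N =>
      simp only [Action.Realized, PreAgent.subst_res_of_fresh hσ]
      exact .scope ih ⟨hσ.apply (fresh_name.1 h1.1), h1.2.1, fresh_subst_term hσ h1.2.2⟩ hΨ'
    | inp y x =>
      intro z hz hzP
      -- After restriction `a` heads the name list of every atomic constraint, and there is at least
      -- one, so the assumption on `z` excludes `a`.
      have hza : z ≠ a := by
        obtain ⟨E, hE⟩ := List.exists_mem_of_ne_nil D h.ne_nil
        have := hz _ (List.mem_map_of_mem hE)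
        simp at this
        exact this.1
      rw [PreAgent.subst_res_of_fresh hσ] at hzP ⊢
      rw [PreAgent.subst_res_of_fresh (hσ.update h1.2 (fresh_var hza.symm))]
      refine .scope (ih z ?_ ?_) ⟨hσ.apply (fresh_name.1 h1.1), hza.symm⟩ hΨ'
      · intro E hE
        have := hz _ (List.mem_map_of_mem hE)
        simp at this
        exact this.2
      · exact (PreAgent.fresh_res.1 hzP).resolve_left hza
  | @openRes Ψ P y N D P' a a₁ a₂ h h1 h2 h3 h4 ih =>
    obtain ⟨hσ, hΨ, hD'⟩ := sat_of_sat_nu h.ne_nil hD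
    simp only [List.mem_singleton, forall_eq, FreshAll] at hσ hΨ
    have ih := ih σ hD'
    simp only [Action.Realized, PreAgent.subst_res_of_fresh hσ]
    exact .openRes ih h2 (fresh_comp (fresh_subst hσ h3) hΨ) (hσ.apply h4)
      ((occurs_subst_term_of_fresh hσ).2 h1)
  | @rep Ψ P α D P' h ih =>
    have ih := ih σ hD
    cases α with
    | tau =>
      simp only [Action.Realized, PreAgent.subst_rep, PreAgent.subst_par] at ih ⊢
      exact .rep ih
    | out y b N =>
      simp only [Action.Realized, PreAgent.subst_rep, PreAgent.subst_par] at ih ⊢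
      exact .rep ih
    | inp y x =>
      simp only [Action.Realized, PreAgent.subst_rep, PreAgent.subst_par] at ih ⊢
      exact fun z hz hzP => .rep (ih z hz (by simpa using hzP))

end Soundness
end Psi

/-! ### From concrete to symbolic transitions: the invariant and its stability under the rules -/

namespace Psi

open NamedTerms (var)
open HasSubst (subst)

section Matching

variable {T C A : Type u} [TermType T] [DataType T C] [DataType T A]

/-- Renaming the bound name of an input in its derivative has no effect once a term is substituted
for that name. -/
theorem PreAgent.smul_subst_single_of_fix {π : NPerm} {z : Name} {L : T} {P : PreAgent T C A}
    (h : ∀ a, a ≠ z → Occurs a P → π a = a) :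
    (π • P).subst (.single (π z) L) = P.subst (.single z L) := by
  have := PreAgent.smul_subst_smul P 1 1 π 1 (.single (π z) L) (.single z L) fun a ha => by
    by_cases haz : a = z
    · subst haz; simp
    · have := h a haz ha
      rw [this, Substn.single_of_ne, Equiv.Perm.one_apply, Substn.single_of_ne _ haz]
      exact fun e => haz (π.injective (this.trans e))
  simpa using this

variable {psi : PsiCalculus T C A}

/-- The first atomic constraint `(ν c) {| Ψ' ⊢ M ↔ y |}` of a symbolic transition of `P` in the
environment `Ψ`, where `P` has the frame `(ν b) Φ` and the names `c` are chosen outside of `B`. -/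
structure IsSubjectConstraint (psi : PsiCalculus T C A) (B : Finset Name) (b : List Name) (Φ Ψ : A)
    (P : PreAgent T C A) (c : List Name) (Ψ' : A) (M : T) : Prop where
  sub : b ⊆ c
  notMem : ∀ a ∈ c, a ∉ B
  env : StablyEquivalent psi Ψ' (psi.comp Ψ Φ)
  fresh : ∀ w, Fresh w P → w ∉ c → Fresh w M

/-- There is a symbolic transition of `P` for the concrete transition `α` of `P σ` to `R`, and
`(σ, Ψ₀)` is a solution of its constraint. All bound names are chosen outside of `B`. -/
def Action.Matched (psi : PsiCalculus T C A) (B : Finset Name) (b : List Name) (Φ Ψ Ψ₀ : A)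
    (σ : Substn T) (P R : PreAgent T C A) : Action T T → Prop
  | tau => ∃ D P', SymTrans psi Ψ P .tau D P' ∧ (∀ E ∈ D, E.Sat psi σ Ψ₀) ∧ P'.subst σ = R
  | inp K z => ∀ y ∈ B, ∀ x ∈ B, Psi.Fresh y Ψ → Psi.Fresh y P → Psi.Fresh x P → y ≠ x →
      σ y = K → ∃ c Ψ' M D P',
        SymTrans psi Ψ P (.inp y x) (⟨c, Ψ', psi.chan M (var y)⟩ :: D) P' ∧
        (∀ E ∈ (⟨c, Ψ', psi.chan M (var y)⟩ :: D : TransConstraint C A), E.Sat psi σ Ψ₀) ∧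
        IsSubjectConstraint psi B b Φ Ψ P c Ψ' M ∧
        ∀ L, P'.subst (σ.update x L) = R.subst (.single z L)
  | out K a N => ∀ y ∈ B, Psi.Fresh y Ψ → Psi.Fresh y P → σ y = K → ∃ c Ψ' M D P' a' N',
        SymTrans psi Ψ P (.out y a' N') (⟨c, Ψ', psi.chan M (var y)⟩ :: D) P' ∧
        (∀ E ∈ (⟨c, Ψ', psi.chan M (var y)⟩ :: D : TransConstraint C A), E.Sat psi σ Ψ₀) ∧
        IsSubjectConstraint psi B b Φ Ψ P c Ψ' M ∧ (∀ e ∈ a', e ∉ B) ∧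
        ∃ ρ : NPerm, a.map ρ = a' ∧ (∀ e, e ∉ a → Occurs e N ∨ Occurs e R → ρ e = e) ∧
          subst N' σ = ρ • N ∧ P'.subst σ = ρ • R

/-- `P σ = R`, the environment `Ψc` is `Ψ σ ⊗ Ψ₀`, the frame of `P` is `(ν b) Φ`, and all names that
occur are in `B`. -/
structure IsInstance (psi : PsiCalculus T C A) (Ψc : A) (R : PreAgent T C A) (B : Finset Name)
    (P : PreAgent T C A) (σ : Substn T) (Ψ Ψ₀ : A) (b : List Name) (Φ : A) : Prop where
  wellFormed : P.WellFormed psi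
  eq : P.subst σ = R
  env : cls psi Ψc = cls psi (psi.comp (subst Ψ σ) Ψ₀)
  frame : IsFrame psi P b Φ
  notMem : ∀ a ∈ b, a ∉ B
  fresh : ∀ w, w ∉ B → Fresh w P ∧ σ.Fresh w ∧ Fresh w Ψ ∧ Fresh w Ψ₀ ∧ Fresh w Ψc

/-- All alpha-variants of the transition `Ψc ▷ R --α--> R'` are matched by symbolic transitions. -/
def Matchable (psi : PsiCalculus T C A) (Ψc : A) (R : PreAgent T C A) (α : Action T T)
    (R' : PreAgent T C A) : Prop :=
  ∀ (π : NPerm) (B : Finset Name) (P : PreAgent T C A) (σ : Substn T) (Ψ Ψ₀ : A) (b : List Name)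
    (Φ : A), IsInstance psi (π • Ψc) (π • R) B P σ Ψ Ψ₀ b Φ →
      (π • α).Matched psi B b Φ Ψ Ψ₀ σ P (π • R')

variable {Ψc Ψ Ψ₀ Φ : A} {R R' P : PreAgent T C A} {α : Action T T} {B : Finset Name} {σ : Substn T}
  {b : List Name}

theorem Matchable.smul (h : Matchable psi Ψc R α R') (π : NPerm) :
    Matchable psi (π • Ψc) (π • R) (π • α) (π • R') := by
  intro ρ
  simp only [← mul_smul]
  exact h _

theorem Matchable.matched (h : Matchable psi Ψc R α R')
    (hI : IsInstance psi Ψc R B P σ Ψ Ψ₀ b Φ) : α.Matched psi B b Φ Ψ Ψ₀ σ P R' := by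
  simpa using h 1 B P σ Ψ Ψ₀ b Φ (by simpa using hI)

/-- Alpha-conversion of the bound name is invisible, because the invariant compares input
derivatives only after substitution for that name. -/
theorem Action.Matched.inp_of_smul {π : NPerm} {K : T} {z : Name}
    (hα : ∀ e, e ≠ z → Occurs e R' → π e = e)
    (h : (inp K (π z)).Matched psi B b Φ Ψ Ψ₀ σ P (π • R')) :
    (inp K z).Matched psi B b Φ Ψ Ψ₀ σ P R' := by
  intro y hy x hx h1 h2 h3 h4 h5
  obtain ⟨c, Ψ', M, D, P', g1, g2, g3, g4⟩ := h y hy x hx h1 h2 h3 h4 h5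
  exact ⟨c, Ψ', M, D, P', g1, g2, g3, fun L =>
    (g4 L).trans (PreAgent.smul_subst_single_of_fix hα)⟩

/-- The invariant relates the bound names of the two outputs by a permutation, with which `π` can be
composed. -/
theorem Action.Matched.out_of_smul {π : NPerm} {K N : T} {a : List Name}
    (hα : ∀ e, e ∉ a → Occurs e N ∨ Occurs e R' → π e = e)
    (h : (out K (a.map π) (π • N)).Matched psi B b Φ Ψ Ψ₀ σ P (π • R')) :
    (out K a N).Matched psi B b Φ Ψ Ψ₀ σ P R' := by
  intro y hy h1 h2 h3
  obtain ⟨c, Ψ', M, D, P', a', N', g1, g2, g3, g4, ρ, g5, g6, g7, g8⟩ := h y hy h1 h2 h3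
  refine ⟨c, Ψ', M, D, P', a', N', g1, g2, g3, g4, ρ * π, ?_, ?_, ?_, ?_⟩
  · simpa using g5
  · intro e he he'
    have hπ := hα e he he'
    rw [Equiv.Perm.mul_apply, hπ]
    refine g6 e ?_ ?_
    · intro h
      obtain ⟨d, hd, hde⟩ := List.mem_map.1 h
      exact he (π.injective (hde.trans hπ.symm) ▸ hd)
    · rw [← hπ, occurs_smul_iff, occurs_smul_iff]; exact he'
  · rw [mul_smul]; exact g7
  · rw [mul_smul]; exact g8

/-- The subject of a matched transition is the instance of a name. -/
theorem Action.Matched.of_subj_fresh (hσ : ∀ w, w ∉ B → σ.Fresh w)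
    (h : (∀ K ∈ α.subj, ∀ w, w ∉ B → Psi.Fresh w K) → α.Matched psi B b Φ Ψ Ψ₀ σ P R') :
    α.Matched psi B b Φ Ψ Ψ₀ σ P R' := by
  cases α with
  | tau => exact h (by simp [subj])
  | inp K z =>
    intro y hy x hx h1 h2 h3 h4 h5
    refine h (fun K hK w hw => ?_) y hy x hx h1 h2 h3 h4 h5
    obtain rfl : _ = _ := Option.some.inj hK
    exact h5 ▸ (hσ w hw).apply fun e => hw (e ▸ hy)
  | out K a N =>
    intro y hy h1 h2 h3
    refine h (fun K hK w hw => ?_) y hy h1 h2 h3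
    obtain rfl : _ = _ := Option.some.inj hK
    exact h3 ▸ (hσ w hw).apply fun e => hw (e ▸ hy)

/-- Induction hypotheses are applied to renamed transitions, so that concrete binders coincide with
the prescribed frame names; this result undoes the renaming. -/
theorem Action.Matched.of_smul {π : NPerm}
    (hα : ∀ e, e ∉ α.bn → ¬ α.ObjFresh e ∨ Occurs e R' → π e = e)
    (hK : ∀ K ∈ α.subj, π • K = K)
    (h : (π • α).Matched psi B b Φ Ψ Ψ₀ σ P (π • R')) :
    α.Matched psi B b Φ Ψ Ψ₀ σ P R' := by
  cases α with
  | tau =>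
    obtain ⟨D, P', h1, h2, h3⟩ := h
    exact ⟨D, P', h1, h2, h3.trans
      (Psi.smul_eq_of_fix fun e he => hα e (by simp [bn]) (Or.inr he))⟩
  | inp K z =>
    rw [smul_inp, hK K rfl] at h
    exact inp_of_smul (fun e he he' => hα e (by simpa [bn] using he) (Or.inr he')) h
  | out K a N =>
    rw [smul_out, hK K rfl] at h
    exact out_of_smul (fun e he he' => hα e he (he'.imp_left fun h => h)) h

theorem PreAgent.subst_single_of_fresh {P : PreAgent T C A} {z : Name} {L : T} (hz : Fresh z P) :
    P.subst (.single z L) = P := by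
  rw [PreAgent.subst_rename P (π := 1) fun a ha => Substn.single_of_ne _ fun e : a = z =>
    ha (e ▸ hz), one_smul]

theorem PreAgent.subst_update_single {P : PreAgent T C A} {σ : Substn T} {x w : Name} {L : T}
    (hσ : σ.Fresh w) (hP : Fresh w P) :
    (P.subst (σ.update x (var w))).subst (.single w L) = P.subst (σ.update x L) := by
  refine PreAgent.subst_subst P fun a ha => ?_
  by_cases h : a = x
  · subst h; simp [TermType.var_subst]
  · rw [Substn.update_of_ne _ _ h, Substn.update_of_ne _ _ h]
    exact (subst_term_single_of_fresh (hσ.apply fun e : w = a => ha (e ▸ hP))).symm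

/-- Substituting a fresh name determines all other substitutions. -/
theorem PreAgent.subst_update_eq {P R : PreAgent T C A} {σ : Substn T} {x z : Name}
    (S : Finset Name)
    (h : ∀ w, w ∉ S → P.subst (σ.update x (var w)) = R.subst (.single z (var w))) (L : T) :
    P.subst (σ.update x L) = R.subst (.single z L) := by
  classical
  obtain ⟨w, hw, hσ, -, hP⟩ := PreAgent.exists_binder σ σ (S ∪ nsupp R) P
  simp only [Finset.mem_union, not_or, mem_nsupp, not_occurs] at hw
  have h2 : R.subst (.single z L) = (R.subst (.single z (var w))).subst (.single w L) := by
    refine (PreAgent.subst_subst R fun a ha => ?_).symm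
    by_cases h : a = z
    · subst h; simp [TermType.var_subst]
    · rw [Substn.single_of_ne _ h, Substn.single_of_ne _ h, TermType.var_subst,
        Substn.single_of_ne _ fun e : a = w => ha (e ▸ hw.2)]
  rw [← PreAgent.subst_update_single hσ hP, h2, h w hw.1]

/-- A renaming of the bound names of an output can be chosen to fix other names. -/
theorem exists_perm_extend {a a' : List Name} {ρ : NPerm} {N : T} {R : PreAgent T C A}
    (ha : a.Nodup) (h : a.map ρ = a')
    (hρ : ∀ e, e ∉ a → Occurs e N ∨ Occurs e R → ρ e = e) (F : Finset Name)
    (hF : ∀ e ∈ F, e ∉ a → e ∉ a') :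
    ∃ ρ' : NPerm, a.map ρ' = a' ∧ (∀ e, e ∉ a → Occurs e N ∨ Occurs e R ∨ e ∈ F → ρ' e = e) ∧
      ρ' • N = ρ • N ∧ ρ' • R = ρ • R := by
  classical
  obtain ⟨ρ', h1, h2⟩ := exists_perm_map_eq_fix ha (h ▸ ha.map ρ.injective) (by simp [← h])
    (nsupp N ∪ nsupp R ∪ F) fun e he hea => by
      simp only [Finset.mem_union, mem_nsupp] at he
      rcases he with he | he
      · rw [← h]
        intro h'
        obtain ⟨d, hd, hde⟩ := List.mem_map.1 h'
        exact hea (ρ.injective (hde.trans (hρ e hea he).symm) ▸ hd)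
      · exact hF e he hea
  simp only [Finset.mem_union, mem_nsupp, or_assoc] at h2
  have key : ∀ e ∈ a, ρ' e = ρ e := List.map_inj_left.1 (h1.trans h.symm)
  refine ⟨ρ', h1, fun e he he' => h2 e he' he, smul_eq_smul fun e he => ?_,
    smul_eq_smul fun e he => ?_⟩
  · by_cases hea : e ∈ a
    · exact key e hea
    · rw [h2 e (Or.inl he) hea, hρ e hea (Or.inl he)]
  · by_cases hea : e ∈ a
    · exact key e hea
    · rw [h2 e (Or.inr (Or.inl he)) hea, hρ e hea (Or.inr he)]

namespace IsSubjectConstraint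

variable {c : List Name} {Ψ' : A} {M : T}

theorem scope {a : Name} (h : IsSubjectConstraint psi (insert a B) b Φ Ψ P c Ψ' M) (ha : a ∉ B) :
    IsSubjectConstraint psi B (a :: b) Φ Ψ (.res a P) (a :: c) Ψ' M where
  sub := List.cons_subset_cons _ h.sub
  notMem e he := by
    rcases List.mem_cons.1 he with rfl | he
    · exact ha
    · exact fun h' => h.notMem e he (Finset.mem_insert_of_mem h')
  env := h.env
  fresh w hw hwc := by
    simp only [List.mem_cons, not_or] at hwc
    exact h.fresh w ((PreAgent.fresh_res.1 hw).resolve_left hwc.1) hwc.2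

theorem par_left {Q : PreAgent T C A} {bQ : List Name} {ΨQ : A}
    (h : IsSubjectConstraint psi (B ∪ bQ.toFinset) b Φ (psi.comp Ψ ΨQ) P c Ψ' M)
    (hbQ : ∀ a ∈ bQ, a ∉ B) :
    IsSubjectConstraint psi B (b ++ bQ) (psi.comp Φ ΨQ) Ψ (.par P Q) (bQ ++ c) Ψ' M where
  sub := List.append_subset.2 ⟨List.subset_append_of_subset_right _ h.sub,
    List.subset_append_left _ _⟩
  notMem e he := by
    rcases List.mem_append.1 he with he | he
    · exact hbQ e he
    · exact fun h' => h.notMem e he (Finset.mem_union_left _ h')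
  env := by
    have := h.env
    rw [stablyEquivalent_iff] at this ⊢
    intro τ
    rw [this τ]
    simp only [psi.comp_subst, cls_comp]
    ac_rfl
  fresh w hw hwc := by
    simp only [List.mem_append, not_or] at hwc
    exact h.fresh w (PreAgent.fresh_par.1 hw).1 hwc.2

theorem par_right {Q : PreAgent T C A} {bQ : List Name} {ΨQ : A}
    (h : IsSubjectConstraint psi (B ∪ bQ.toFinset) b Φ (psi.comp Ψ ΨQ) P c Ψ' M)
    (hbQ : ∀ a ∈ bQ, a ∉ B) :
    IsSubjectConstraint psi B (bQ ++ b) (psi.comp ΨQ Φ) Ψ (.par Q P) (bQ ++ c) Ψ' M where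
  sub := List.append_subset.2 ⟨List.subset_append_left _ _,
    List.subset_append_of_subset_right _ h.sub⟩
  notMem := (h.par_left (Q := Q) hbQ).notMem
  env := by
    have := h.env
    rw [stablyEquivalent_iff] at this ⊢
    intro τ
    rw [this τ]
    simp only [psi.comp_subst, cls_comp]
    ac_rfl
  fresh w hw hwc := by
    simp only [List.mem_append, not_or] at hwc
    exact h.fresh w (PreAgent.fresh_par.1 hw).2 hwc.2

/-- Agents without proper unguarded assertions have trivial frames. -/
theorem of_trivial {b' : List Name} {P' : PreAgent T C A} {Φ' : A}
    (h : IsSubjectConstraint psi B b Φ Ψ P c Ψ' M) (hΦ : ∀ τ : Substn T, cls psi (subst Φ τ) = 1)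
    (hΦ' : Φ' = psi.unit) (hb' : b' = []) (hP : ∀ w, Fresh w P' → Fresh w P) :
    IsSubjectConstraint psi B b' Φ' Ψ P' c Ψ' M where
  sub := by simp [hb']
  notMem := h.notMem
  env := by
    have := h.env
    rw [stablyEquivalent_iff] at this ⊢
    intro τ
    rw [this τ]
    simp only [psi.comp_subst, cls_comp, hΦ, hΦ', psi.unit_subst, cls_unit]
  fresh w hw := h.fresh w (hP w hw)

end IsSubjectConstraint

namespace Action.Matched

theorem scope {a : Name} (h : α.Matched psi (insert a B) b Φ Ψ Ψ₀ σ P R') (ha : a ∉ B)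
    (hbn : α.bn.Nodup) (hα : α.Fresh a) (hσ : σ.Fresh a) (hΨ : Psi.Fresh a Ψ)
    (hΨ₀ : Psi.Fresh a Ψ₀) :
    α.Matched psi B (a :: b) Φ Ψ Ψ₀ σ (.res a P) (.res a R') := by
  have nu : ∀ {D : TransConstraint C A}, (∀ E ∈ D, E.Sat psi σ Ψ₀) →
      ∀ E ∈ TransConstraint.nu [a] D, E.Sat psi σ Ψ₀ := fun h =>
    sat_nu (by simpa using hσ) (by simpa [FreshAll] using hΨ₀) h
  cases α with
  | tau =>
    obtain ⟨D, P', h1, h2, rfl⟩ := h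
    exact ⟨_, _, .scope h1 trivial hΨ, nu h2, PreAgent.subst_res_of_fresh hσ⟩
  | inp K z =>
    intro y hy x hx h1 h2 h3 h4 h5
    have hya : a ≠ y := fun e => ha (e ▸ hy)
    have hxa : a ≠ x := fun e => ha (e ▸ hx)
    obtain ⟨c, Ψ', M, D, P', g1, g2, g3, g4⟩ := h y (by simp [hy]) x (by simp [hx]) h1
      ((PreAgent.fresh_res.1 h2).resolve_left hya.symm)
      ((PreAgent.fresh_res.1 h3).resolve_left hxa.symm) h4 h5
    -- The derivatives must agree for every term `L`, but an `L` that contains `a` could be captured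
    -- by the restriction. By `PreAgent.subst_update_eq` it suffices to substitute names other than
    -- `a`, and these commute with it.
    refine ⟨a :: c, Ψ', M, _, _, .scope g1 ⟨fresh_name.2 hya, hxa⟩ hΨ, nu g2, g3.scope ha,
      PreAgent.subst_update_eq {a} fun w hw => ?_⟩
    have hwa : Psi.Fresh a (var w : T) := fresh_var fun e => hw (by simp [e])
    rw [PreAgent.subst_res_of_fresh (hσ.update hxa hwa),
      PreAgent.subst_res_of_fresh (Substn.Fresh.single hα.2 hwa), g4]
  | out K l N =>
    intro y hy h1 h2 h3
    have hya : a ≠ y := fun e => ha (e ▸ hy)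
    obtain ⟨c, Ψ', M, D, P', a', N', g1, g2, g3, g4, ρ, g5, g6, g7, g8⟩ := h y (by simp [hy]) h1
      ((PreAgent.fresh_res.1 h2).resolve_left hya.symm) h3
    have haa' : a ∉ a' := fun h => g4 a h (by simp)
    -- The renaming of bound names is adjusted to fix `a`, so that it preserves the restriction of
    -- the derivative.
    obtain ⟨ρ, g5, g6, e1, e2⟩ := exists_perm_extend hbn g5 g6 {a} (by simpa using fun _ => haa')
    have hρ : ρ a = a := g6 a hα.2.1 (by simp)
    -- Scope needs freshness for `N'`, while only its instance is known, as a renaming of `N`.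
    -- Because `a` is fresh for `σ`, an occurrence in `N'` would persist in the instance.
    have hN' : Psi.Fresh a N' := by
      have : Psi.Fresh a (subst N' σ) := by
        rw [g7, ← e1, ← hρ]; exact Psi.fresh_smul ρ hα.2.2
      exact not_occurs.1 fun h => (occurs_subst_term_of_fresh hσ).2 h this
    refine ⟨a :: c, Ψ', M, _, _, a', N', .scope g1 ⟨fresh_name.2 hya, haa', hN'⟩ hΨ, nu g2,
      g3.scope ha, fun e he h => g4 e he (by simp [h]), ρ, g5, fun e he he' => ?_, g7.trans e1.symm,
      ?_⟩
    · by_cases hea : e = a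
      · subst hea; exact hρ
      · refine g6 e he (he'.imp_right fun h => Or.inl fun h' => h ?_)
        exact PreAgent.fresh_res.2 (Or.inr h')
    · rw [PreAgent.subst_res_of_fresh hσ, g8, PreAgent.smul_res, hρ, e2]

theorem openRes {a : Name} {a₁ a₂ : List Name} {K N : T}
    (h : (out K (a₁ ++ a₂) N).Matched psi (insert a B) b Φ Ψ Ψ₀ σ P R') (ha : a ∉ B)
    (haa : a ∉ a₁ ++ a₂) (haN : Occurs a N) (hσ : σ.Fresh a) (hΨ : Psi.Fresh a Ψ)
    (hΨ₀ : Psi.Fresh a Ψ₀) :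
    (out K (a₁ ++ a :: a₂) N).Matched psi B (a :: b) Φ Ψ Ψ₀ σ (.res a P) R' := by
  intro y hy h1 h2 h3
  have hya : a ≠ y := fun e => ha (e ▸ hy)
  obtain ⟨c, Ψ', M, D, P', a', N', g1, g2, g3, g4, ρ, rfl, g6, g7, g8⟩ := h y (by simp [hy]) h1
    ((PreAgent.fresh_res.1 h2).resolve_left hya.symm) h3
  -- The opened name occurs in `N` and was not bound before, so `ρ` fixes it; it can be inserted at
  -- the corresponding position of the renamed list.
  have hρ : ρ a = a := g6 a haa (Or.inl haN)
  rw [List.map_append] at g1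
  refine ⟨a :: c, Ψ', M, _, _, a₁.map ρ ++ a :: a₂.map ρ, N', .openRes g1 ?_ ?_ hΨ hya,
    sat_nu (b := [a]) (by simpa using hσ) (by simpa [FreshAll] using hΨ₀) g2, g3.scope ha, ?_, ρ,
    by simp [hρ], fun e he => g6 e ?_, g7, g8⟩
  · rw [← occurs_subst_term_of_fresh hσ, g7, ← hρ, occurs_smul_iff]
    exact haN
  · exact fun h => g4 a (by simpa using h) (by simp)
  · intro e he he'
    by_cases hea : e = a
    · exact ha (hea ▸ he')
    · exact g4 e (by simpa [hea] using he) (by simp [he'])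
  · exact fun h => he (by simp at h ⊢; tauto)

theorem par_left {Q : PreAgent T C A} {bQ : List Name} {ΨQ : A}
    (h : α.Matched psi (B ∪ bQ.toFinset) b Φ (psi.comp Ψ ΨQ) Ψ₀ σ P R')
    (hQ : IsFrame psi Q bQ ΨQ) (hbQ : ∀ a ∈ bQ, a ∉ B)
    (hB : ∀ w, w ∉ B → Psi.Fresh w P ∧ Psi.Fresh w Q ∧ σ.Fresh w ∧ Psi.Fresh w Ψ ∧ Psi.Fresh w Ψ₀)
    (hbn : α.bn.Nodup) (hα : FreshAll α.bn (Q.subst σ)) :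
    α.Matched psi B (b ++ bQ) (psi.comp Φ ΨQ) Ψ Ψ₀ σ (.par P Q) (.par R' (Q.subst σ)) := by
  have nu : ∀ {D : TransConstraint C A}, (∀ E ∈ D, E.Sat psi σ Ψ₀) →
      ∀ E ∈ TransConstraint.nu bQ D, E.Sat psi σ Ψ₀ := fun h =>
    sat_nu (fun a ha => (hB a (hbQ a ha)).2.2.1) (fun a ha => (hB a (hbQ a ha)).2.2.2.2) h
  have hbP : FreshAll bQ P := fun a ha => (hB a (hbQ a ha)).1
  have hbΨ : FreshAll bQ Ψ := fun a ha => (hB a (hbQ a ha)).2.2.2.1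
  cases α with
  | tau =>
    obtain ⟨D, P', h1, h2, rfl⟩ := h
    exact ⟨_, _, .par_left hQ hbΨ hbP (fun _ _ => trivial) h1 (by simp [bn, FreshAll])
      (by simp [subj]), nu h2, PreAgent.subst_par ..⟩
  | inp K z =>
    intro y hy x hx h1 h2 h3 h4 h5
    have hyb : y ∉ bQ := fun e => hbQ y e hy
    rw [PreAgent.fresh_par] at h2 h3
    obtain ⟨c, Ψ', M, D, P', g1, g2, g3, g4⟩ := h y (by simp [hy]) x (by simp [hx])
      (fresh_comp h1 (hQ.fresh h2.2 hyb)) h2.1 h3.1 h4 h5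
    refine ⟨bQ ++ c, Ψ', M, _, _, .par_left (α := inp y x) hQ hbΨ hbP
      (fun e he => ⟨fresh_name.2 fun h => hyb (h ▸ he), fun h => hbQ e he (h ▸ hx)⟩) g1 ?_ ?_, nu g2, g3.par_left hbQ, fun L => ?_⟩
    · simpa [bn, FreshAll] using h3.2
    · simpa [subj] using h2.2
    · have hz : Psi.Fresh z (Q.subst σ) := hα z (by simp [bn])
      rw [PreAgent.subst_par, PreAgent.subst_par, g4, PreAgent.subst_update h3.2,
        PreAgent.subst_single_of_fresh hz]
  | out K l N =>
    intro y hy h1 h2 h3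
    have hyb : y ∉ bQ := fun e => hbQ y e hy
    rw [PreAgent.fresh_par] at h2
    obtain ⟨c, Ψ', M, D, P', a', N', g1, g2, g3, g4, ρ, g5, g6, g7, g8⟩ := h y (by simp [hy])
      (fresh_comp h1 (hQ.fresh h2.2 hyb)) h2.1 h3
    have ha' : ∀ e ∈ a', e ∉ B := fun e he h => g4 e he (by simp [h])
    -- The derivative now contains the instance of `Q`, whose names `ρ` has to fix as well. This is
    -- possible because the new bound names lie outside `B`.
    obtain ⟨ρ, g5, g6, e1, e2⟩ := exists_perm_extend hbn g5 g6 (nsupp (Q.subst σ))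
      fun e he _ he' => mem_nsupp.1 he
        (PreAgent.fresh_subst (hB e (ha' e he')).2.2.1 (hB e (ha' e he')).2.1)
    refine ⟨bQ ++ c, Ψ', M, _, _, a', N', .par_left (α := out y a' N') hQ hbΨ
      hbP (fun e he => ⟨fresh_name.2 fun h => hyb (h ▸ he), fun h => g4 e h (by simp [he]), ?_⟩) g1 ?_ ?_, nu g2, g3.par_left hbQ, ha', ρ, g5,
      fun e he he' => g6 e he ?_, g7.trans e1.symm, ?_⟩
    -- A frame name of `Q` is fresh for `P` and not among the new bound names, and symbolic
    -- transitions create no names, so it is fresh for the object.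
    · have := (g1.fresh (hbP e he)).resolve_left fun h => g4 e h (by simp [he])
      exact this.1
    · exact fun e he => (hB e (ha' e he)).2.1
    · simpa [subj] using h2.2
    · refine he'.imp_right fun h => ?_
      by_contra h'
      simp only [not_or, not_occurs, mem_nsupp] at h'
      exact h (PreAgent.fresh_par.2 (by tauto))
    · rw [PreAgent.subst_par, g8, PreAgent.smul_par, e2, Psi.smul_eq_of_fix (x := Q.subst σ)]
      intro e he
      by_cases hel : e ∈ l
      · exact absurd (hα e hel) he
      · exact g6 e hel (Or.inr (Or.inr (mem_nsupp.2 he)))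

theorem par_right {Q : PreAgent T C A} {bQ : List Name} {ΨQ : A}
    (h : α.Matched psi (B ∪ bQ.toFinset) b Φ (psi.comp Ψ ΨQ) Ψ₀ σ P R')
    (hQ : IsFrame psi Q bQ ΨQ) (hbQ : ∀ a ∈ bQ, a ∉ B)
    (hB : ∀ w, w ∉ B → Psi.Fresh w P ∧ Psi.Fresh w Q ∧ σ.Fresh w ∧ Psi.Fresh w Ψ ∧ Psi.Fresh w Ψ₀)
    (hbn : α.bn.Nodup) (hα : FreshAll α.bn (Q.subst σ)) :
    α.Matched psi B (bQ ++ b) (psi.comp ΨQ Φ) Ψ Ψ₀ σ (.par Q P) (.par (Q.subst σ) R') := by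
  have nu : ∀ {D : TransConstraint C A}, (∀ E ∈ D, E.Sat psi σ Ψ₀) →
      ∀ E ∈ TransConstraint.nu bQ D, E.Sat psi σ Ψ₀ := fun h =>
    sat_nu (fun a ha => (hB a (hbQ a ha)).2.2.1) (fun a ha => (hB a (hbQ a ha)).2.2.2.2) h
  have hbP : FreshAll bQ P := fun a ha => (hB a (hbQ a ha)).1
  have hbΨ : FreshAll bQ Ψ := fun a ha => (hB a (hbQ a ha)).2.2.2.1
  cases α with
  | tau =>
    obtain ⟨D, P', h1, h2, rfl⟩ := h
    exact ⟨_, _, .par_right hQ hbΨ hbP (fun _ _ => trivial) h1 (by simp [bn, FreshAll])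
      (by simp [subj]), nu h2, PreAgent.subst_par ..⟩
  | inp K z =>
    intro y hy x hx h1 h2 h3 h4 h5
    have hyb : y ∉ bQ := fun e => hbQ y e hy
    rw [PreAgent.fresh_par] at h2 h3
    obtain ⟨c, Ψ', M, D, P', g1, g2, g3, g4⟩ := h y (by simp [hy]) x (by simp [hx])
      (fresh_comp h1 (hQ.fresh h2.1 hyb)) h2.2 h3.2 h4 h5
    refine ⟨bQ ++ c, Ψ', M, _, _, .par_right (α := inp y x) hQ hbΨ hbP
      (fun e he => ⟨fresh_name.2 fun h => hyb (h ▸ he), fun h => hbQ e he (h ▸ hx)⟩) g1 ?_ ?_, nu g2, g3.par_right hbQ, fun L => ?_⟩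
    · simpa [bn, FreshAll] using h3.1
    · simpa [subj] using h2.1
    · have hz : Psi.Fresh z (Q.subst σ) := hα z (by simp [bn])
      rw [PreAgent.subst_par, PreAgent.subst_par, g4, PreAgent.subst_update h3.1,
        PreAgent.subst_single_of_fresh hz]
  | out K l N =>
    intro y hy h1 h2 h3
    have hyb : y ∉ bQ := fun e => hbQ y e hy
    rw [PreAgent.fresh_par] at h2
    obtain ⟨c, Ψ', M, D, P', a', N', g1, g2, g3, g4, ρ, g5, g6, g7, g8⟩ := h y (by simp [hy])
      (fresh_comp h1 (hQ.fresh h2.1 hyb)) h2.2 h3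
    have ha' : ∀ e ∈ a', e ∉ B := fun e he h => g4 e he (by simp [h])
    obtain ⟨ρ, g5, g6, e1, e2⟩ := exists_perm_extend hbn g5 g6 (nsupp (Q.subst σ))
      fun e he _ he' => mem_nsupp.1 he
        (PreAgent.fresh_subst (hB e (ha' e he')).2.2.1 (hB e (ha' e he')).2.1)
    refine ⟨bQ ++ c, Ψ', M, _, _, a', N', .par_right (α := out y a' N') hQ hbΨ
      hbP (fun e he => ⟨fresh_name.2 fun h => hyb (h ▸ he), fun h => g4 e h (by simp [he]), ?_⟩) g1 ?_ ?_, nu g2, g3.par_right hbQ, ha', ρ, g5,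
      fun e he he' => g6 e he ?_, g7.trans e1.symm, ?_⟩
    · have := (g1.fresh (hbP e he)).resolve_left fun h => g4 e h (by simp [he])
      exact this.1
    · exact fun e he => (hB e (ha' e he)).2.1
    · simpa [subj] using h2.1
    · refine he'.imp_right fun h => ?_
      by_contra h'
      simp only [not_or, not_occurs, mem_nsupp] at h'
      exact h (PreAgent.fresh_par.2 (by tauto))
    · rw [PreAgent.subst_par, g8, PreAgent.smul_par, e2, Psi.smul_eq_of_fix (x := Q.subst σ)]
      intro e he
      by_cases hel : e ∈ l
      · exact absurd (hα e hel) he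
      · exact g6 e hel (Or.inr (Or.inr (mem_nsupp.2 he)))

theorem case {n : ℕ} {φ : Fin n → C} {P : Fin n → PreAgent T C A} {i : Fin n}
    (h : α.Matched psi B b Φ Ψ Ψ₀ σ (P i) R') (hΦ : ∀ τ : Substn T, cls psi (subst Φ τ) = 1)
    (hφ : psi.entails (psi.comp (subst Ψ σ) Ψ₀) (subst (φ i) σ)) :
    α.Matched psi B [] psi.unit Ψ Ψ₀ σ (.case φ P) R' := by
  have sat : ∀ {D : TransConstraint C A}, (∀ E ∈ D, E.Sat psi σ Ψ₀) →
      ∀ E ∈ D ++ [⟨[], Ψ, φ i⟩], E.Sat psi σ Ψ₀ := by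
    intro D hD E hE
    rcases List.mem_append.1 hE with hE | hE
    · exact hD E hE
    · rw [List.mem_singleton.1 hE]
      exact ⟨by simp, by simp [FreshAll], hφ⟩
  have fr : ∀ {w}, Psi.Fresh w (PreAgent.case φ P) → Psi.Fresh w (P i) :=
    fun h => (PreAgent.fresh_case.1 h i).2
  cases α with
  | tau =>
    obtain ⟨D, P', h1, h2, h3⟩ := h
    exact ⟨_, _, .case h1, sat h2, h3⟩
  | inp K z =>
    intro y hy x hx h1 h2 h3 h4 h5
    obtain ⟨c, Ψ', M, D, P', g1, g2, g3, g4⟩ := h y hy x hx h1 (fr h2) (fr h3) h4 h5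
    exact ⟨c, Ψ', M, _, _, .case g1, sat g2, g3.of_trivial hΦ rfl rfl fun w => fr, g4⟩
  | out K l N =>
    intro y hy h1 h2 h3
    obtain ⟨c, Ψ', M, D, P', a', N', g1, g2, g3, g4⟩ := h y hy h1 (fr h2) h3
    exact ⟨c, Ψ', M, _, _, a', N', .case g1, sat g2, g3.of_trivial hΦ rfl rfl fun w => fr, g4⟩

theorem rep (h : α.Matched psi B b Φ Ψ Ψ₀ σ (.par P (.rep P)) R')
    (hΦ : ∀ τ : Substn T, cls psi (subst Φ τ) = 1) :
    α.Matched psi B [] psi.unit Ψ Ψ₀ σ (.rep P) R' := by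
  have fr : ∀ {w}, Psi.Fresh w (PreAgent.rep P) → Psi.Fresh w (PreAgent.par P (.rep P)) :=
    fun h => PreAgent.fresh_par.2 ⟨PreAgent.fresh_rep.1 h, h⟩
  cases α with
  | tau =>
    obtain ⟨D, P', h1, h2, h3⟩ := h
    exact ⟨_, _, .rep h1, h2, h3⟩
  | inp K z =>
    intro y hy x hx h1 h2 h3 h4 h5
    obtain ⟨c, Ψ', M, D, P', g1, g2, g3, g4⟩ := h y hy x hx h1 (fr h2) (fr h3) h4 h5
    exact ⟨c, Ψ', M, _, _, .rep g1, g2, g3.of_trivial hΦ rfl rfl fun w => fr, g4⟩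
  | out K l N =>
    intro y hy h1 h2 h3
    obtain ⟨c, Ψ', M, D, P', a', N', g1, g2, g3, g4⟩ := h y hy h1 (fr h2) h3
    exact ⟨c, Ψ', M, _, _, a', N', .rep g1, g2, g3.of_trivial hΦ rfl rfl fun w => fr, g4⟩

theorem _root_.Psi.IsSubjectConstraint.of_prefix {M : T} (hP : ∀ w, Psi.Fresh w P → Psi.Fresh w M) :
    IsSubjectConstraint psi B [] psi.unit Ψ P [] Ψ M where
  sub := by simp
  notMem := by simp
  env := by
    rw [stablyEquivalent_iff]
    intro τ
    simp only [psi.comp_subst, cls_comp, psi.unit_subst, cls_unit, mul_one]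
  fresh w hw _ := hP w hw

theorem input {M K : T} {x z : Name}
    (hK : psi.entails (psi.comp (subst Ψ σ) Ψ₀) (psi.chan (subst M σ) K))
    (hR : ∀ L, P.subst (σ.update x L) = R'.subst (.single z L)) :
    (inp K z).Matched psi B [] psi.unit Ψ Ψ₀ σ (.input M x P) R' := by
  intro y hy x' hx h1 h2 h3 h4 h5
  rw [PreAgent.fresh_input] at h2 h3
  -- The invariant prescribes the symbolic bound name `x'`, to which the binder of the prefix is
  -- converted.
  have hx' : x = x' ∨ Psi.Fresh x' P := by tauto
  rw [PreAgent.input_conv hx']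
  have hyP : Psi.Fresh y (Equiv.swap x x' • P) := by
    by_cases hxx : x = x'
    · subst hxx
      simp only [Equiv.swap_self]
      exact (show Psi.Fresh y ((1 : NPerm) • P) by rw [one_smul]; tauto)
    · exact Trans.fresh_swap_smul (hx'.resolve_left hxx) (fun h => by tauto) h4
  refine ⟨[], Ψ, M, [], _, .inp h1 h2.1 hyP h4, ?_, .of_prefix fun w hw =>
    (PreAgent.fresh_input.1 hw).1, fun L => ?_⟩
  · simp only [List.mem_singleton, forall_eq]
    refine ⟨by simp, by simp [FreshAll], ?_⟩
    rw [psi.chan_subst, TermType.var_subst, h5]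
    exact hK
  · rw [← hR]
    have := PreAgent.smul_subst_smul P 1 1 (Equiv.swap x x') 1 (σ.update x' L) (σ.update x L)
      fun a ha => by
        by_cases hax : a = x
        · subst hax; simp
        · have hax' : a ≠ x' := by
            rintro rfl
            exact ha (hx'.resolve_left (Ne.symm hax))
          rw [Equiv.swap_apply_of_ne_of_ne hax hax', Equiv.Perm.one_apply,
            Substn.update_of_ne _ _ hax, Substn.update_of_ne _ _ hax']
    simpa using this

theorem output {M K N : T}
    (hK : psi.entails (psi.comp (subst Ψ σ) Ψ₀) (psi.chan (subst M σ) K)) :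
    (out K [] (subst N σ)).Matched psi B [] psi.unit Ψ Ψ₀ σ (.output M N P) (P.subst σ) := by
  intro y hy h1 h2 h3
  rw [PreAgent.fresh_output] at h2
  refine ⟨[], Ψ, M, [], _, [], N, .out h1 h2.1 h2.2.1 h2.2.2, ?_, .of_prefix fun w hw =>
    (PreAgent.fresh_output.1 hw).1, by simp, 1, by simp, by simp, by simp, by simp⟩
  simp only [List.mem_singleton, forall_eq]
  refine ⟨by simp, by simp [FreshAll], ?_⟩
  rw [psi.chan_subst, TermType.var_subst, h3]
  exact hK

end Action.Matched

end Matching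
end Psi

/-! ### Lifting the premises of a communication -/

namespace Psi

open NamedTerms (var)
open HasSubst (subst)

section Matchable

variable {T C A : Type u} [TermType T] [DataType T C] [DataType T A] {psi : PsiCalculus T C A}

theorem PreAgent.subst_single_subst_eq {x : Name} {N : T} {P : PreAgent T C A} {σ : Substn T} :
    (P.subst (.single x N)).subst σ = P.subst (σ.update x (HasSubst.subst N σ)) := by
  refine PreAgent.subst_subst P fun a _ => ?_
  by_cases h : a = x
  · subst h; simp
  · rw [Substn.update_of_ne _ _ h, Substn.single_of_ne _ h, TermType.var_subst]

variable {Ψc Ψ Ψ₀ Φ : A} {R R' P P' : PreAgent T C A} {α : Action T T} {B : Finset Name}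
  {σ : Substn T} {b : List Name}

/-- Since `y` occurs only in the first atomic constraint, the value of `y` is irrelevant to the
others and to the freshness conditions of the first. -/
theorem SymTrans.sat_of_update {α : Action Name T} {E : AtomicConstraint C A}
    {D : TransConstraint C A} {y : Name} {L : T} (h : SymTrans psi Ψ P α (E :: D) P')
    (hy : y ∈ α.subj) (hΨ : Fresh y Ψ) (hP : Fresh y P) (hσ : σ.Fresh y)
    (hs : ∀ F ∈ E :: D, F.Sat psi (σ.update y L) Ψ₀) :
    (∀ a ∈ E.names, σ.Fresh a) ∧ FreshAll E.names Ψ₀ ∧ ∀ F ∈ D, F.Sat psi σ Ψ₀ := by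
  obtain ⟨E', D', e, h1, h2⟩ := h.exists_cons hy hΨ hP
  obtain ⟨rfl, rfl⟩ := List.cons.inj e
  obtain ⟨s1, s2, -⟩ := hs E (by simp)
  exact ⟨fun a ha => .of_update hσ (fun e => h1 (e ▸ ha)) (s1 a ha), s2, fun F hF =>
    .of_update hσ (hs F (by simp [hF])) ⟨fun h => h1 ((h2 F hF).1 h), (h2 F hF).2⟩⟩

/-- Matching symbolic transitions for the premises of a communication from `P` to `Q`. -/
theorem exists_symTrans_com {Q S' : PreAgent T C A} {bP bQ a : List Name} {ΨP ΨQ : A} {M K N : T}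
    {x₀ : Name} (wP : P.WellFormed psi) (wQ : Q.WellFormed psi) (hP : IsFrame psi P bP ΨP)
    (hQ : IsFrame psi Q bQ ΨQ) (hd : List.Disjoint bP bQ) (hbP : ∀ e ∈ bP, e ∉ B)
    (hbQ : ∀ e ∈ bQ, e ∉ B)
    (hB : ∀ w, w ∉ B →
      Fresh w P ∧ Fresh w Q ∧ σ.Fresh w ∧ Fresh w Ψ ∧ Fresh w Ψ₀ ∧ Fresh w Ψc)
    (env : cls psi Ψc = cls psi (psi.comp (subst Ψ σ) Ψ₀))
    (hM : FreshAll bP M) (hK : FreshAll bQ K)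
    (t1 : Trans psi (psi.comp (subst ΨQ σ) Ψc) (P.subst σ) (.out M a N) R')
    (t2 : Trans psi (psi.comp (subst ΨP σ) Ψc) (Q.subst σ) (.inp K x₀) S')
    (m1 : Matchable psi (psi.comp (subst ΨQ σ) Ψc) (P.subst σ) (.out M a N) R')
    (m2 : Matchable psi (psi.comp (subst ΨP σ) Ψc) (Q.subst σ) (.inp K x₀) S')
    (hMK : psi.entails (psi.comp (psi.comp Ψc (subst ΨP σ)) (subst ΨQ σ)) (psi.chan M K))
    (ha : FreshAll a (Q.subst σ)) :
    ∃ y z cP cQ ΨP' ΨQ' MP MQ DP DQ a' N' x P' Q',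
      ComCondition psi Ψ P Q bP bQ ΨP ΨQ y z cP cQ ΨP' ΨQ' MP MQ ∧
      SymTrans psi (psi.comp Ψ ΨQ) P (.out y a' N') (⟨cP, ΨP', psi.chan MP (var y)⟩ :: DP) P' ∧
      SymTrans psi (psi.comp Ψ ΨP) Q (.inp z x) (⟨cQ, ΨQ', psi.chan MQ (var z)⟩ :: DQ) Q' ∧
      FreshAll a' Q ∧ y ∉ a' ∧ z ∉ a' ∧ Fresh y N' ∧ Fresh z N' ∧
      ((∀ e, e ∈ cP ∨ e ∈ cQ → σ.Fresh e ∧ Fresh e Ψ₀) ∧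
        psi.entails (psi.comp (psi.comp Ψc (subst ΨP σ)) (subst ΨQ σ))
          (subst (psi.chan MP MQ) σ) ∧
        (∀ E ∈ DP, E.Sat psi σ Ψ₀) ∧ ∀ E ∈ DQ, E.Sat psi σ Ψ₀) ∧
      ∃ ρ : NPerm, a.map ρ = a' ∧
        (∀ e, e ∉ a → Occurs e (P.subst σ) ∨ Occurs e (Q.subst σ) → ρ e = e) ∧
        (∀ e ∈ a', σ.Fresh e) ∧ P'.subst σ = ρ • R' ∧
        (Q'.subst (.single x N')).subst σ = ρ • S'.subst (.single x₀ N) := by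
  classical
  -- Two symbolic subjects and one symbolic input variable.
  obtain ⟨l, hl, hlen, hfr⟩ := exists_fresh_list 3
    (B ∪ bP.toFinset ∪ bQ.toFinset ∪ nsupp M ∪ nsupp K)
  obtain ⟨y, z, x, rfl⟩ := List.length_eq_three.1 hlen
  simp only [List.nodup_cons, List.mem_cons, List.not_mem_nil, or_false, not_or] at hl
  obtain ⟨⟨hyz, hyx⟩, hzx, -⟩ := hl
  have hy := hfr y (by simp)
  have hz := hfr z (by simp)
  have hx := hfr x (by simp)
  simp only [Finset.mem_union, List.mem_toFinset, not_or] at hy hz hx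
  obtain ⟨⟨⟨⟨yB, ybP⟩, ybQ⟩, yM⟩, yK⟩ := hy
  obtain ⟨⟨⟨⟨zB, zbP⟩, zbQ⟩, zM⟩, zK⟩ := hz
  obtain ⟨⟨⟨⟨xB, xbP⟩, xbQ⟩, xM⟩, xK⟩ := hx
  obtain ⟨yP, yQ, yσ, yΨ, yΨ₀, yΨc⟩ := hB y yB
  obtain ⟨zP, zQ, zσ, zΨ, zΨ₀, zΨc⟩ := hB z zB
  have xQ := (hB x xB).2.1
  have yΨP := hP.fresh yP ybP
  have yΨQ := hQ.fresh yQ ybQ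
  have zΨP := hP.fresh zP zbP
  have zΨQ := hQ.fresh zQ zbQ
  -- P is lifted with `y` standing for its concrete subject `M`. The names of `M` and of the frame
  -- of Q join the set to be avoided.
  have I1 : IsInstance psi (psi.comp (subst ΨQ σ) Ψc) (P.subst σ)
      (B ∪ {y, z} ∪ nsupp M ∪ bQ.toFinset) P (σ.update y M) (psi.comp Ψ ΨQ) Ψ₀ bP ΨP := by
    refine ⟨wP, PreAgent.subst_update yP, ?_, hP, ?_, ?_⟩
    · rw [subst_update_of_fresh (fresh_comp yΨ yΨQ)]
      simp only [psi.comp_subst, cls_comp, env]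
      ac_rfl
    · intro e he
      have h1 := hbP e he
      have h2 : e ∉ nsupp M := fun h => mem_nsupp.1 h (hM e he)
      have h3 : e ∉ bQ := fun h => hd he h
      have h4 : e ≠ y := fun h => ybP (h ▸ he)
      have h5 : e ≠ z := fun h => zbP (h ▸ he)
      simp_all
    · intro w hw
      simp only [Finset.mem_union, Finset.mem_insert, Finset.mem_singleton, List.mem_toFinset,
        not_or, mem_nsupp, not_occurs] at hw
      obtain ⟨⟨⟨wB, wy, wz⟩, wM⟩, wbQ⟩ := hw
      obtain ⟨wP, wQ, wσ, wΨ, wΨ₀, wΨc⟩ := hB w wB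
      have wΨQ := hQ.fresh wQ wbQ
      exact ⟨wP, wσ.update wy wM, fresh_comp wΨ wΨQ, wΨ₀, fresh_comp (fresh_subst wσ wΨQ) wΨc⟩
  obtain ⟨cP, ΨP', MP, DP, P', a', N', g1, g2, g3, g4, ρ, g5, g6, g7, g8⟩ :=
    m1.matched I1 y (by simp) (fresh_comp yΨ yΨQ) yP (Substn.update_same ..)
  -- Q is lifted after P, so that its constraint can be asked to avoid `cP`; this makes `cP` and
  -- `cQ` disjoint.
  have I2 : IsInstance psi (psi.comp (subst ΨP σ) Ψc) (Q.subst σ)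
      (B ∪ {y, z, x} ∪ nsupp K ∪ bP.toFinset ∪ cP.toFinset) Q (σ.update z K) (psi.comp Ψ ΨP) Ψ₀
      bQ ΨQ := by
    refine ⟨wQ, PreAgent.subst_update zQ, ?_, hQ, ?_, ?_⟩
    · rw [subst_update_of_fresh (fresh_comp zΨ zΨP)]
      simp only [psi.comp_subst, cls_comp, env]
      ac_rfl
    · intro e he
      have h1 := hbQ e he
      have h2 : e ∉ nsupp K := fun h => mem_nsupp.1 h (hK e he)
      have h3 : e ∉ bP := fun h => hd h he
      have h4 : e ≠ y := fun h => ybQ (h ▸ he)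
      have h5 : e ≠ z := fun h => zbQ (h ▸ he)
      have h6 : e ≠ x := fun h => xbQ (h ▸ he)
      have h7 : e ∉ cP := fun h => g3.notMem e h (by simp [he])
      simp_all
    · intro w hw
      simp only [Finset.mem_union, Finset.mem_insert, Finset.mem_singleton, List.mem_toFinset,
        not_or, mem_nsupp, not_occurs] at hw
      obtain ⟨⟨⟨⟨wB, wy, wz, wx⟩, wK⟩, wbP⟩, wcP⟩ := hw
      obtain ⟨wP, wQ, wσ, wΨ, wΨ₀, wΨc⟩ := hB w wB
      have wΨP := hP.fresh wP wbP
      exact ⟨wQ, wσ.update wz wK, fresh_comp wΨ wΨP, wΨ₀, fresh_comp (fresh_subst wσ wΨP) wΨc⟩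
  obtain ⟨cQ, ΨQ', MQ, DQ, Q', k1, k2, k3, k4⟩ :=
    m2.matched I2 z (by simp) x (by simp) (fresh_comp zΨ zΨP) zQ xQ hzx (Substn.update_same ..)
  have ycP : y ∉ cP := fun h => g3.notMem y h (by simp)
  have zcP : z ∉ cP := fun h => g3.notMem z h (by simp)
  have ycQ : y ∉ cQ := fun h => k3.notMem y h (by simp)
  have zcQ : z ∉ cQ := fun h => k3.notMem z h (by simp)
  have cPB : ∀ e ∈ cP, e ∉ B := fun e he h => g3.notMem e he (by simp [h])
  have cQB : ∀ e ∈ cQ, e ∉ B := fun e he h => k3.notMem e he (by simp [h])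
  have hcc : List.Disjoint cP cQ := fun e he he' => k3.notMem e he' (by simp [he])
  have a'B : ∀ e ∈ a', e ∉ B := fun e he h => g4 e he (by simp [h])
  have ya' : y ∉ a' := fun h => g4 y h (by simp)
  have za' : z ∉ a' := fun h => g4 z h (by simp)
  have yMP := g3.fresh y yP ycP
  have zMQ := k3.fresh z zQ zcQ
  obtain ⟨yN', yP'⟩ := (g1.fresh yP).resolve_left ya'
  have zN' := ((g1.fresh zP).resolve_left za').1
  have zQ' := ((k1.fresh zQ).resolve_left (by simpa [Action.bn] using hzx)).2
  obtain ⟨s1, s2, s3⟩ := g1.sat_of_update rfl (fresh_comp yΨ yΨQ) yP yσ g2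
  obtain ⟨r1, r2, r3⟩ := k1.sat_of_update rfl (fresh_comp zΨ zΨP) zQ zσ k2
  -- The new bound names of the output avoid `B`, so `ρ` can be chosen to fix the remaining names of
  -- both instances. This is needed to rename the combined derivative.
  obtain ⟨ρ, g5, g6, e1, e2⟩ := exists_perm_extend t1.bn_nodup g5 g6
    (nsupp (P.subst σ) ∪ nsupp (Q.subst σ)) fun e he _ he' => by
      obtain ⟨wP, wQ, wσ, -⟩ := hB e (a'B e he')
      simp only [Finset.mem_union, mem_nsupp] at he
      exact he.elim (fun h => h (PreAgent.fresh_subst wσ wP))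
        fun h => h (PreAgent.fresh_subst wσ wQ)
  refine ⟨y, z, cP, cQ, ΨP', ΨQ', MP, MQ, DP, DQ, a', N', x, P', Q', ⟨hP, hQ, g3.sub, k3.sub, hcc,
    fun e he => (hB e (hbP e he)).1, fun e he => (hB e (hbQ e he)).2.1,
    ⟨fun e he => (hB e (cPB e he)).2.2.2.1, fun e he => (hB e (cPB e he)).2.1, fun e he =>
      k3.fresh e (hB e (cPB e he)).2.1 fun h => hcc he h⟩,
    ⟨fun e he => (hB e (cQB e he)).2.2.2.1, fun e he => (hB e (cQB e he)).1, fun e he =>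
      g3.fresh e (hB e (cQB e he)).1 fun h => hcc h he⟩, hyz, ?_, ?_, ?_⟩, g1, k1,
    fun e he => (hB e (a'B e he)).2.1, ya', za', yN', zN', ⟨?_, ?_, s3, r3⟩, ρ, g5,
    fun e he he' => g6 e he (Or.inr (Or.inr (by simpa using he'))),
    fun e he => (hB e (a'B e he)).2.2.1, ?_, ?_⟩
  · intro w hw
    simp only [List.mem_cons, List.not_mem_nil, or_false] at hw
    rcases hw with rfl | rfl
    · exact ⟨yΨ, yP, yQ, ycP, ycQ, yMP, k3.fresh _ yQ ycQ⟩
    · exact ⟨zΨ, zP, zQ, zcP, zcQ, g3.fresh _ zP zcP, zMQ⟩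
  · have := g3.env
    rw [stablyEquivalent_iff] at this ⊢
    intro τ
    rw [this τ]
    simp only [psi.comp_subst, cls_comp]
    ac_rfl
  · exact k3.env
  · rintro e (he | he)
    · exact ⟨s1 e he, s2 e he⟩
    · exact ⟨r1 e he, r2 e he⟩
  -- The two lifted subject constraints connect the instance of `MP` with `M` and that of `MQ` with
  -- `K`. With `hMK` between them, symmetry and transitivity give the channel condition of the
  -- symbolic communication.
  · have c1 := (g2 _ (List.mem_cons_self ..)).2.2
    have c2 := (k2 _ (List.mem_cons_self ..)).2.2
    rw [psi.chan_subst, TermType.var_subst, Substn.update_same] at c1 c2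
    rw [subst_term_update yMP] at c1
    rw [subst_term_update zMQ] at c2
    have d1 := entails_of_cls (Ψ' := psi.comp (psi.comp Ψc (subst ΨP σ)) (subst ΨQ σ)) (by
      rw [cls_comp, stablyEquivalent_iff.1 g3.env,
        subst_update_of_fresh (fresh_comp (fresh_comp yΨ yΨQ) yΨP)]
      simp only [psi.comp_subst, cls_comp, env]
      ac_rfl) c1
    have d2 := entails_of_cls (Ψ' := psi.comp (psi.comp Ψc (subst ΨP σ)) (subst ΨQ σ)) (by
      rw [cls_comp, stablyEquivalent_iff.1 k3.env,
        subst_update_of_fresh (fresh_comp (fresh_comp zΨ zΨP) zΨQ)]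
      simp only [psi.comp_subst, cls_comp, env]
      ac_rfl) c2
    rw [psi.chan_subst]
    exact psi.chan_trans _ _ _ _ d1 (psi.chan_trans _ _ _ _ hMK (psi.chan_symm _ _ _ d2))
  · rw [e2, ← g8, PreAgent.subst_update yP']
  · rw [subst_term_update yN', ← e1] at g7
    rw [PreAgent.subst_single_subst_eq, g7, PreAgent.smul_subst_single,
      PreAgent.smul_subst_single_of_fix, ← k4]
    · refine PreAgent.subst_congr fun e he => ?_
      by_cases h : e = x
      · subst h; simp
      · rw [Substn.update_of_ne _ _ h, Substn.update_of_ne _ _ h,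
          Substn.update_of_ne _ _ fun e' : e = z => he (e' ▸ zQ')]
    -- Apart from the input variable, names of the receiver's derivative occur in the instance of Q.
    -- They are not bound by the output, because `a` is fresh for that instance, so `ρ` fixes them.
    · intro e hex he
      have : Occurs e (Q.subst σ) := fun h =>
        he ((t2.fresh h).resolve_left (by simpa [Action.bn] using hex)).2
      exact g6 e (fun h => this (ha e h)) (Or.inr (Or.inr (by simp [this])))

end Matchable
end Psi

/-! ### Lifting prefixes, case, replication and restriction -/

namespace Psi

open NamedTerms (var)
open HasSubst (subst)

section Transitions

variable {T C A : Type u} [TermType T] [DataType T C] [DataType T A] {psi : PsiCalculus T C A}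
  {Ψc Ψ Ψ₀ Φ : A} {R R' P : PreAgent T C A} {α : Action T T} {B : Finset Name}
  {σ : Substn T} {b : List Name}

namespace IsInstance

theorem matched_input {M K : T} {x : Name} (hI : IsInstance psi Ψc (.input M x R) B P σ Ψ Ψ₀ b Φ)
    (h : psi.entails Ψc (psi.chan M K)) :
    (Action.inp K x).Matched psi B b Φ Ψ Ψ₀ σ P R := by
  obtain ⟨M', x', P', rfl⟩ := PreAgent.exists_input_of_tag (P := P) (by
    rw [← PreAgent.tag_subst (σ := σ), hI.eq, PreAgent.tag_input])
  obtain ⟨rfl, rfl⟩ := hI.frame.nil_of_tag (by simp)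
  obtain ⟨w, -, hwσ, -, hwP⟩ := PreAgent.exists_binder σ σ ∅ P'
  have e := hI.eq
  rw [PreAgent.subst_input hwσ (Or.inr hwP)] at e
  obtain ⟨rfl, rfl, hx⟩ := PreAgent.input_inj e
  refine .input (entails_of_cls hI.env h) fun L => ?_
  -- The concrete binder and the binder `w` used for the instance of P differ by a swap, which
  -- disappears after substitution.
  have e1 := PreAgent.smul_subst_single_of_fix (π := Equiv.swap w x) (z := w) (L := L)
    (P := P'.subst (σ.update x' (var w))) fun a haw ha => by
      refine Equiv.swap_apply_of_ne_of_ne haw fun e => ?_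
      rcases hx with h | h
      · exact haw (e.trans h.symm)
      · exact ha (e ▸ h)
  rw [Equiv.swap_apply_left] at e1
  rw [e1, PreAgent.subst_update_single hwσ hwP]

theorem matched_output {M K N : T} (hI : IsInstance psi Ψc (.output M N R) B P σ Ψ Ψ₀ b Φ)
    (h : psi.entails Ψc (psi.chan M K)) :
    (Action.out K [] N).Matched psi B b Φ Ψ Ψ₀ σ P R := by
  obtain ⟨M', N', P', rfl, rfl, rfl, rfl⟩ := PreAgent.subst_eq_output hI.eq
  obtain ⟨rfl, rfl⟩ := hI.frame.nil_of_tag (by simp)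
  exact .output (entails_of_cls hI.env h)

theorem matched_case {n : ℕ} {φ : Fin n → C} {R : Fin n → PreAgent T C A} {i : Fin n}
    (hI : IsInstance psi Ψc (.case φ R) B P σ Ψ Ψ₀ b Φ) (h : Matchable psi Ψc (R i) α R')
    (hφ : psi.entails Ψc (φ i)) : α.Matched psi B b Φ Ψ Ψ₀ σ P R' := by
  obtain ⟨φ', P', rfl, h1, h2⟩ := PreAgent.subst_eq_case hI.eq
  obtain ⟨rfl, rfl⟩ := hI.frame.nil_of_tag (by simp)
  -- The premise is matched relative to a frame of the branch, while the case agent has the unit as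
  -- its frame. The former is trivial under every substitution because the branch has no other
  -- unguarded assertions.
  obtain ⟨b', Φ', hf, hb'⟩ := exists_isFrame psi (P' i) B
  have hw := wellFormed_case.1 hI.wellFormed i
  refine .case (i := i) (h.matched (b := b') (Φ := Φ') ⟨hw.1, h2 i, hI.env, hf, hb', fun w hw => ?_⟩)
    (fun τ => hf.cls_subst_of_unguarded hw.2 τ) (entails_of_cls hI.env (h1 i ▸ hφ))
  have := hI.fresh w hw
  exact ⟨(PreAgent.fresh_case.1 this.1 i).2, this.2⟩

theorem matched_rep (hI : IsInstance psi Ψc (.rep R) B P σ Ψ Ψ₀ b Φ)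
    (h : Matchable psi Ψc (.par R (.rep R)) α R') : α.Matched psi B b Φ Ψ Ψ₀ σ P R' := by
  obtain ⟨P', rfl, rfl⟩ := PreAgent.subst_eq_rep hI.eq
  obtain ⟨rfl, rfl⟩ := hI.frame.nil_of_tag (by simp)
  obtain ⟨b', Φ', hf, hb'⟩ := exists_isFrame psi (.par P' (.rep P')) B
  have hw := wellFormed_rep.1 hI.wellFormed
  refine .rep (h.matched (b := b') (Φ := Φ') ⟨wellFormed_par.2 ⟨hw.1, hI.wellFormed⟩, ?_, hI.env,
    hf, hb', fun w hw => ?_⟩) fun τ => ?_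
  · rw [PreAgent.subst_par, PreAgent.subst_rep]
  · have := hI.fresh w hw
    exact ⟨PreAgent.fresh_par.2 ⟨PreAgent.fresh_rep.1 this.1, this.1⟩, this.2⟩
  -- The unfolded replication has a trivial frame: P has no unguarded assertions and the replication
  -- contributes the unit.
  · obtain ⟨bP, bQ, ΨP, ΨQ, -, rfl, h1, h2, -⟩ := hf.par_inv
    obtain ⟨-, rfl⟩ := h2.nil_of_tag (by simp)
    rw [psi.comp_subst, cls_comp, h1.cls_subst_of_unguarded (hw.2.mono fun _ h => h.elim),
      psi.unit_subst, cls_unit, one_mul]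

/-- The prescribed frame begins with the binder to be used for P. The concrete binder `c` is brought
to it by a swap, which leaves the environment equal, as both names are fresh there. -/
theorem res_inv {c : Name} (hI : IsInstance psi Ψc (.res c R) B P σ Ψ Ψ₀ b Φ) (hc : Fresh c Ψc) :
    ∃ a P' b', b = a :: b' ∧ P = .res a P' ∧ a ∉ B ∧ (c = a ∨ Fresh a R) ∧
      IsInstance psi (Equiv.swap c a • Ψc) (Equiv.swap c a • R) (insert a B) P' σ Ψ Ψ₀ b' Φ := by
  obtain ⟨a₁, P₁, rfl⟩ := PreAgent.exists_res_of_tag (P := P) (by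
    rw [← PreAgent.tag_subst (σ := σ), hI.eq, PreAgent.tag_res])
  obtain ⟨a, P', b', rfl, e, hf, hab⟩ := hI.frame.res_inv
  rw [e] at hI ⊢
  have ha : a ∉ B := hI.notMem a (by simp)
  obtain ⟨-, haσ, haΨ, haΨ₀, haΨc⟩ := hI.fresh a ha
  have e := hI.eq
  rw [PreAgent.subst_res_of_fresh haσ] at e
  obtain ⟨e1, e2⟩ := PreAgent.res_inj e.symm
  refine ⟨a, P', b', rfl, rfl, ha, e2, wellFormed_res.1 hI.wellFormed, e1, ?_, hf, ?_, ?_⟩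
  · rw [swap_smul_of_fresh hc haΨc]; exact hI.env
  · intro w hw h
    rcases Finset.mem_insert.1 h with rfl | h
    · exact hab hw
    · exact hI.notMem w (by simp [hw]) h
  · intro w hw
    simp only [Finset.mem_insert, not_or] at hw
    have := hI.fresh w hw.2
    rw [swap_smul_of_fresh hc haΨc]
    exact ⟨(PreAgent.fresh_res.1 this.1).resolve_left hw.1, this.2⟩

theorem matched_scope {c : Name} (hI : IsInstance psi Ψc (.res c R) B P σ Ψ Ψ₀ b Φ)
    (hT : Trans psi Ψc R α R') (h : Matchable psi Ψc R α R') (hα : α.Fresh c) (hc : Fresh c Ψc) :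
    α.Matched psi B b Φ Ψ Ψ₀ σ P (.res c R') := by
  obtain ⟨a, P', b', rfl, rfl, ha, hac, hI'⟩ := hI.res_inv hc
  obtain ⟨-, haσ, haΨ, haΨ₀, haΨc⟩ := hI.fresh a ha
  have hα' : (Equiv.swap c a • α).Fresh a := by
    simpa using Action.fresh_smul (π := Equiv.swap c a) hα
  have := (h _ _ _ _ _ _ _ _ hI').scope ha
    (by rw [Action.bn_smul]; exact hT.bn_nodup.map (Equiv.injective _)) hα' haσ haΨ haΨ₀
  -- Undoing the swap requires that it fixes the subject. Scope makes `c` fresh for it; `a` is fresh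
  -- because the subject is the value of a name in `B`, and `a` lies outside `B` and is fresh for
  -- `σ`.
  refine .of_subj_fresh (fun w hw => (hI.fresh w hw).2.1) fun hKB => ?_
  refine .of_smul (π := Equiv.swap c a) ?_ ?_
    (by simpa using this)
  · intro e he he'
    have hec : e ≠ c := by
      rintro rfl
      rcases he' with h | h
      · cases α with
        | out K l N => exact h hα.2.2
        | _ => exact h trivial
      · exact h (by simp)
    refine Equiv.swap_apply_of_ne_of_ne hec ?_
    rintro rfl
    obtain ⟨h1, h2⟩ := (hT.fresh (hac.resolve_left (Ne.symm hec))).resolve_left he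
    exact he'.elim (fun h => h h1) fun h => h (PreAgent.fresh_res.2 (Or.inr h2))
  · intro K hK
    refine swap_smul_of_fresh ?_ (hKB K hK a ha)
    cases α with
    | tau => simp [Action.subj] at hK
    | inp _ _ => obtain rfl : _ = _ := Option.some.inj hK; exact hα.1
    | out _ _ _ => obtain rfl : _ = _ := Option.some.inj hK; exact hα.1

theorem matched_openRes {c : Name} {K N : T} {a₁ a₂ : List Name}
    (hI : IsInstance psi Ψc (.res c R) B P σ Ψ Ψ₀ b Φ)
    (hT : Trans psi Ψc R (.out K (a₁ ++ a₂) N) R')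
    (h : Matchable psi Ψc R (.out K (a₁ ++ a₂) N) R') (hca : c ∉ a₁ ++ a₂) (hc : Fresh c Ψc)
    (hcK : Fresh c K) (hcN : Occurs c N) :
    (Action.out K (a₁ ++ c :: a₂) N).Matched psi B b Φ Ψ Ψ₀ σ P R' := by
  obtain ⟨a, P', b', rfl, rfl, ha, hac, hI'⟩ := hI.res_inv hc
  obtain ⟨-, haσ, haΨ, haΨ₀, haΨc⟩ := hI.fresh a ha
  have h' := h _ _ _ _ _ _ _ _ hI'
  rw [Action.smul_out, List.map_append] at h'
  -- After the swap the concrete bound name is `a`, so the symbolic Open rule applies; the swap is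
  -- undone as a conversion of the action's bound names.
  have := h'.openRes ha ?_ ?_ haσ haΨ haΨ₀
  · refine .of_subj_fresh (fun w hw => (hI.fresh w hw).2.1) fun hKB => ?_
    refine .of_smul (π := Equiv.swap c a) ?_ ?_
      (by simpa using this)
    · intro e he he'
      simp only [Action.bn, List.mem_append, List.mem_cons, not_or] at he
      refine Equiv.swap_apply_of_ne_of_ne he.2.1 ?_
      rintro rfl
      obtain ⟨h1, h2⟩ := (hT.fresh (hac.resolve_left (Ne.symm he.2.1))).resolve_left
        (by simp [Action.bn, he])
      exact he'.elim (fun h => h h1) fun h => h h2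
    · intro L hL
      obtain rfl : _ = _ := Option.some.inj hL
      exact swap_smul_of_fresh hcK (hKB K rfl a ha)
  · intro h
    rw [← List.map_append] at h
    obtain ⟨d, hd, hda⟩ := List.mem_map.1 h
    refine hca ?_
    rwa [← (Equiv.swap c a).injective (hda.trans (Equiv.swap_apply_left c a).symm)]
  · have := (occurs_smul_iff (Equiv.swap c a) c N).2 hcN
    rwa [Equiv.swap_apply_left] at this

end IsInstance

end Transitions
end Psi

/-! ### Lifting parallel composition and communication -/

namespace Psi

open NamedTerms (var)
open HasSubst (subst)

section Transitions

variable {T C A : Type u} [TermType T] [DataType T C] [DataType T A] {psi : PsiCalculus T C A}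
  {Ψc Ψ Ψ₀ Φ : A} {R R' P : PreAgent T C A} {α : Action T T} {B : Finset Name}
  {σ : Substn T} {b : List Name}

namespace IsInstance

theorem par_inv {S : PreAgent T C A} (hI : IsInstance psi Ψc (.par R S) B P σ Ψ Ψ₀ b Φ) :
    ∃ P' Q bP bQ ΨP ΨQ, P = .par P' Q ∧ P'.subst σ = R ∧ Q.subst σ = S ∧ b = bP ++ bQ ∧
      Φ = psi.comp ΨP ΨQ ∧ P'.WellFormed psi ∧ Q.WellFormed psi ∧ IsFrame psi P' bP ΨP ∧
      IsFrame psi Q bQ ΨQ ∧ List.Disjoint bP bQ ∧ (∀ e ∈ bP, e ∉ B) ∧ (∀ e ∈ bQ, e ∉ B) ∧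
      ∀ w, w ∉ B → Fresh w P' ∧ Fresh w Q ∧ σ.Fresh w ∧ Fresh w Ψ ∧ Fresh w Ψ₀ ∧ Fresh w Ψc := by
  obtain ⟨P', Q, rfl, h1, h2⟩ := PreAgent.subst_eq_par hI.eq
  obtain ⟨bP, bQ, ΨP, ΨQ, rfl, rfl, hP, hQ, hd, -⟩ := hI.frame.par_inv
  have hw := wellFormed_par.1 hI.wellFormed
  refine ⟨P', Q, bP, bQ, ΨP, ΨQ, rfl, h1, h2, rfl, rfl, hw.1, hw.2, hP, hQ, hd,
    fun e he => hI.notMem e (by simp [he]), fun e he => hI.notMem e (by simp [he]), fun w hw => ?_⟩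
  have := hI.fresh w hw
  rw [PreAgent.fresh_par] at this
  exact ⟨this.1.1, this.1.2, this.2⟩

/-- The premise of a parallel rule is matched, with the frame of the inactive component renamed. -/
theorem matched_par_premise {Q : PreAgent T C A} {c bP bQ : List Name} {Ψc' ΨP ΨQ : A}
    (wP : P.WellFormed psi) (hP : IsFrame psi P bP ΨP) (hQ : IsFrame psi Q bQ ΨQ)
    (hd : List.Disjoint bP bQ) (hbP : ∀ e ∈ bP, e ∉ B) (hbQ : ∀ e ∈ bQ, e ∉ B)
    (hB : ∀ w, w ∉ B →
      Fresh w P ∧ Fresh w Q ∧ σ.Fresh w ∧ Fresh w Ψ ∧ Fresh w Ψ₀ ∧ Fresh w Ψc)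
    (env : cls psi Ψc = cls psi (psi.comp (subst Ψ σ) Ψ₀))
    (hF : IsFrame psi (Q.subst σ) c Ψc') (hcΨ : FreshAll c Ψc) (hcP : FreshAll c (P.subst σ))
    (hα : ∀ e ∈ c, α.Fresh e) (hT : Trans psi (psi.comp Ψc' Ψc) (P.subst σ) α R')
    (h : Matchable psi (psi.comp Ψc' Ψc) (P.subst σ) α R')
    (hαB : ∀ K ∈ α.subj, ∀ w, w ∉ B → Fresh w K) :
    α.Matched psi (B ∪ bQ.toFinset) bP ΨP (psi.comp Ψ ΨQ) Ψ₀ σ P R' := by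
  classical
  obtain ⟨π, -, e1, hπ⟩ := hF.exists_perm (hQ.subst fun e he => (hB e (hbQ e he)).2.2.1)
    (nsupp (P.subst σ) ∪ nsupp Ψc ∪ α.supp)
  simp only [Finset.mem_union, mem_nsupp] at hπ
  have fP : ∀ e, Occurs e (P.subst σ) → π e = e := fun e he => hπ e (Or.inl (Or.inl he))
    (fun h => he (hcP e h)) fun h => he (PreAgent.fresh_subst (hB e (hbQ e h)).2.2.1
      (hB e (hbQ e h)).1)
  have fΨ : π • Ψc = Ψc := smul_eq_of_fix fun e he => hπ e (Or.inl (Or.inr he))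
    (fun h => he (hcΨ e h)) fun h => he (hB e (hbQ e h)).2.2.2.2.2
  have key : IsInstance psi (π • psi.comp Ψc' Ψc) (π • P.subst σ) (B ∪ bQ.toFinset) P σ
      (psi.comp Ψ ΨQ) Ψ₀ bP ΨP := by
    rw [psi.smul_comp, e1, fΨ, smul_eq_of_fix fP]
    refine ⟨wP, rfl, ?_, hP, ?_, ?_⟩
    · simp only [psi.comp_subst, cls_comp, env]
      ac_rfl
    · intro e he
      have h1 := hbP e he
      have h2 : e ∉ bQ := fun h => hd he h
      simp [h1, h2]
    · intro w hw
      simp only [Finset.mem_union, List.mem_toFinset, not_or] at hw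
      obtain ⟨wP, wQ, wσ, wΨ, wΨ₀, wΨc⟩ := hB w hw.1
      have wΨQ := hQ.fresh wQ hw.2
      exact ⟨wP, wσ, fresh_comp wΨ wΨQ, wΨ₀, fresh_comp (fresh_subst wσ wΨQ) wΨc⟩
  refine .of_smul (π := π) ?_ ?_ (h _ _ _ _ _ _ _ _ key)
  -- Names of the action's object and of the derivative that are not bound come from the instance of
  -- P, where `π` is the identity.
  · intro e he he'
    refine fP e fun h' => ?_
    obtain ⟨h1, h2⟩ := (hT.fresh h').resolve_left he
    exact he'.elim (fun h => h h1) fun h => h h2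
  · intro K hK
    have hKα : ∀ e, Occurs e K → e ∈ α.supp := by
      intro e he
      cases α with
      | tau => simp [Action.subj] at hK
      | inp _ _ => obtain rfl : _ = _ := Option.some.inj hK; simp [Action.supp, he]
      | out _ _ _ => obtain rfl : _ = _ := Option.some.inj hK; simp [Action.supp, he]
    exact smul_eq_of_fix fun e he => hπ e (Or.inr (hKα e he))
      (fun h => Action.fresh_iff.1 (hα e h) (hKα e he)) fun h => he (hαB K hK e (hbQ e h))

theorem matched_par_left {S : PreAgent T C A} {c : List Name} {Ψc' : A}
    (hI : IsInstance psi Ψc (.par R S) B P σ Ψ Ψ₀ b Φ) (hF : IsFrame psi S c Ψc')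
    (hcΨ : FreshAll c Ψc) (hcR : FreshAll c R) (hα : ∀ e ∈ c, α.Fresh e)
    (hT : Trans psi (psi.comp Ψc' Ψc) R α R') (h : Matchable psi (psi.comp Ψc' Ψc) R α R')
    (hbn : FreshAll α.bn S) : α.Matched psi B b Φ Ψ Ψ₀ σ P (.par R' S) := by
  obtain ⟨P, Q, bP, bQ, ΨP, ΨQ, rfl, rfl, rfl, rfl, rfl, wP, wQ, hP, hQ, hd, hbP, hbQ, hB⟩ :=
    hI.par_inv
  refine .of_subj_fresh (fun w hw => (hB w hw).2.2.1) fun hαB => ?_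
  refine Action.Matched.par_left (matched_par_premise wP hP hQ hd hbP hbQ hB hI.env hF hcΨ hcR
    hα hT h hαB) hQ hbQ (fun w hw => ?_) hT.bn_nodup hbn
  obtain ⟨h1, h2, h3, h4, h5, -⟩ := hB w hw
  exact ⟨h1, h2, h3, h4, h5⟩

theorem matched_par_right {S : PreAgent T C A} {c : List Name} {Ψc' : A}
    (hI : IsInstance psi Ψc (.par S R) B P σ Ψ Ψ₀ b Φ) (hF : IsFrame psi S c Ψc')
    (hcΨ : FreshAll c Ψc) (hcR : FreshAll c R) (hα : ∀ e ∈ c, α.Fresh e)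
    (hT : Trans psi (psi.comp Ψc' Ψc) R α R') (h : Matchable psi (psi.comp Ψc' Ψc) R α R')
    (hbn : FreshAll α.bn S) : α.Matched psi B b Φ Ψ Ψ₀ σ P (.par S R') := by
  obtain ⟨Q, P, bQ, bP, ΨQ, ΨP, rfl, rfl, rfl, rfl, rfl, wQ, wP, hQ, hP, hd, hbQ, hbP, hB⟩ :=
    hI.par_inv
  have hB : ∀ w, w ∉ B → Fresh w P ∧ Fresh w Q ∧ σ.Fresh w ∧ Fresh w Ψ ∧ Fresh w Ψ₀ ∧ Fresh w Ψc :=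
    fun w hw => ⟨(hB w hw).2.1, (hB w hw).1, (hB w hw).2.2⟩
  refine .of_subj_fresh (fun w hw => (hB w hw).2.2.1) fun hαB => ?_
  refine Action.Matched.par_right (matched_par_premise wP hP hQ hd.symm hbP hbQ hB hI.env hF hcΨ hcR
    hα hT h hαB) hQ hbQ (fun w hw => ?_) hT.bn_nodup hbn
  obtain ⟨h1, h2, h3, h4, h5, -⟩ := hB w hw
  exact ⟨h1, h2, h3, h4, h5⟩

/-- Uniqueness of frames is used only for the lengths of the lists. One permutation then converts
both concrete lists at once, and it can fix all other relevant names because both old and new frame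
names are fresh for the environment and both instances. -/
theorem exists_perm_frames {Q : PreAgent T C A} {bP bQ bPc bQc : List Name}
    {ΨP ΨQ ΨPc ΨQc : A} (hFP : IsFrame psi (P.subst σ) bPc ΨPc)
    (hFQ : IsFrame psi (Q.subst σ) bQc ΨQc) (hdc : List.Disjoint bPc bQc)
    (hP : IsFrame psi P bP ΨP) (hQ : IsFrame psi Q bQ ΨQ) (hd : List.Disjoint bP bQ)
    (hbP : ∀ e ∈ bP, e ∉ B) (hbQ : ∀ e ∈ bQ, e ∉ B)
    (hB : ∀ w, w ∉ B →
      Fresh w P ∧ Fresh w Q ∧ σ.Fresh w ∧ Fresh w Ψ ∧ Fresh w Ψ₀ ∧ Fresh w Ψc)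
    (hPΨ : FreshAll bPc Ψc) (hPQ : FreshAll bPc (Q.subst σ)) (hPP : FreshAll bPc (P.subst σ))
    (hQΨ : FreshAll bQc Ψc) (hQP : FreshAll bQc (P.subst σ)) (hQQ : FreshAll bQc (Q.subst σ)) :
    ∃ π : NPerm, bPc.map π = bP ∧ bQc.map π = bQ ∧ π • Ψc = Ψc ∧
      (∀ e, Occurs e (P.subst σ) → π e = e) ∧ ∀ e, Occurs e (Q.subst σ) → π e = e := by
  classical
  have pP := fun e he => (hB e (hbP e he))
  have pQ := fun e he => (hB e (hbQ e he))
  obtain ⟨π₁, h1, -⟩ := hFP.exists_perm (hP.subst fun e he => (pP e he).2.2.1) ∅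
  obtain ⟨π₂, h2, -⟩ := hFQ.exists_perm (hQ.subst fun e he => (pQ e he).2.2.1) ∅
  have l1 : bPc.length = bP.length := by simp [← h1]
  have l2 : bQc.length = bQ.length := by simp [← h2]
  obtain ⟨π, e, hπ⟩ := exists_perm_map_eq_fix (hFP.nodup.append hFQ.nodup hdc)
    (hP.nodup.append hQ.nodup hd) (by simp [l1, l2])
    (nsupp Ψc ∪ nsupp (P.subst σ) ∪ nsupp (Q.subst σ)) fun e he _ he' => by
      obtain ⟨wP, wQ, wσ, -, -, wΨc⟩ := (List.mem_append.1 he').elim (pP e) (pQ e)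
      simp only [Finset.mem_union, mem_nsupp] at he
      rcases he with (he | he) | he
      · exact he wΨc
      · exact he (PreAgent.fresh_subst wσ wP)
      · exact he (PreAgent.fresh_subst wσ wQ)
  rw [List.map_append] at e
  obtain ⟨e1, e2⟩ := List.append_inj e (by simp [l1])
  simp only [Finset.mem_union, mem_nsupp, List.mem_append] at hπ
  refine ⟨π, e1, e2, smul_eq_of_fix fun e he => hπ e (by simp [he]) fun h => ?_,
    fun e he => hπ e (by simp [he]) fun h => ?_, fun e he => hπ e (by simp [he]) fun h => ?_⟩
  · exact he (h.elim (hPΨ e) (hQΨ e))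
  · exact he (h.elim (hPP e) (hQP e))
  · exact he (h.elim (hPQ e) (hQQ e))

theorem matched_com_left {S S' : PreAgent T C A} {bPc bQc a : List Name} {ΨPc ΨQc : A} {M K N : T}
    {x : Name} (hI : IsInstance psi Ψc (.par R S) B P σ Ψ Ψ₀ b Φ)
    (hFP : IsFrame psi R bPc ΨPc) (hFQ : IsFrame psi S bQc ΨQc) (hdc : List.Disjoint bPc bQc)
    (hPΨ : FreshAll bPc Ψc) (hPS : FreshAll bPc S) (hPM : FreshAll bPc M) (hPR : FreshAll bPc R)
    (hQΨ : FreshAll bQc Ψc) (hQR : FreshAll bQc R) (hQK : FreshAll bQc K) (hQS : FreshAll bQc S)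
    (t1 : Trans psi (psi.comp ΨQc Ψc) R (.out M a N) R')
    (t2 : Trans psi (psi.comp ΨPc Ψc) S (.inp K x) S')
    (hMK : psi.entails (psi.comp (psi.comp Ψc ΨPc) ΨQc) (psi.chan M K)) (ha : FreshAll a S)
    (m1 : Matchable psi (psi.comp ΨQc Ψc) R (.out M a N) R')
    (m2 : Matchable psi (psi.comp ΨPc Ψc) S (.inp K x) S') :
    Action.tau.Matched psi B b Φ Ψ Ψ₀ σ P (.resList a (.par R' (S'.subst (.single x N)))) := by
  classical
  have hT : Trans psi Ψc (.par R S) .tau (.resList a (.par R' (S'.subst (.single x N)))) :=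
    .com_left hFP hFQ hdc hPΨ hPS hPM hPR hQΨ hQR hQK hQS t1 t2 hMK ha
  obtain ⟨P, Q, bP, bQ, ΨP, ΨQ, rfl, rfl, rfl, rfl, rfl, wP, wQ, hP, hQ, hd, hbP, hbQ, hB⟩ :=
    hI.par_inv
  obtain ⟨π, eP, eQ, fΨ, fP, fQ⟩ := exists_perm_frames hFP hFQ hdc hP hQ hd hbP hbQ hB hPΨ hPS hPR hQΨ
    hQR hQS
  have pP := fun e he => (hB e (hbP e he))
  have pQ := fun e he => (hB e (hbQ e he))
  have eΨP := hFP.smul_eq (hP.subst fun e he => (pP e he).2.2.1)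
    (fun e he => PreAgent.fresh_subst (pP e he).2.2.1 (pP e he).1) eP fP
  have eΨQ := hFQ.smul_eq (hQ.subst fun e he => (pQ e he).2.2.1)
    (fun e he => PreAgent.fresh_subst (pQ e he).2.2.1 (pQ e he).2.1) eQ fQ
  have uP := smul_eq_of_fix fP
  have uQ := smul_eq_of_fix fQ
  have t1 := t1.smul π
  have t2 := t2.smul π
  have m1 := m1.smul π
  have m2 := m2.smul π
  have hMK := psi.smul_entails π _ _ hMK
  have hPM := freshAll_smul π hPM
  have hQK := freshAll_smul π hQK
  have ha' := freshAll_smul π ha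
  simp only [psi.smul_comp, psi.smul_chan, eΨP, eΨQ, fΨ, uP, uQ, eP, eQ, Action.smul_out,
    Action.smul_inp] at t1 t2 m1 m2 hMK hPM hQK ha'
  obtain ⟨y, z, cP, cQ, ΨP', ΨQ', MP, MQ, DP, DQ, a', N', x', P', Q', com, g1, g2, g3, g4, g5, g6,
    g7, ⟨s1, s2, s3, s4⟩, ρ, r1, r2, r3, r4, r5⟩ := exists_symTrans_com wP wQ hP hQ hd hbP hbQ hB
    hI.env hPM hQK t1 t2 m1 m2 hMK ha'
  refine ⟨_, _, .com_left com g1 g2 g3 g4 g5 g6 g7, ?_, ?_⟩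
  · intro E hE
    simp only [List.mem_cons, List.mem_append] at hE
    rcases hE with rfl | hE | hE
    · refine ⟨fun e he => (s1 e (by simpa using he)).1,
        fun e he => (s1 e (by simpa using he)).2, ?_⟩
      refine entails_of_cls ?_ s2
      simp only [psi.comp_subst, cls_comp, hI.env]
      ac_rfl
    · exact s3 E hE
    · exact s4 E hE
  · rw [PreAgent.subst_resList_of_fresh r3, PreAgent.subst_par, r4, r5, ← r1,
      ← PreAgent.smul_subst_single]
    -- The derivative of a silent transition has only names of the two instances, all fixed by `π`.
    have e1 : π • PreAgent.resList a (.par R' (S'.subst (.single x N))) = .resList a (.par R' (S'.subst (.single x N))) :=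
      smul_eq_of_fix fun e he => by
        by_cases h : Occurs e (P.subst σ)
        · exact fP e h
        · by_cases h' : Occurs e (Q.subst σ)
          · exact fQ e h'
          · exact absurd (hT.fresh_of_tau (PreAgent.fresh_par.2 ⟨not_occurs.1 h, not_occurs.1 h'⟩)) he
    -- The same holds for `ρ`, outside the renamed bound names. A free name of the derivative is not
    -- one of these: `π` fixes it, so it would lie in `a`, which is restricted.
    have e2 : ρ • PreAgent.resList a (.par R' (S'.subst (.single x N))) = .resList a (.par R' (S'.subst (.single x N))) :=
      smul_eq_of_fix fun e he => by
        have ho : Occurs e (P.subst σ) ∨ Occurs e (Q.subst σ) := by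
          by_contra h
          rw [not_or, not_occurs, not_occurs] at h
          exact he (hT.fresh_of_tau (PreAgent.fresh_par.2 h))
        refine r2 e (fun h => ?_) ho
        obtain ⟨d, hd, hde⟩ := List.mem_map.1 h
        have hπ : π e = e := ho.elim (fP e) (fQ e)
        rw [π.injective (hde.trans hπ.symm)] at hd
        exact he (PreAgent.fresh_resList.2 (Or.inl hd))
    conv_rhs => rw [← e2, ← e1]
    simp

theorem matched_com_right {S S' : PreAgent T C A} {bPc bQc a : List Name} {ΨPc ΨQc : A} {M K N : T}
    {x : Name} (hI : IsInstance psi Ψc (.par R S) B P σ Ψ Ψ₀ b Φ)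
    (hFP : IsFrame psi R bPc ΨPc) (hFQ : IsFrame psi S bQc ΨQc) (hdc : List.Disjoint bPc bQc)
    (hPΨ : FreshAll bPc Ψc) (hPS : FreshAll bPc S) (hPM : FreshAll bPc M) (hPR : FreshAll bPc R)
    (hQΨ : FreshAll bQc Ψc) (hQR : FreshAll bQc R) (hQK : FreshAll bQc K) (hQS : FreshAll bQc S)
    (t1 : Trans psi (psi.comp ΨQc Ψc) R (.inp M x) R')
    (t2 : Trans psi (psi.comp ΨPc Ψc) S (.out K a N) S')
    (hMK : psi.entails (psi.comp (psi.comp Ψc ΨPc) ΨQc) (psi.chan M K)) (ha : FreshAll a R)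
    (m1 : Matchable psi (psi.comp ΨQc Ψc) R (.inp M x) R')
    (m2 : Matchable psi (psi.comp ΨPc Ψc) S (.out K a N) S') :
    Action.tau.Matched psi B b Φ Ψ Ψ₀ σ P (.resList a (.par (R'.subst (.single x N)) S')) := by
  classical
  have hT : Trans psi Ψc (.par R S) .tau (.resList a (.par (R'.subst (.single x N)) S')) :=
    .com_right hFP hFQ hdc hPΨ hPS hPM hPR hQΨ hQR hQK hQS t1 t2 hMK ha
  obtain ⟨P, Q, bP, bQ, ΨP, ΨQ, rfl, rfl, rfl, rfl, rfl, wP, wQ, hP, hQ, hd, hbP, hbQ, hB⟩ :=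
    hI.par_inv
  obtain ⟨π, eP, eQ, fΨ, fP, fQ⟩ := exists_perm_frames hFP hFQ hdc hP hQ hd hbP hbQ hB hPΨ hPS hPR hQΨ
    hQR hQS
  have pP := fun e he => (hB e (hbP e he))
  have pQ := fun e he => (hB e (hbQ e he))
  have eΨP := hFP.smul_eq (hP.subst fun e he => (pP e he).2.2.1)
    (fun e he => PreAgent.fresh_subst (pP e he).2.2.1 (pP e he).1) eP fP
  have eΨQ := hFQ.smul_eq (hQ.subst fun e he => (pQ e he).2.2.1)
    (fun e he => PreAgent.fresh_subst (pQ e he).2.2.1 (pQ e he).2.1) eQ fQ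
  have uP := smul_eq_of_fix fP
  have uQ := smul_eq_of_fix fQ
  have t1 := t1.smul π
  have t2 := t2.smul π
  have m1 := m1.smul π
  have m2 := m2.smul π
  have hMK := psi.smul_entails π _ _ hMK
  have hPM := freshAll_smul π hPM
  have hQK := freshAll_smul π hQK
  have ha' := freshAll_smul π ha
  simp only [psi.smul_comp, psi.smul_chan, eΨP, eΨQ, fΨ, uP, uQ, eP, eQ, Action.smul_out,
    Action.smul_inp] at t1 t2 m1 m2 hMK hPM hQK ha'
  -- The common result lets the first agent send, so it is applied with the two components
  -- exchanged; `ComCondition.symm` restores their order.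
  obtain ⟨z, y, cQ, cP, ΨQ', ΨP', MQ, MP, DQ, DP, a', N', x', Q', P', com, g1, g2, g3, g4, g5, g6,
    g7, ⟨s1, s2, s3, s4⟩, ρ, r1, r2, r3, r4, r5⟩ := exists_symTrans_com wQ wP hQ hP hd.symm hbQ hbP
    (fun w hw => ⟨(hB w hw).2.1, (hB w hw).1, (hB w hw).2.2⟩) hI.env hQK hPM t2 t1 m2 m1
    (entails_of_cls (by simp only [cls_comp]; ac_rfl) (psi.chan_symm _ _ _ hMK)) ha'
  refine ⟨_, _, .com_right com.symm g2 g1 g3 g5 g4 g7 g6, ?_, ?_⟩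
  · intro E hE
    simp only [List.mem_cons, List.mem_append] at hE
    rcases hE with rfl | hE | hE
    · refine ⟨fun e he => (s1 e (by simpa [or_comm] using he)).1,
        fun e he => (s1 e (by simpa [or_comm] using he)).2, ?_⟩
      rw [psi.chan_subst] at s2 ⊢
      refine entails_of_cls ?_ (psi.chan_symm _ _ _ s2)
      simp only [psi.comp_subst, cls_comp, hI.env]
      ac_rfl
    · exact s4 E hE
    · exact s3 E hE
  · rw [PreAgent.subst_resList_of_fresh r3, PreAgent.subst_par, r4, r5, ← r1,
      ← PreAgent.smul_subst_single]
    have e1 : π • PreAgent.resList a (.par (R'.subst (.single x N)) S') = .resList a (.par (R'.subst (.single x N)) S') :=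
      smul_eq_of_fix fun e he => by
        by_cases h : Occurs e (P.subst σ)
        · exact fP e h
        · by_cases h' : Occurs e (Q.subst σ)
          · exact fQ e h'
          · exact absurd (hT.fresh_of_tau (PreAgent.fresh_par.2 ⟨not_occurs.1 h, not_occurs.1 h'⟩)) he
    have e2 : ρ • PreAgent.resList a (.par (R'.subst (.single x N)) S') = .resList a (.par (R'.subst (.single x N)) S') :=
      smul_eq_of_fix fun e he => by
        have ho : Occurs e (P.subst σ) ∨ Occurs e (Q.subst σ) := by
          by_contra h
          rw [not_or, not_occurs, not_occurs] at h
          exact he (hT.fresh_of_tau (PreAgent.fresh_par.2 h))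
        refine r2 e (fun h => ?_) ho.symm
        obtain ⟨d, hd, hde⟩ := List.mem_map.1 h
        have hπ : π e = e := ho.elim (fP e) (fQ e)
        rw [π.injective (hde.trans hπ.symm)] at hd
        exact he (PreAgent.fresh_resList.2 (Or.inl hd))
    conv_rhs => rw [← e2, ← e1]
    simp

end IsInstance

/-- Every concrete transition is matched by a symbolic one. -/
theorem Trans.matchable (h : Trans psi Ψc R α R') : Matchable psi Ψc R α R' := by
  induction h with
  | inp h =>
    intro π B P σ Ψ Ψ₀ b Φ hI
    rw [PreAgent.smul_input] at hI
    exact hI.matched_input (by rw [← psi.smul_chan]; exact psi.smul_entails _ _ _ h)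
  | out h =>
    intro π B P σ Ψ Ψ₀ b Φ hI
    rw [PreAgent.smul_output] at hI
    exact hI.matched_output (by rw [← psi.smul_chan]; exact psi.smul_entails _ _ _ h)
  | case _ h ih =>
    intro π B P σ Ψ Ψ₀ b Φ hI
    rw [PreAgent.smul_case] at hI
    exact hI.matched_case (ih.smul π) (psi.smul_entails _ _ _ h)
  | com_left h1 h2 h3 h4 h5 h6 h7 h8 h9 h10 h11 t1 t2 h12 h13 ih1 ih2 =>
    intro π B P σ Ψ Ψ₀ b Φ hI
    have t1 := t1.smul π
    have t2 := t2.smul π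
    have ih1 := ih1.smul π
    have ih2 := ih2.smul π
    rw [psi.smul_comp] at t1 t2 ih1 ih2
    rw [PreAgent.smul_par] at hI
    rw [PreAgent.smul_resList, PreAgent.smul_par, PreAgent.smul_subst_single]
    refine hI.matched_com_left (h1.smul π) (h2.smul π) (disjoint_map π h3) (freshAll_smul π h4)
      (freshAll_smul π h5) (freshAll_smul π h6) (freshAll_smul π h7) (freshAll_smul π h8)
      (freshAll_smul π h9) (freshAll_smul π h10) (freshAll_smul π h11) t1 t2 ?_
      (freshAll_smul π h13) ih1 ih2
    rw [← psi.smul_comp, ← psi.smul_comp, ← psi.smul_chan]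
    exact psi.smul_entails _ _ _ h12
  | com_right h1 h2 h3 h4 h5 h6 h7 h8 h9 h10 h11 t1 t2 h12 h13 ih1 ih2 =>
    intro π B P σ Ψ Ψ₀ b Φ hI
    have t1 := t1.smul π
    have t2 := t2.smul π
    have ih1 := ih1.smul π
    have ih2 := ih2.smul π
    rw [psi.smul_comp] at t1 t2 ih1 ih2
    rw [PreAgent.smul_par] at hI
    rw [PreAgent.smul_resList, PreAgent.smul_par, PreAgent.smul_subst_single]
    refine hI.matched_com_right (h1.smul π) (h2.smul π) (disjoint_map π h3) (freshAll_smul π h4)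
      (freshAll_smul π h5) (freshAll_smul π h6) (freshAll_smul π h7) (freshAll_smul π h8)
      (freshAll_smul π h9) (freshAll_smul π h10) (freshAll_smul π h11) t1 t2 ?_
      (freshAll_smul π h13) ih1 ih2
    rw [← psi.smul_comp, ← psi.smul_comp, ← psi.smul_chan]
    exact psi.smul_entails _ _ _ h12
  | par_left h1 h2 h3 h4 t h5 ih =>
    intro π B P σ Ψ Ψ₀ b Φ hI
    have t := t.smul π
    have ih := ih.smul π
    rw [psi.smul_comp] at t ih
    rw [PreAgent.smul_par] at hI ⊢
    exact hI.matched_par_left (h1.smul π) (freshAll_smul π h2) (freshAll_smul π h3)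
      (by simpa using fun b hb => Action.fresh_smul (h4 b hb)) t ih
      (by rw [Action.bn_smul]; exact freshAll_smul π h5)
  | par_right h1 h2 h3 h4 t h5 ih =>
    intro π B P σ Ψ Ψ₀ b Φ hI
    have t := t.smul π
    have ih := ih.smul π
    rw [psi.smul_comp] at t ih
    rw [PreAgent.smul_par] at hI ⊢
    exact hI.matched_par_right (h1.smul π) (freshAll_smul π h2) (freshAll_smul π h3)
      (by simpa using fun b hb => Action.fresh_smul (h4 b hb)) t ih
      (by rw [Action.bn_smul]; exact freshAll_smul π h5)
  | scope t h1 h2 ih =>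
    intro π B P σ Ψ Ψ₀ b Φ hI
    rw [PreAgent.smul_res] at hI ⊢
    exact hI.matched_scope (t.smul π) (ih.smul π) (Action.fresh_smul h1) (fresh_smul π h2)
  | openRes t h1 h2 h3 h4 ih =>
    intro π B P σ Ψ Ψ₀ b Φ hI
    have t := t.smul π
    have ih := ih.smul π
    rw [Action.smul_out, List.map_append] at t ih
    rw [PreAgent.smul_res] at hI
    rw [Action.smul_out, List.map_append, List.map_cons]
    refine hI.matched_openRes t ih ?_ (fresh_smul π h2) (fresh_smul π h3)
      ((occurs_smul_iff π _ _).2 h4)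
    rw [← List.map_append]
    simpa using h1
  | rep _ ih =>
    intro π B P σ Ψ Ψ₀ b Φ hI
    have ih := ih.smul π
    rw [PreAgent.smul_par, PreAgent.smul_rep] at ih
    rw [PreAgent.smul_rep] at hI
    exact hI.matched_rep ih
  | @inp_conv Ψ R K x z R' _ h ih =>
    intro π B P σ Ψ Ψ₀ b Φ hI
    -- Alpha-conversion changes neither environment nor source, so the hypothesis holds for the same
    -- instance and only the swap in the action and derivative has to be absorbed.
    have := ih π B P σ Ψ Ψ₀ b Φ hI
    rw [Action.smul_inp] at this ⊢
    rw [smul_swap_smul]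
    refine .inp_of_smul (π := Equiv.swap (π x) (π z)) ?_ (by simpa using this)
    intro e he he'
    rw [← smul_swap_smul] at he'
    refine Equiv.swap_apply_of_ne_of_ne ?_ he
    rintro rfl
    rw [occurs_smul_iff] at he'
    refine he' ?_
    rw [fresh_smul_iff', Equiv.swap_inv, Equiv.swap_apply_left]
    exact h
  | @out_conv Ψ R K a N R' c d _ h1 h2 h3 h4 ih =>
    intro π B P σ Ψ Ψ₀ b Φ hI
    have := ih π B P σ Ψ Ψ₀ b Φ hI
    rw [Action.smul_out] at this ⊢
    rw [smul_swap_smul, smul_swap_smul, map_swap_map]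
    refine .out_of_smul (π := Equiv.swap (π c) (π d)) ?_ (by simpa [Function.comp_def] using this)
    intro e he he'
    rw [← smul_swap_smul, ← smul_swap_smul] at he'
    rw [← map_swap_map] at he
    refine Equiv.swap_apply_of_ne_of_ne ?_ ?_
    · rintro rfl
      rw [occurs_smul_iff, occurs_smul_iff] at he'
      rcases he' with he' | he'
      · refine he' ?_
        rw [fresh_smul_iff', Equiv.swap_inv, Equiv.swap_apply_left]
        exact h3
      · refine he' ?_
        rw [fresh_smul_iff', Equiv.swap_inv, Equiv.swap_apply_left]
        exact h4
    · rintro rfl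
      exact he (List.mem_map_of_mem (List.mem_map.2 ⟨c, h1, Equiv.swap_apply_left c d⟩))

end Transitions
end Psi

/-! ### The simulation clause -/

namespace Psi

open NamedTerms (var)
open HasSubst (subst)

section Completeness

variable {T C A : Type u} [TermType T] [DataType T C] [DataType T A] {psi : PsiCalculus T C A}
  {Ψ : A} {P Q R' : PreAgent T C A} {σ : Substn T}

theorem cls_comp_unit_subst (σ : Substn T) (Ψ : A) :
    cls psi Ψ = cls psi (psi.comp (subst psi.unit σ) Ψ) := by
  rw [psi.unit_subst, cls_comp, cls_unit, one_mul]

/-- At top level the symbolic environment is the unit, so the concrete one is entirely the assertion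
`Ψ` of the solution. The set to avoid can contain any finite set in addition to all names involved.
-/
theorem Trans.exists_matched {α : Action T T} (h : Trans psi Ψ (P.subst σ) α R')
    (hP : P.WellFormed psi) (S : Finset Name) :
    ∃ B b Φ, S ⊆ B ∧ α.Matched psi B b Φ psi.unit Ψ σ P R' := by
  classical
  obtain ⟨b, Φ, hf, hb⟩ := exists_isFrame psi P (S ∪ nsupp P ∪ σ.supp ∪ nsupp Ψ)
  refine ⟨_, b, Φ, fun a ha => ?_,
    h.matchable.matched ⟨hP, rfl, cls_comp_unit_subst σ Ψ, hf, hb, fun w hw => ?_⟩⟩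
  · simp [ha]
  · simp only [Finset.mem_union, not_or, mem_nsupp, not_occurs] at hw
    exact ⟨hw.1.1.2, Substn.fresh_iff.2 hw.1.2, fresh_unit, hw.2, hw.2⟩

theorem Substn.update_self (σ : Substn T) (x : Name) : σ.update x (σ x) = σ := by
  have : (σ.update x (σ x)).toFun = σ.toFun := by
    funext a
    by_cases h : a = x
    · subst h; exact Substn.update_same ..
    · exact Substn.update_of_ne _ _ h
  cases σ
  simpa [Substn.update] using this

namespace Constraint

theorem exists_cover {D : Constraint psi} {p : Constraint psi → Prop}
    (h : ∀ σ Ψ, D.Sat σ Ψ → ∃ E, p E ∧ E.Sat σ Ψ) :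
    ∃ F : Set (Constraint psi), D.ImpliesSome F ∧ ∀ E ∈ F, p E :=
  ⟨{E | p E}, h, fun _ h => h⟩

theorem sat_of_andFresh {D : Constraint psi} {a : List Name} {P Q : Agent psi} {Ψ : A}
    (h : (D.andFresh a P Q).Sat σ Ψ) : D.Sat σ Ψ := by
  induction a with
  | nil => exact h
  | cons b a ih => exact ih h.1.1

end Constraint

variable {R : A → Agent psi → Agent psi → Prop} {P Q P' : Agent psi} {D : Constraint psi}
  {DP : TransConstraint C A}

theorem IsBisimulation.exists_symTrans_tau (hR : IsBisimulation psi R)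
    (hPQ : R Ψ (P.subst σ) (Q.subst σ)) (hT : SymTrans psi psi.unit P.1 .tau DP P'.1)
    (hDP : ∀ E ∈ DP, E.Sat psi σ Ψ) :
    ∃ (Q' : Agent psi) (DQ : TransConstraint C A), SymTrans psi psi.unit Q.1 .tau DQ Q'.1 ∧
      (∀ E ∈ DQ, E.Sat psi σ Ψ) ∧ R Ψ (P'.subst σ) (Q'.subst σ) := by
  have t : Trans psi Ψ (P.1.subst σ) .tau (P'.1.subst σ) :=
    Trans.congr (hT.realized σ Ψ hDP) (cls_comp_unit_subst σ Ψ)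
  obtain ⟨Q₁, t₁, h₁⟩ := hR.sim_other Ψ _ _ hPQ .tau (P'.subst σ) (by simp)
    (by simp [Action.bn, FreshAll]) (by simp [Action.bn, FreshAll]) t
  obtain ⟨B, b, Φ, -, DQ, Q', g1, g2, g3⟩ := Trans.exists_matched (P := Q.1) t₁ Q.2 ∅
  exact ⟨⟨Q', g1.wellFormed Q.2⟩, DQ, g1, g2, (Subtype.ext g3 : Agent.subst ⟨Q', _⟩ σ = Q₁) ▸ h₁⟩

theorem IsBisimulation.exists_symTrans_inp {y x : Name} (hR : IsBisimulation psi R)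
    (hPQ : R Ψ (P.subst σ) (Q.subst σ)) (hT : SymTrans psi psi.unit P.1 (.inp y x) DP P'.1)
    (hDP : ∀ E ∈ DP, E.Sat psi σ Ψ) (hxy : y ≠ x) (hx : Fresh x Q.1) (hy : Fresh y Q.1) :
    ∃ (Q' : Agent psi) (DQ : TransConstraint C A), SymTrans psi psi.unit Q.1 (.inp y x) DQ Q'.1 ∧
      (∀ E ∈ DQ, E.Sat psi σ Ψ) ∧ R Ψ (P'.subst σ) (Q'.subst σ) := by
  classical
  obtain ⟨z, hz, hzσ, -, hzP'⟩ := PreAgent.exists_binder σ σ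
    (DP.foldr (fun E S => E.names.toFinset ∪ S) ∅ ∪ nsupp (P.1.subst σ) ∪ nsupp (Q.1.subst σ) ∪
      nsupp Ψ) P'.1
  simp only [Finset.mem_union, not_or, mem_nsupp, not_occurs] at hz
  obtain ⟨⟨⟨hz1, hz2⟩, hz3⟩, hz4⟩ := hz
  have t : Trans psi Ψ (P.1.subst σ) (.inp (σ y) z) (P'.1.subst (σ.update x (var z))) :=
    Trans.congr (hT.realized σ Ψ hDP z (fun E hE h => hz1 (mem_foldr_names hE h)) hz2)
      (cls_comp_unit_subst σ Ψ)
  -- The early clause is used at the term `σ x`: replacing `z` by it restores the effect of `σ` on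
  -- `x`, so both derivatives become the instances under `σ` itself.
  obtain ⟨Q₁, t₁, h₁⟩ := hR.sim_inp Ψ _ _ hPQ (σ y) z (P'.subst (σ.update x (var z))) hz4 hz3 t
    (σ x)
  obtain ⟨B, b, Φ, hB, hm⟩ := Trans.exists_matched (P := Q.1) t₁ Q.2 {y, x}
  obtain ⟨c, Ψ', M, DQ, Q', g1, g2, -, g3⟩ := hm y (hB (by simp)) x (hB (by simp)) fresh_unit hy hx
    hxy rfl
  refine ⟨⟨Q', g1.wellFormed Q.2⟩, _, g1, g2, ?_⟩
  have e1 : (P'.subst (σ.update x (var z))).subst (.single z (σ x)) = P'.subst σ :=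
    Subtype.ext ((PreAgent.subst_update_single hzσ hzP').trans (by rw [Substn.update_self]; rfl))
  have e2 : Q₁.subst (.single z (σ x)) = Agent.subst ⟨Q', g1.wellFormed Q.2⟩ σ :=
    Subtype.ext ((g3 _).symm.trans (by rw [Substn.update_self]; rfl))
  rwa [e1, e2] at h₁

theorem IsBisimulation.exists_symTrans_out {y : Name} {a : List Name} {N : T}
    (hR : IsBisimulation psi R) (hPQ : R Ψ (P.subst σ) (Q.subst σ))
    (hT : SymTrans psi psi.unit P.1 (.out y a N) DP P'.1) (hDP : ∀ E ∈ DP, E.Sat psi σ Ψ)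
    (hya : y ∉ a) (ha : FreshAll a Q.1) (hy : Fresh y Q.1) :
    ∃ (Q' : Agent psi) (N' : T) (DQ : TransConstraint C A),
      SymTrans psi psi.unit Q.1 (.out y a N') DQ Q'.1 ∧ (∀ E ∈ DQ, E.Sat psi σ Ψ) ∧
      subst N σ = subst N' σ ∧ R Ψ (P'.subst σ) (Q'.subst σ) := by
  classical
  let _ := TermType.dataType T
  -- Being listed in an atomic constraint that `(σ, Ψ)` solves, the bound names are fresh for `σ`
  -- and `Ψ`, as the bisimulation clause for outputs requires.
  obtain ⟨E, hE, haE⟩ := hT.exists_outBn_subset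
  have haσ : ∀ e ∈ a, σ.Fresh e := fun e he => (hDP E hE).1 e (haE e he)
  have haΨ : FreshAll a Ψ := fun e he => (hDP E hE).2.1 e (haE e he)
  have t : Trans psi Ψ (P.1.subst σ) (.out (σ y) a (subst N σ)) (P'.1.subst σ) :=
    Trans.congr (hT.realized σ Ψ hDP) (cls_comp_unit_subst σ Ψ)
  obtain ⟨Q₁, t₁, h₁⟩ := hR.sim_other Ψ _ _ hPQ (.out (σ y) a (subst N σ)) (P'.subst σ)
    (by simp) haΨ
    (fun e he => PreAgent.fresh_subst (haσ e he) (ha e he)) t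
  obtain ⟨B, b, Φ, hB, hm⟩ := Trans.exists_matched (P := Q.1) t₁ Q.2
    (nsupp Q.1 ∪ {y} ∪ σ.supp ∪ nsupp Ψ)
  obtain ⟨c, Ψ', M, DQ, Q', a', N', g1, g2, -, g3, ρ, g4, g5, g6, g7⟩ :=
    hm y (hB (by simp)) fresh_unit hy rfl
  -- The lifted output has its own bound names, whereas the symbolic bisimulation demands the
  -- original ones. The permutation between them is made to fix `Q`, `y`, `σ` and `Ψ`, so its
  -- inverse renames the lifted transition, its constraint included, and keeps the solution.
  obtain ⟨ρ, g4, g5, e1, e2⟩ := exists_perm_extend t₁.bn_nodup g4 g5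
    (nsupp Q.1 ∪ {y} ∪ σ.supp ∪ nsupp Ψ) fun e he _ he' => g3 e he' (hB he)
  have fix : ∀ e ∈ nsupp Q.1 ∪ {y} ∪ σ.supp ∪ nsupp Ψ, ρ⁻¹ e = e := by
    intro e he
    rw [Equiv.Perm.inv_eq_iff_eq]
    refine (g5 e (fun h => ?_) (Or.inr (Or.inr he))).symm
    simp only [Finset.mem_union, mem_nsupp, Finset.mem_singleton] at he
    rcases he with ((he | he) | he) | he
    · exact he (ha e h)
    · exact hya (he ▸ h)
    · exact Substn.fresh_iff.1 (haσ e h) he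
    · exact he (haΨ e h)
  have fσ : ∀ e ∈ σ.supp, ρ⁻¹ e = e := fun e he => fix e (by simp [he])
  change a.map ρ = a' at g4
  have g1 := g1.smul ρ⁻¹
  have ea : a'.map ⇑ρ⁻¹ = a := by simp [← g4]
  rw [psi.smul_unit, smul_eq_of_fix fun e he => fix e (by simp [he]), Action.smul_out, ea,
    show ρ⁻¹ • y = y from fix y (by simp)] at g1
  have eN : subst N σ = subst (ρ⁻¹ • N') σ := by
    rw [← smul_subst_eq fun e _ => Substn.smul_apply_of_fix fσ e]
    exact (inv_smul_eq_iff.2 (g6.trans e1.symm)).symm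
  have eQ : (ρ⁻¹ • Q').subst σ = Q₁.1 := by
    rw [← PreAgent.smul_subst_eq fun e _ => Substn.smul_apply_of_fix fσ e]
    exact inv_smul_eq_iff.2 (g7.trans e2.symm)
  refine ⟨⟨ρ⁻¹ • Q', g1.wellFormed Q.2⟩, _, _, g1, fun E hE => ?_, eN,
    (Subtype.ext eQ : Agent.subst ⟨ρ⁻¹ • Q', g1.wellFormed Q.2⟩ σ = Q₁) ▸ h₁⟩
  obtain ⟨F, hF, rfl⟩ := List.mem_map.1 hE
  exact (g2 F hF).perm fσ fun e he => fix e (by simp [he])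

end Completeness

end Psi

theorem mainTheorem1 {T C A : Type u} [Psi.TermType T] [Psi.DataType T C] [Psi.DataType T A]
    (psi : Psi.PsiCalculus T C A) (R : A → Psi.Agent psi → Psi.Agent psi → Prop)
    (hR : Psi.IsBisimulation psi R)
    (definable : ∀ P Q : Psi.Agent psi, ∃ D : Psi.Constraint psi,
      ∀ σ Ψ, D.Sat σ Ψ ↔ R Ψ (P.subst σ) (Q.subst σ)) :
    Psi.IsSymbolicBisimulation psi
      (fun D P Q => ∀ σ Ψ, D.Sat σ Ψ → R Ψ (P.subst σ) (Q.subst σ)) := by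
  refine ⟨fun D P Q h σ Ψ hD φ => ?_, fun D P Q h σ Ψ hD => hR.symm _ _ _ (h σ Ψ hD), ?_⟩
  · rw [Psi.substFrameEntails_iff, Psi.substFrameEntails_iff]
    exact hR.static Ψ _ _ (h σ Ψ hD) φ
  intro D P Q h α DP P' hT hbn hsubj
  -- From here on a single solution is treated. The constraint found for it may depend on this
  -- solution, but its required property does not mention it.
  refine Psi.Constraint.exists_cover fun σ Ψ hD => ?_
  have hPQ := h σ Ψ hD.1
  cases α with
  | tau =>
    obtain ⟨Q', DQ, t, hs, hr⟩ := hR.exists_symTrans_tau hPQ hT hD.2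
    obtain ⟨E, hE⟩ := definable P' Q'
    -- The first conjunct makes the transition of `Q` available at every solution of the new
    -- constraint, the second puts the derivatives into `R` there.
    exact ⟨.and (.trans DQ) E, ⟨Q', _, DQ, t, fun _ _ h => h.1, rfl, fun σ Ψ h => (hE σ Ψ).1 h.2⟩,
      hs, (hE σ Ψ).2 hr⟩
  | inp y x =>
    have hx := hbn x (by simp [Psi.Action.bn])
    obtain ⟨Q', DQ, t, hs, hr⟩ := hR.exists_symTrans_inp hPQ hT hD.2 (hx.2.2.2.2 y rfl).symm hx.2.1
      (hsubj y rfl).2.1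
    obtain ⟨E, hE⟩ := definable P' Q'
    exact ⟨.and (.trans DQ) E, ⟨Q', _, DQ, t, fun _ _ h => h.1, rfl, fun σ Ψ h => (hE σ Ψ).1 h.2⟩,
      hs, (hE σ Ψ).2 hr⟩
  | out y a N =>
    obtain ⟨Q', N', DQ, t, hs, he, hr⟩ := hR.exists_symTrans_out hPQ hT hD.2
      (fun h => (hbn y h).2.2.2.2 y rfl rfl) (fun e he => (hbn e he).2.1) (hsubj y rfl).2.1
    obtain ⟨E, hE⟩ := definable P' Q'
    -- The equation is the additional requirement on output objects. The freshness conditions joined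
    -- for the derivatives only remove solutions.
    exact ⟨.and (.trans DQ) (.and (.eq N N') E),
      ⟨Q', _, DQ, t, fun _ _ h => h.1, N', rfl, fun _ _ h => h.2.1,
        fun σ Ψ h => (hE σ Ψ).1 (Psi.Constraint.sat_of_andFresh h).2.2⟩,
      hs, he, (hE σ Ψ).2 hr⟩
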